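/- Let $\mathbb K\in\{\mathbb R,\mathbb C\}$. **The function $g$.** Let $g:\mathbb R\to\mathbb R$ be a (strictly) increasing odd function of class $C^1$ with $1\in g(\mathbb R)$ (so that $g^{-1}$ is defined on $[0,1]$), $g(0)=g'(0)=0$ and $\frac{s\,g'(s)^2}{g(s)}\to 0$ as $s\to0$. Put $H(s)=\sqrt s\,g(\sqrt s)$ for $s\ge 0$, and let $s_0\in(0,1]$ be such that $g(s_0)<1$ and $H$ is strictly convex on $[0,s_0^2]$. Let $\widehat H=H$ on $[0,s_0^2]$ and $\widehat H=+\infty$ elsewhere, and define $$L(0)=0,\qquad L(r)=\frac1r\sup_{s\in\mathbb R}\bigl(rs-\widehat H(s)\bigr)\ (r>0),\qquad \Lambda_H(s)=\frac{H(s)}{sH'(s)}\ (0<s\le s_0^2),$$ $$\psi(s)=\frac1{H'(s_0^2)}+\int_{1/s}^{H'(s_0^2)}\frac{dv}{v^2\bigl(1-\Lambda_H((H')^{-1}(v))\bigr)}\qquad\Bigl(s\ge \frac1{H'(s_0^2)}\Bigr).$$ Here $(H')^{-1}:[0,H'(s_0^2)]\to[0,s_0^2]$ is the inverse of $H'$ on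 $[0,s_0^2]$, extended by the value $s_0^2$ to arguments larger than $H'(s_0^2)$. Moreover $\psi^{-1}:[1/H'(s_0^2),\infty)\to[1/H'(s_0^2),\infty)$ is extended by the value $1/H'(s_0^2)$ to arguments smaller than $1/H'(s_0^2)$. **The system.** Let $c_1,c_2>0$. Let $X$ be a Hilbert space over $\mathbb K$, $A:D(A)\to X$ densely defined and skew-adjoint ($A^*=-A$), $B:X\to X$ bounded, selfadjoint, nonnegative and nonzero, and $F:X\to X$ Lipschitz continuous on bounded subsets of $X$ with $\langle u,BF(u)\rangle_X\ge0$ for every $u\in X$. Let $(\Omega,\mu)$ be a probability space, $U:L^2(\Omega,\mu;\mathbb K)\to X$ a surjective linear isometry and $b\ge0$ a measurable function on $\Omega$ with $\|b\|_{L^\infty}=\|B\|$, such that $(U^{-1}BUf)(x)=b(x)f(x)$ for almost every $x$ and every $f\in L^2(\Omega,\mu)$. Put $\rho(f)=U^{-1}F(Uf)$. Assume that $\rho(0)=0$, that $\overline f\rho(f)\ge0$ almost everywhere for every $f\in L^2(\Omega,\mu)$, and that for every $f\in L^\infty(\Omega,\mu)$ $$c_1g(|f(x)|)\le|\rho(f)(x)|\le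 c_2g^{-1}(|f(x)|)\quad\text{for a.e. }x\text{ with }|f(x)|\le1,$$ $$c_1|f(x)|\le|\rho(f)(x)|\le c_2|f(x)|\quad\text{for a.e. }x\text{ with }|f(x)|\ge1.$$ Assume finally that $T>0$ and $C_T>0$ are such that $$C_T\|\phi(0)\|_X^2\le\int_0^T\|B^{1/2}\phi(t)\|_X^2\,dt$$ for every solution $\phi$ of $\phi'+A\phi=0$. **Theorem.** There are positive constants $C,\kappa_1,\kappa_2,\gamma_3$, depending only on $g,s_0,c_1,c_2$ (so not on the rest of the system, $T$, $C_T$, nor on the solution), such that the following holds for every system as above. (1) For every $u_0\in X$ there is a unique solution $u\in C^0([0,\infty);X)\cap C^1([0,\infty);D(A)')$ of $u'+Au+BF(u)=0$ with $u(0)=u_0$, where $D(A)'$ is the dual of $D(A)$ with respect to the pivot space $X$. If $u_0\in D(A)$, then $u\in C^0([0,\infty);D(A))\cap C^1([0,\infty);X)$. (2) Put $\gamma_2=\kappa_2\,\dfrac{C_T}{T^3\|B^{1/2}\|^4+T}$ and $\gamma_1=\kappa_1\,\dfrac{\|B\|}{\gamma_2}$. For every solution $u$, the energy $E_u(t)=\frac12\|u(t)\|_X^2$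 satisfies $$E_u(t)\le C\,\max(1,T)\,\max(\gamma_1,E_u(0))\,L\!\left(\frac1{\psi^{-1}(\gamma_2t)}\right)\qquad\text{for every }t\ge0.$$ (3) If moreover $\limsup_{s\searrow0}\Lambda_H(s)<1$, then for every solution $u$ $$E_u(t)\le C\,\max(1,T)\,\max(\gamma_1,E_u(0))\,(H')^{-1}\!\left(\frac{\gamma_3}{\gamma_2t}\right)\qquad\text{for every }t>0.$$ In particular, for a fixed system and fixed $T,C_T$, the rate is $(H')^{-1}(\gamma_3'/t)$, where $\gamma_3'=\gamma_3/\gamma_2$ does not depend on the solution. -/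

import Mathlib

open Set Filter Topology MeasureTheory
open scoped ComplexOrder

noncomputable section

/-! ### Unbounded operators and solutions of the evolution equation -/

section Operators

variable {𝕜 X : Type*} [RCLike 𝕜] [NormedAddCommGroup X] [InnerProductSpace 𝕜 X]

/-- A densely defined operator `A` with `A* = -A`. -/
def IsSkewAdjoint [CompleteSpace X] (A : X →ₗ.[𝕜] X) : Prop :=
  Dense (A.domain : Set X) ∧ A.adjoint = -A

/-- The domain `D(A)` with its graph norm, represented by the graph `{(v, A v)}` of `A` with the
norm inherited from `X × X`, that is `max ‖v‖ ‖A v‖`, which is equivalent to the graph norm. -/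
def GraphDomain (A : X →ₗ.[𝕜] X) : Type _ := A.graph

instance (A : X →ₗ.[𝕜] X) : NormedAddCommGroup (GraphDomain A) :=
  inferInstanceAs (NormedAddCommGroup A.graph)

instance (A : X →ₗ.[𝕜] X) : NormedSpace 𝕜 (GraphDomain A) :=
  inferInstanceAs (NormedSpace 𝕜 A.graph)

/-- The inclusion of `D(A)` in `X`. -/
def domainInclusion (A : X →ₗ.[𝕜] X) : GraphDomain A →L[𝕜] X :=
  (ContinuousLinearMap.fst 𝕜 X X).comp A.graph.subtypeL

/-- The operator `A` as a bounded operator from `D(A)` to `X`. -/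
def domainOperator (A : X →ₗ.[𝕜] X) : GraphDomain A →L[𝕜] X :=
  (ContinuousLinearMap.snd 𝕜 X X).comp A.graph.subtypeL

/-- The dual `D(A)'` of `D(A)`. -/
abbrev DomainDual (A : X →ₗ.[𝕜] X) : Type _ := StrongDual 𝕜 (GraphDomain A)

/-- The embedding of the pivot space `X` into `D(A)'`: `x ↦ (v ↦ ⟨x, v⟩)`. -/
def pivotEmbedding (A : X →ₗ.[𝕜] X) (x : X) : DomainDual A :=
  (innerSL 𝕜 x).comp (domainInclusion A)

/-- The extension to the whole of `X`, with values in `D(A)'`, of a skew-adjoint operator `A`: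
`x ↦ (v ↦ -⟨x, A v⟩)`. For `x ∈ D(A)` it is the image of `A x` under the embedding of `X` in
`D(A)'`. -/
def extendedOperator (A : X →ₗ.[𝕜] X) (x : X) : DomainDual A :=
  -((innerSL 𝕜 x).comp (domainOperator A))

/-- `u ∈ C⁰([0,∞); X) ∩ C¹([0,∞); D(A)')` solves `u' + A u + G(u) = 0`, as an equation in `D(A)'`.
For continuous `G` the continuity of the derivative follows from the equation, since its right-hand
side depends continuously on `t`. Only the values of `u` on `[0,∞)` matter. -/
structure IsWeakSolution (A : X →ₗ.[𝕜] X) (G : X → X) (u : ℝ → X) : Prop where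
  continuousOn : ContinuousOn u (Ici 0)
  equation : ∀ t : ℝ, 0 ≤ t →
    HasDerivWithinAt (fun τ => pivotEmbedding A (u τ))
      (-extendedOperator A (u t) - pivotEmbedding A (G (u t))) (Ici 0) t

/-- `u ∈ C⁰([0,∞); D(A)) ∩ C¹([0,∞); X)` solves `u' + A u + G(u) = 0`, as an equation in `X`;
here `w t = A (u t)`. -/
def IsStrongSolution [NormedSpace ℝ X] (A : X →ₗ.[𝕜] X) (G : X → X) (u : ℝ → X) : Prop :=
  ∃ w : ℝ → X, (∀ t : ℝ, 0 ≤ t → (u t, w t) ∈ A.graph) ∧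
    ContinuousOn u (Ici 0) ∧ ContinuousOn w (Ici 0) ∧
    ∀ t : ℝ, 0 ≤ t → HasDerivWithinAt u (-w t - G (u t)) (Ici 0) t

open Classical in
/-- The nonnegative square root `B^{1/2}` of a bounded selfadjoint nonnegative operator `B`: the
unique bounded selfadjoint nonnegative operator whose square is `B` (and `0` if there is none). -/
def posSqrt (B : X →L[𝕜] X) : X →L[𝕜] X :=
  if h : ∃ R : X →L[𝕜] X, R.IsPositive ∧ R.comp R = B then h.choose else 0

/-- The observability inequality
`C_T ‖φ(0)‖² ≤ ∫₀ᵀ ‖B^{1/2} φ(t)‖² dt` for all solutions of `φ' + A φ = 0`. -/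
def IsObservable (A : X →ₗ.[𝕜] X) (B : X →L[𝕜] X) (T CT : ℝ) : Prop :=
  ∀ φ : ℝ → X, IsWeakSolution A (fun _ => 0) φ →
    CT * ‖φ 0‖ ^ 2 ≤ ∫ t in (0 : ℝ)..T, ‖posSqrt B (φ t)‖ ^ 2

/-- The energy `E_u(t) = ½ ‖u(t)‖²`. -/
def energy {X : Type*} [NormedAddCommGroup X] (u : ℝ → X) (t : ℝ) : ℝ := 1 / 2 * ‖u t‖ ^ 2

/-- `F` is Lipschitz continuous on bounded subsets of `X`. -/
def LipschitzOnBounded {X : Type*} [NormedAddCommGroup X] (F : X → X) : Prop :=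
  ∀ r : ℝ, ∃ K : NNReal, LipschitzOnWith K F (Metric.closedBall 0 r)

end Operators

/-! ### The multiplication representation of `B` and the mapping `ρ` -/

section Representation

variable {𝕜 X Ω : Type*} [RCLike 𝕜] [NormedAddCommGroup X] [InnerProductSpace 𝕜 X]
  [MeasurableSpace Ω]

/-- `B` is unitarily equivalent, through the isometry `U` of `L²(Ω, μ)` onto `X`, to the
multiplication by the nonnegative essentially bounded function `b`, and
`‖b‖_{L^∞(Ω,μ)} = ‖B‖`. -/
structure IsMultiplicationRepresentation (B : X →L[𝕜] X) (μ : Measure Ω) (b : Ω → ℝ)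
    (U : Lp 𝕜 2 μ ≃ₗᵢ[𝕜] X) : Prop where
  measurable : Measurable b
  nonneg : ∀ x, 0 ≤ b x
  norm_eq : eLpNorm b ⊤ μ = ENNReal.ofReal ‖B‖
  apply_eq : ∀ f : Lp 𝕜 2 μ, ∀ᵐ x ∂μ, U.symm (B (U f)) x = (b x : 𝕜) * f x

/-- The mapping `F` viewed through the isometry `U`: `ρ(f) = U⁻¹ F(U f)`. -/
def pullback {μ : Measure Ω} (U : Lp 𝕜 2 μ ≃ₗᵢ[𝕜] X) (F : X → X) (f : Lp 𝕜 2 μ) : Lp 𝕜 2 μ :=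
  U.symm (F (U f))

/-- The comparison of `ρ` with `g`: for every `f ∈ L^∞(Ω, μ)`,
`c₁ g(|f|) ≤ |ρ(f)| ≤ c₂ g⁻¹(|f|)` almost everywhere on `{|f| ≤ 1}` and
`c₁ |f| ≤ |ρ(f)| ≤ c₂ |f|` almost everywhere on `{|f| ≥ 1}`. -/
def IsComparable {μ : Measure Ω} (g : ℝ → ℝ) (c₁ c₂ : ℝ) (ρ : Lp 𝕜 2 μ → Lp 𝕜 2 μ) : Prop :=
  ∀ f : Lp 𝕜 2 μ, MemLp f ⊤ μ → ∀ᵐ x ∂μ,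
    (‖f x‖ ≤ 1 → c₁ * g ‖f x‖ ≤ ‖ρ f x‖ ∧ ‖ρ f x‖ ≤ c₂ * Function.invFun g ‖f x‖) ∧
    (1 ≤ ‖f x‖ → c₁ * ‖f x‖ ≤ ‖ρ f x‖ ∧ ‖ρ f x‖ ≤ c₂ * ‖f x‖)

end Representation

/-! ### The function `g` and the functions built from it -/

section Profile

/-- `H(s) = √s g(√s)`. -/
def Hfun (g : ℝ → ℝ) (s : ℝ) : ℝ := √s * g √s

/-- The assumptions on `g` and `s₀`. The condition `one_mem_range` says that `g⁻¹` is defined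
on `[0,1]`. -/
structure IsProfile (g : ℝ → ℝ) (s₀ : ℝ) : Prop where
  strictMono : StrictMono g
  odd : ∀ s, g (-s) = -g s
  contDiff : ContDiff ℝ 1 g
  zero : g 0 = 0
  deriv_zero : deriv g 0 = 0
  one_mem_range : 1 ∈ range g
  tendsto : Tendsto (fun s => s * deriv g s ^ 2 / g s) (𝓝[≠] 0) (𝓝 0)
  s₀_pos : 0 < s₀
  s₀_le_one : s₀ ≤ 1
  g_s₀_lt_one : g s₀ < 1
  strictConvexOn : StrictConvexOn ℝ (Icc 0 (s₀ ^ 2)) (Hfun g)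

/-- The convex conjugate `r ↦ sup_s (r s - Ĥ(s))` of the function `Ĥ` that is equal to `H` on
`[0, s₀²]` and to `+∞` elsewhere; the supremum thus runs over `[0, s₀²]`. -/
def HhatConj (g : ℝ → ℝ) (s₀ r : ℝ) : ℝ :=
  sSup ((fun s => r * s - Hfun g s) '' Icc 0 (s₀ ^ 2))

/-- `L(0) = 0` and `L(r) = Ĥ*(r) / r` for `r > 0`. -/
def Lfun (g : ℝ → ℝ) (s₀ r : ℝ) : ℝ := if r = 0 then 0 else HhatConj g s₀ r / r

/-- `Λ_H(s) = H(s) / (s H'(s))`. -/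
def LambdaH (g : ℝ → ℝ) (s : ℝ) : ℝ := Hfun g s / (s * deriv (Hfun g) s)

/-- The inverse `(H')⁻¹` of the increasing function `H'` on `[0, s₀²]`, extended by the value
`s₀²` to the numbers larger than `H'(s₀²)`. -/
def HderivInv (g : ℝ → ℝ) (s₀ v : ℝ) : ℝ :=
  sSup {s : ℝ | s ∈ Icc 0 (s₀ ^ 2) ∧ deriv (Hfun g) s ≤ v}

/-- `ψ(s) = 1/H'(s₀²) + ∫_{1/s}^{H'(s₀²)} dv / (v² (1 - Λ_H((H')⁻¹(v))))`, for
`s ≥ 1/H'(s₀²)`. -/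
def psi (g : ℝ → ℝ) (s₀ s : ℝ) : ℝ :=
  1 / deriv (Hfun g) (s₀ ^ 2) +
    ∫ v in (1 / s)..(deriv (Hfun g) (s₀ ^ 2)),
      1 / (v ^ 2 * (1 - LambdaH g (HderivInv g s₀ v)))

/-- The inverse `ψ⁻¹` of the increasing function `ψ` on `[1/H'(s₀²), ∞)`, extended by the value
`1/H'(s₀²)` to the numbers smaller than the minimum `ψ(1/H'(s₀²)) = 1/H'(s₀²)` of `ψ`. -/
def psiInv (g : ℝ → ℝ) (s₀ τ : ℝ) : ℝ :=
  sInf {s : ℝ | 1 / deriv (Hfun g) (s₀ ^ 2) ≤ s ∧ τ ≤ psi g s₀ s}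

end Profile

end

/-!
The proof passes to the moving frame of the unitary group `S(t) = exp (-t A)`: for `v(t) = S(-t) u(t)`
the equation `u' + A u + B F(u) = 0` becomes the ordinary differential equation
`v' = -S(-t) B F(S(t) v)`, in which no unbounded operator is left (`IsMildSolution`).

*The group.* The resolvents `(l + A)⁻¹`, `l` real, exist by maximality of the graph of `A`. The bounded
operators `-(l² / 2) ((l + A)⁻¹ - (l - A)⁻¹)` are skew-adjoint, commute and tend to `A` on `D(A)` as
`l → ∞`; their exponentials converge to `S` (`IsSkewAdjoint.exists_unitaryGroup`).

*Well-posedness.* Weak and mild solutions are the same (`IsWeakSolution.isMildSolution`,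
`IsMildSolution.isWeakSolution`). Because `re ⟨u, B F(u)⟩ ≥ 0`, the norm of a solution is nonincreasing,
so that the nonlinearity can be truncated to a bounded globally Lipschitz one, for which the
Picard-Lindelöf theorem gives global solutions (`exists_isMildSolution`). If `u(0) ∈ D(A)`, the
increments `u(t + h) - u(t)` are `O(h)` for every `t`, which forces `u(t) ∈ D(A)` by maximality; then
`u` is differentiable at every `t`, its derivative is weakly continuous, and the norm of the derivative
is continuous since `‖u'(s)‖ ≤ exp (K |s - t|) ‖u'(t)‖` for all `s, t` (`IsMildSolution.isStrongSolution`).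

*The energy inequality.* Duhamel's formula transfers the observability inequality to the damped
equation (`IsObservable.energy_le`): with `K = T² ‖B^{1/2}‖⁴ + 1`,
`C_T E(0) ≤ K ∫₀ᵀ (‖B^{1/2} u‖² + ‖B^{1/2} F(u)‖²)`. The Fenchel-Young inequality for `H` on the part of
`Ω` where `|f|` is small, and a direct comparison elsewhere, bound `r` times the integrand by
`C₃ ‖B‖ Ĥ*(r) + C₄ (1 + r) ⟨u, B F(u)⟩` for every weight `r ∈ [0, H'(s₀²)]` (`weighted_energy_le`),
and the integral of `⟨u, B F(u)⟩` over a period is the loss of energy. Hence, with `δ = γ₂ T` and a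
constant `β` proportional to `max (γ₁, E(0))`,
`E((n + 1) T) ≤ (1 - 2 δ r) E(n T) + δ r β L(r)` for every such `r`.

*The decay rate.* The profile `y(τ) = L(r(τ))`, `r(τ) = 1 / ψ⁻¹(τ)`, satisfies
`y(τ + δ) ≥ (1 - δ r(τ)) y(τ)` (`IsProfile.Lfun_psiInv_add`). With the weight `r = r(n δ)` taken from the
profile, induction on `n` gives `E(n T) ≤ β y(n δ)` (`IsProfile.energy_decay`). Since `r` is chosen
independently of the energy, no inversion of `L` is needed. If `limsup Λ_H < 1`, then `ψ` grows at most
linearly, and `L(r) ≤ (H')⁻¹(r)` gives the simplified rate.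
-/

set_option linter.unusedSectionVars false

/-! ### Skew-adjoint operators and their resolvents -/

section SkewAdjoint

variable {𝕜 X : Type*} [RCLike 𝕜] [NormedAddCommGroup X] [InnerProductSpace 𝕜 X] [CompleteSpace X]
  {A : X →ₗ.[𝕜] X}

theorem IsSkewAdjoint.inner_graph (hA : IsSkewAdjoint A) {x y x' y' : X}
    (h : (x, y) ∈ A.graph) (h' : (x', y') ∈ A.graph) :
    inner 𝕜 y x' = -inner 𝕜 x y' := by
  obtain ⟨a, rfl, rfl⟩ := (LinearPMap.mem_graph_iff A).1 h
  obtain ⟨a', rfl, rfl⟩ := (LinearPMap.mem_graph_iff A).1 h'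
  have hform := LinearPMap.adjoint_isFormalAdjoint hA.1
  rw [hA.2] at hform
  have := hform (⟨a, a.2⟩ : (-A).domain) a'
  rw [LinearPMap.neg_apply, inner_neg_left] at this
  exact neg_eq_iff_eq_neg.1 this

/-- The maximality of a skew-adjoint operator: a pair that is formally skew to the whole graph
belongs to the graph. -/
theorem IsSkewAdjoint.mem_graph (hA : IsSkewAdjoint A) {x y : X}
    (h : ∀ x' y', (x', y') ∈ A.graph → inner 𝕜 y x' = -inner 𝕜 x y') : (x, y) ∈ A.graph := by
  have h2 : ∀ a : A.domain, inner 𝕜 (-y) (a : X) = inner 𝕜 x (A a) := fun a => by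
    rw [inner_neg_left, h _ _ (LinearPMap.mem_graph A a), neg_neg]
  have hx : x ∈ A.adjoint.domain := LinearPMap.mem_adjoint_domain_of_exists _ ⟨_, h2⟩
  have hy := LinearPMap.adjoint_apply_eq hA.1 ⟨x, hx⟩ h2
  have hg : (x, -y) ∈ (-A).graph := by
    rw [← hA.2]
    exact (LinearPMap.mem_graph_iff _).2 ⟨⟨x, hx⟩, rfl, hy⟩
  obtain ⟨a, ha, hb⟩ := (LinearPMap.mem_graph_iff _).1 hg
  rw [LinearPMap.neg_apply] at hb
  exact (LinearPMap.mem_graph_iff _).2 ⟨a, ha, neg_injective hb⟩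

theorem IsSkewAdjoint.graph_isClosed (hA : IsSkewAdjoint A) :
    IsClosed (A.graph : Set (X × X)) := by
  have : (A.graph : Set (X × X)) = ⋂ p : A.graph,
      {q : X × X | inner 𝕜 q.2 (p : X × X).1 = -inner 𝕜 q.1 (p : X × X).2} := by
    ext ⟨x, y⟩
    simp only [SetLike.mem_coe, mem_iInter, mem_ofPred_eq]
    exact ⟨fun h p => hA.inner_graph h p.2, fun h => hA.mem_graph fun x' y' h' => h ⟨_, h'⟩⟩
  rw [this]
  exact isClosed_iInter fun p => isClosed_eq (by fun_prop) (by fun_prop)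

theorem IsSkewAdjoint.re_inner_graph (hA : IsSkewAdjoint A) {x y : X} (h : (x, y) ∈ A.graph) :
    RCLike.re (inner 𝕜 x y) = 0 := by
  have h1 := congrArg RCLike.re (hA.inner_graph h h)
  rw [map_neg, ← inner_conj_symm x y, RCLike.conj_re] at h1
  rw [← inner_conj_symm x y, RCLike.conj_re]
  linarith

theorem IsSkewAdjoint.norm_sq_resolvent (hA : IsSkewAdjoint A) {x y : X} (h : (x, y) ∈ A.graph)
    (l : ℝ) : ‖(l : 𝕜) • x + y‖ ^ 2 = l ^ 2 * ‖x‖ ^ 2 + ‖y‖ ^ 2 := by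
  rw [@norm_add_sq 𝕜, inner_smul_left, norm_smul, RCLike.conj_ofReal, RCLike.re_ofReal_mul,
    hA.re_inner_graph h, RCLike.norm_ofReal, mul_pow, sq_abs]
  ring

/-- The resolvent equation `l x + A x = z` is solvable for every real `l ≠ 0`. -/
theorem IsSkewAdjoint.exists_resolvent (hA : IsSkewAdjoint A) {l : ℝ} (hl : l ≠ 0) (z : X) :
    ∃ x, (x, z - (l : 𝕜) • x) ∈ A.graph := by
  let Φ : A.graph →ₗ[𝕜] X :=
    (((l : 𝕜) • LinearMap.fst 𝕜 X X + LinearMap.snd 𝕜 X X)).comp A.graph.subtype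
  have hΦ : ∀ p : A.graph, ‖Φ p‖ ^ 2 = l ^ 2 * ‖(p : X × X).1‖ ^ 2 + ‖(p : X × X).2‖ ^ 2 :=
    fun p => hA.norm_sq_resolvent p.2 l
  have hcs : CompleteSpace A.graph := hA.graph_isClosed.completeSpace_coe
  obtain ⟨c, hc, hcl, hc1⟩ : ∃ c : ℝ, 0 < c ∧ c ≤ |l| ∧ c ≤ 1 :=
    ⟨min |l| 1, by positivity, min_le_left _ _, min_le_right _ _⟩
  have hanti : ∀ p : A.graph, c * ‖p‖ ≤ ‖Φ p‖ := fun p => by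
    have h1 : c * ‖(p : X × X).1‖ ≤ ‖Φ p‖ := by
      refine abs_le_of_sq_le_sq' ?_ (norm_nonneg _) |>.2
      rw [hΦ, mul_pow]
      have : c ^ 2 ≤ l ^ 2 := by rw [← sq_abs l]; gcongr
      nlinarith [sq_nonneg ‖(p : X × X).1‖, sq_nonneg ‖(p : X × X).2‖]
    have h2 : c * ‖(p : X × X).2‖ ≤ ‖Φ p‖ := by
      refine abs_le_of_sq_le_sq' ?_ (norm_nonneg _) |>.2
      rw [hΦ, mul_pow]
      have : c ^ 2 ≤ 1 := by nlinarith
      nlinarith [sq_nonneg ‖(p : X × X).2‖, mul_nonneg (sq_nonneg l) (sq_nonneg ‖(p : X × X).1‖)]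
    have : ‖p‖ = max ‖(p : X × X).1‖ ‖(p : X × X).2‖ := rfl
    rw [this, mul_max_of_nonneg _ _ hc.le]
    exact max_le h1 h2
  have hcont : Continuous Φ := by
    change Continuous fun p : A.graph => (l : 𝕜) • (p : X × X).1 + (p : X × X).2
    fun_prop
  have hanti' : AntilipschitzWith c.toNNReal⁻¹ Φ := by
    refine AddMonoidHomClass.antilipschitz_of_bound Φ fun p => ?_
    have := hanti p
    rw [NNReal.coe_inv, Real.coe_toNNReal _ hc.le, inv_mul_eq_div, le_div_iff₀ hc]
    linarith
  have hclosed : IsClosed (Φ.range : Set X) := by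
    rw [LinearMap.coe_range]
    exact (hanti'.isClosedEmbedding
      ((ContinuousLinearMap.mk Φ hcont).uniformContinuous)).isClosed_range
  have : CompleteSpace Φ.range := hclosed.completeSpace_coe
  have hbot : Φ.rangeᗮ = ⊥ := by
    rw [Submodule.eq_bot_iff]
    intro w hw
    have horth : ∀ x y, (x, y) ∈ A.graph → inner 𝕜 w ((l : 𝕜) • x + y) = 0 := fun x y h =>
      Submodule.inner_left_of_mem_orthogonal (LinearMap.mem_range_self Φ ⟨_, h⟩) hw
    have hmem : (w, (l : 𝕜) • w) ∈ A.graph := hA.mem_graph fun x y h => by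
      have := horth x y h
      rw [inner_add_right, inner_smul_right] at this
      rw [inner_smul_left, RCLike.conj_ofReal]
      exact eq_neg_of_add_eq_zero_left this
    have h1 := hA.re_inner_graph hmem
    rw [inner_smul_right, RCLike.re_ofReal_mul, inner_self_eq_norm_sq] at h1
    have := (mul_eq_zero.1 h1).resolve_left hl
    exact norm_eq_zero.1 (pow_eq_zero_iff two_ne_zero |>.1 this)
  have htop : Φ.range = ⊤ := (Submodule.orthogonal_eq_bot_iff).1 hbot
  obtain ⟨p, hp⟩ : z ∈ Φ.range := by rw [htop]; trivial
  refine ⟨(p : X × X).1, ?_⟩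
  have : z - (l : 𝕜) • (p : X × X).1 = (p : X × X).2 := by
    rw [← hp]; exact add_sub_cancel_left _ _
  rw [this]
  exact p.2

theorem IsSkewAdjoint.resolvent_unique (hA : IsSkewAdjoint A) {l : ℝ} (hl : l ≠ 0) {x x' z : X}
    (h : (x, z - (l : 𝕜) • x) ∈ A.graph) (h' : (x', z - (l : 𝕜) • x') ∈ A.graph) : x = x' := by
  have h1 := hA.norm_sq_resolvent (A.graph.sub_mem h h') l
  have h2 : (l : 𝕜) • (x - x') + (z - (l : 𝕜) • x - (z - (l : 𝕜) • x')) = 0 := by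
    rw [smul_sub]; abel
  simp only at h1
  rw [h2, norm_zero] at h1
  have h3 : l ^ 2 * ‖x - x'‖ ^ 2 = 0 := by
    nlinarith [sq_nonneg ‖z - (l : 𝕜) • x - (z - (l : 𝕜) • x')‖,
      mul_nonneg (sq_nonneg l) (sq_nonneg ‖x - x'‖)]
  rw [mul_eq_zero, or_iff_right (pow_ne_zero 2 hl)] at h3
  exact sub_eq_zero.1 (norm_eq_zero.1 (pow_eq_zero_iff two_ne_zero |>.1 h3))

/-- `R` is the resolvent family `R l = (l + A)⁻¹`, for real `l ≠ 0`. -/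
def IsResolvent (A : X →ₗ.[𝕜] X) (R : ℝ → X →L[𝕜] X) : Prop :=
  ∀ l ≠ 0, ∀ z, (R l z, z - (l : 𝕜) • R l z) ∈ A.graph

theorem IsSkewAdjoint.exists_resolvent_clm (hA : IsSkewAdjoint A) :
    ∃ R : ℝ → X →L[𝕜] X, IsResolvent A R := by
  have key : ∀ l : ℝ, ∃ R : X →L[𝕜] X, l ≠ 0 → ∀ z, (R z, z - (l : 𝕜) • R z) ∈ A.graph := by
    intro l
    by_cases hl : l = 0
    · exact ⟨0, fun h => absurd hl h⟩
    choose r hr using hA.exists_resolvent hl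
    refine ⟨LinearMap.mkContinuous
      { toFun := r
        map_add' := fun z z' => hA.resolvent_unique hl (hr _) ?_
        map_smul' := fun c z => hA.resolvent_unique hl (hr _) ?_ } |l|⁻¹ fun z => ?_, fun _ => hr⟩
    · convert! A.graph.add_mem (hr z) (hr z') using 1
      ext <;> simp only [Prod.mk_add_mk, smul_add]
      abel
    · convert! A.graph.smul_mem c (hr z) using 1
      ext
      · simp
      · simp only [RingHom.id_apply, Prod.smul_mk, smul_sub]
        rw [smul_comm]
    · change ‖r z‖ ≤ _
      have h1 := hA.norm_sq_resolvent (hr z) l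
      rw [add_sub_cancel] at h1
      rw [inv_mul_eq_div, le_div_iff₀ (abs_pos.2 hl)]
      refine abs_le_of_sq_le_sq' ?_ (norm_nonneg _) |>.2
      rw [mul_pow, sq_abs]
      nlinarith [sq_nonneg ‖z - (l : 𝕜) • r z‖]
  choose R hR using key
  exact ⟨R, fun l hl => hR l hl⟩

variable {R : ℝ → X →L[𝕜] X}

theorem IsResolvent.norm_le (hA : IsSkewAdjoint A) (hR : IsResolvent A R) {l : ℝ} (hl : l ≠ 0)
    (z : X) : |l| * ‖R l z‖ ≤ ‖z‖ := by
  have h1 := hA.norm_sq_resolvent (hR l hl z) l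
  rw [add_sub_cancel] at h1
  refine abs_le_of_sq_le_sq' ?_ (norm_nonneg _) |>.2
  rw [mul_pow, sq_abs]
  nlinarith [sq_nonneg ‖z - (l : 𝕜) • R l z‖]

theorem IsResolvent.apply_graph (hA : IsSkewAdjoint A) (hR : IsResolvent A R) {l : ℝ} (hl : l ≠ 0)
    {x y : X} (h : (x, y) ∈ A.graph) : R l ((l : 𝕜) • x + y) = x :=
  hA.resolvent_unique hl (hR l hl _) (by rwa [add_sub_cancel_left])

theorem IsResolvent.commute (hA : IsSkewAdjoint A) (hR : IsResolvent A R) {l m : ℝ} (hl : l ≠ 0)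
    (hm : m ≠ 0) : Commute (R l) (R m) := by
  ext z
  change R l (R m z) = R m (R l z)
  set p := R m z with hp
  set q := R l p with hq
  have hpg : (p, z - (m : 𝕜) • p) ∈ A.graph := hR m hm z
  have hqg : (q, p - (l : 𝕜) • q) ∈ A.graph := hR l hl p
  -- `R l (A p) = A q`, because `l p + A p` is sent to `p`
  have h1 : R l (z - (m : 𝕜) • p) = p - (l : 𝕜) • q := by
    have := hR.apply_graph hA hl hpg
    rw [map_add, map_smul, ← hq] at this
    exact eq_sub_of_add_eq' this
  have h2 : R l z = (m : 𝕜) • q + (p - (l : 𝕜) • q) := by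
    rw [← h1, map_sub, map_smul, ← hq]; abel
  rw [h2, hR.apply_graph hA hm hqg]

theorem IsResolvent.inner_apply (hA : IsSkewAdjoint A) (hR : IsResolvent A R) {l : ℝ} (hl : l ≠ 0)
    (z w : X) : inner 𝕜 (R l z) w = -inner 𝕜 z (R (-l) w) := by
  have h := hA.inner_graph (hR l hl z) (hR (-l) (neg_ne_zero.2 hl) w)
  simp only [inner_sub_left, inner_sub_right, inner_smul_left, inner_smul_right,
    RCLike.conj_ofReal, RCLike.ofReal_neg] at h
  linear_combination h

end SkewAdjoint

/-! ### The unitary group generated by a skew-adjoint operator -/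

section BoundedGroup

theorem tendsto_of_tendsto_on_dense {ι E F : Type*} [SeminormedAddCommGroup E]
    [SeminormedAddCommGroup F] {l : Filter ι} {f : ι → E → F} {g : E → F} {D : Set E} {C : ℝ}
    (hD : Dense D) (hf : ∀ᶠ i in l, ∀ x y, ‖f i x - f i y‖ ≤ C * ‖x - y‖)
    (hg : ∀ x y, ‖g x - g y‖ ≤ C * ‖x - y‖)
    (h : ∀ x ∈ D, Tendsto (fun i => f i x) l (𝓝 (g x))) (x : E) :
    Tendsto (fun i => f i x) l (𝓝 (g x)) := by
  rw [Metric.tendsto_nhds]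
  intro ε hε
  have hC : 0 < |C| + 1 := by positivity
  obtain ⟨y, hy, hxy⟩ := hD.exists_dist_lt x (ε := ε / (3 * (|C| + 1))) (by positivity)
  rw [dist_eq_norm] at hxy
  have hb : C * ‖x - y‖ < ε / 3 := by
    calc C * ‖x - y‖ ≤ (|C| + 1) * ‖x - y‖ := by
          gcongr; linarith [le_abs_self C]
      _ < (|C| + 1) * (ε / (3 * (|C| + 1))) := by gcongr
      _ = ε / 3 := by field_simp
  filter_upwards [hf, Metric.tendsto_nhds.1 (h y hy) (ε / 3) (by positivity)] with i h1 h2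
  rw [dist_eq_norm] at h2 ⊢
  calc ‖f i x - g x‖ = ‖(f i x - f i y) + (f i y - g y) + (g y - g x)‖ := by congr 1; abel
    _ ≤ ‖f i x - f i y‖ + ‖f i y - g y‖ + ‖g y - g x‖ := norm_add₃_le
    _ < ε / 3 + ε / 3 + ε / 3 := by
      have h3 := h1 x y
      have h4 := hg x y
      rw [norm_sub_rev] at h4
      gcongr <;> linarith
    _ = ε := by ring

variable {𝕜 X : Type*} [RCLike 𝕜] [NormedAddCommGroup X] [InnerProductSpace 𝕜 X] [CompleteSpace X]

/-- The group `t ↦ exp (t C)` of a bounded operator. -/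
noncomputable def expGroup (C : X →L[𝕜] X) (t : ℝ) : X →L[𝕜] X := NormedSpace.exp ((t : 𝕜) • C)

theorem expGroup_zero (C : X →L[𝕜] X) : expGroup C 0 = 1 := by
  simp [expGroup]

theorem expGroup_add (C : X →L[𝕜] X) (s t : ℝ) :
    expGroup C (s + t) = expGroup C s * expGroup C t := by
  let : NormedAlgebra ℚ (X →L[𝕜] X) := NormedAlgebra.restrictScalars ℚ 𝕜 _
  rw [expGroup, RCLike.ofReal_add, add_smul]
  exact NormedSpace.exp_add_of_commute (((Commute.refl C).smul_left _).smul_right _)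

theorem expGroup_add_of_commute {C D : X →L[𝕜] X} (h : Commute C D) (t : ℝ) :
    expGroup (C + D) t = expGroup C t * expGroup D t := by
  let : NormedAlgebra ℚ (X →L[𝕜] X) := NormedAlgebra.restrictScalars ℚ 𝕜 _
  rw [expGroup, smul_add]
  exact NormedSpace.exp_add_of_commute ((h.smul_left _).smul_right _)

theorem commute_expGroup {C D : X →L[𝕜] X} (h : Commute D C) (t : ℝ) :
    Commute D (expGroup C t) := by
  let : NormedAlgebra ℚ (X →L[𝕜] X) := NormedAlgebra.restrictScalars ℚ 𝕜 _
  exact Commute.exp_right (h.smul_right _)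

variable [NormedSpace ℝ X] [IsScalarTower ℝ 𝕜 X]

theorem hasDerivAt_expGroup (C : X →L[𝕜] X) (x : X) (t : ℝ) :
    HasDerivAt (fun s => expGroup C s x) (expGroup C t (C x)) t := by
  have h1 : HasDerivAt (fun u : 𝕜 => NormedSpace.exp (u • C)) (NormedSpace.exp ((t : 𝕜) • C) * C)
      (t : 𝕜) := hasDerivAt_exp_smul_const C (t : 𝕜)
  have h2 := h1.clm_apply (hasDerivAt_const (t : 𝕜) x)
  have h3 := (h2.hasFDerivAt.restrictScalars ℝ).comp_hasDerivAt t
    (RCLike.ofRealCLM (K := 𝕜)).hasDerivAt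
  simpa [expGroup, Function.comp_def] using h3

theorem expGroup_norm {C : X →L[𝕜] X} (hC : ∀ x y, inner 𝕜 (C x) y = -inner 𝕜 x (C y)) (t : ℝ)
    (x : X) : ‖expGroup C t x‖ = ‖x‖ := by
  have hd : ∀ s, HasDerivAt (fun s => inner 𝕜 (expGroup C s x) (expGroup C s x)) 0 s := fun s => by
    have h := (hasDerivAt_expGroup C x s).inner 𝕜 (hasDerivAt_expGroup C x s)
    have hc : expGroup C s (C x) = C (expGroup C s x) :=
      DFunLike.congr_fun (commute_expGroup (Commute.refl C) s).symm x
    rwa [hc, hC, add_neg_cancel] at h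
  have h := is_const_of_deriv_eq_zero (fun s => (hd s).differentiableAt) (fun s => (hd s).deriv) t 0
  simp only [expGroup_zero, one_apply_eq_self, inner_self_eq_norm_sq_to_K] at h
  have h' : ‖expGroup C t x‖ ^ 2 = ‖x‖ ^ 2 := by exact_mod_cast h
  exact (pow_left_inj₀ (norm_nonneg _) (norm_nonneg _) two_ne_zero).1 h'

theorem expGroup_sub_le {C D : X →L[𝕜] X} (hC : ∀ x y, inner 𝕜 (C x) y = -inner 𝕜 x (C y))
    (hD : ∀ x y, inner 𝕜 (D x) y = -inner 𝕜 x (D y)) (h : Commute C D) (t : ℝ) (x : X) :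
    ‖expGroup C t x - expGroup D t x‖ ≤ |t| * ‖C x - D x‖ := by
  have hsub : ∀ x y, inner 𝕜 ((D - C) x) y = -inner 𝕜 x ((D - C) y) := fun x y => by
    simp only [sub_apply, inner_sub_left, inner_sub_right, hC, hD]; ring
  have h1 : expGroup D t x = expGroup C t (expGroup (D - C) t x) := by
    have := expGroup_add_of_commute (C := C) (D := D - C) (h.sub_right (Commute.refl C)) t
    rw [add_sub_cancel] at this
    rw [this]; rfl
  have h2 := Convex.norm_image_sub_le_of_norm_hasDerivWithin_le
    (f := fun s => expGroup (D - C) s x) (C := ‖D x - C x‖) (s := univ) (x := 0) (y := t)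
    (fun s _ => (hasDerivAt_expGroup (D - C) x s).hasDerivWithinAt)
    (fun s _ => by rw [expGroup_norm hsub]; rfl) convex_univ (mem_univ _) (mem_univ _)
  simp only [expGroup_zero, one_apply_eq_self, sub_zero, Real.norm_eq_abs] at h2
  rw [h1, ← map_sub, expGroup_norm hC, norm_sub_rev, mul_comm, norm_sub_rev (C x)]
  exact h2

end BoundedGroup

section UnitaryGroup

variable {𝕜 X : Type*} [RCLike 𝕜] [NormedAddCommGroup X] [InnerProductSpace 𝕜 X]
  [NormedSpace ℝ X]

/-- `S` is the strongly continuous group of isometries `t ↦ exp (-t A)`: it preserves the graph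
of `A`, and for `x ∈ D(A)` the orbit `t ↦ S t x` is a differentiable solution of `φ' + A φ = 0`. -/
structure IsUnitaryGroup (A : X →ₗ.[𝕜] X) (S : ℝ → X →L[𝕜] X) : Prop where
  zero : ∀ x, S 0 x = x
  add : ∀ s t x, S (s + t) x = S s (S t x)
  norm : ∀ t x, ‖S t x‖ = ‖x‖
  continuous : ∀ x, Continuous fun t => S t x
  graph : ∀ {x y}, (x, y) ∈ A.graph → ∀ t, (S t x, S t y) ∈ A.graph
  hasDerivAt : ∀ {x y}, (x, y) ∈ A.graph → ∀ t, HasDerivAt (fun s => S s x) (-S t y) t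

variable [CompleteSpace X] [IsScalarTower ℝ 𝕜 X] {A : X →ₗ.[𝕜] X} {R : ℝ → X →L[𝕜] X}

/-- On `D(A)` the operators `l (l + A)⁻¹` converge to the identity. -/
theorem IsResolvent.tendsto_smul (hA : IsSkewAdjoint A) (hR : IsResolvent A R) {l : ℕ → ℝ}
    (hl0 : ∀ n, l n ≠ 0) (hl : Tendsto (fun n => |l n|) atTop atTop) (z : X) :
    Tendsto (fun n => (l n : 𝕜) • R (l n) z) atTop (𝓝 z) := by
  have hb : ∀ n z, ‖(l n : 𝕜) • R (l n) z‖ ≤ ‖z‖ := fun n z => by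
    rw [norm_smul, RCLike.norm_ofReal]
    exact hR.norm_le hA (hl0 n) z
  refine tendsto_of_tendsto_on_dense (f := fun n z => (l n : 𝕜) • R (l n) z) (g := id) (C := 1)
    hA.1 (.of_forall fun n x y => ?_) (fun x y => by simp) (fun x hx => ?_) z
  · rw [one_mul, ← smul_sub, ← map_sub]
    exact hb n _
  · have h := LinearPMap.mem_graph A ⟨x, hx⟩
    set y := A ⟨x, hx⟩
    have he : ∀ n, (l n : 𝕜) • R (l n) x = x - R (l n) y := fun n => by
      have := hR.apply_graph hA (hl0 n) h
      rw [map_add, map_smul] at this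
      exact eq_sub_of_add_eq this
    have h0 : Tendsto (fun n => R (l n) y) atTop (𝓝 0) := by
      refine squeeze_zero_norm (a := fun n => |l n|⁻¹ * ‖y‖) (fun n => ?_) ?_
      · rw [inv_mul_eq_div, le_div_iff₀ (abs_pos.2 (hl0 n)), mul_comm]
        exact hR.norm_le hA (hl0 n) y
      · simpa using hl.inv_tendsto_atTop.mul_const ‖y‖
    simp only [he]
    simpa using tendsto_const_nhds.sub h0

/-- There are bounded, mutually commuting skew-adjoint operators `C n` that commute with the
resolvent of `A` and converge to `-A` on `D(A)`. -/
theorem IsResolvent.exists_approximation (hA : IsSkewAdjoint A) (hR : IsResolvent A R) :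
    ∃ C : ℕ → X →L[𝕜] X, (∀ n x y, inner 𝕜 (C n x) y = -inner 𝕜 x (C n y)) ∧
      (∀ n m, Commute (C n) (C m)) ∧ (∀ n, Commute (R 1) (C n)) ∧
      ∀ x y, (x, y) ∈ A.graph → Tendsto (fun n => C n x) atTop (𝓝 (-y)) := by
  have hpos : ∀ n : ℕ, ((n : ℝ) + 1) ≠ 0 := fun n => by positivity
  have hneg : ∀ n : ℕ, -((n : ℝ) + 1) ≠ 0 := fun n => neg_ne_zero.2 (hpos n)
  have hlim : Tendsto (fun n : ℕ => |(n : ℝ) + 1|) atTop atTop :=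
    tendsto_abs_atTop_atTop.comp
      (tendsto_atTop_add_const_right _ _ tendsto_natCast_atTop_atTop)
  refine ⟨fun n => ((((n : ℝ) + 1) ^ 2 / 2 : ℝ) : 𝕜) • (R (n + 1) + R (-(n + 1))),
    fun n x y => ?_, fun n m => ?_, fun n => ?_, fun x y h => ?_⟩
  · have h1 := hR.inner_apply hA (hpos n) x y
    have h2 := hR.inner_apply hA (hneg n) x y
    rw [neg_neg] at h2
    simp only [smul_apply, add_apply, inner_smul_left,
      inner_smul_right, inner_add_left, inner_add_right, RCLike.conj_ofReal, h1, h2]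
    ring
  · exact (((hR.commute hA (hpos n) (hpos m)).add_right (hR.commute hA (hpos n) (hneg m))).add_left
      ((hR.commute hA (hneg n) (hpos m)).add_right (hR.commute hA (hneg n) (hneg m)))).smul_left _
      |>.smul_right _
  · exact ((hR.commute hA one_ne_zero (hpos n)).add_right
      (hR.commute hA one_ne_zero (hneg n))).smul_right _
  · -- `l² (R l + R (-l)) x = -(l R l y + (-l) R (-l) y)` with `l = n + 1`
    have he : ∀ n : ℕ, ((((n : ℝ) + 1) ^ 2 / 2 : ℝ) : 𝕜) • (R (n + 1) x + R (-(n + 1)) x) =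
        -((1 / 2 : 𝕜) • ((((n : ℝ) + 1 : ℝ) : 𝕜) • R (n + 1) y +
          ((-((n : ℝ) + 1) : ℝ) : 𝕜) • R (-(n + 1)) y)) := fun n => by
      have h1 := hR.apply_graph hA (hpos n) h
      have h2 := hR.apply_graph hA (hneg n) h
      rw [map_add, map_smul] at h1 h2
      set a := R ((n : ℝ) + 1) x
      set b := R (-((n : ℝ) + 1)) x
      rw [← eq_sub_iff_add_eq'] at h1 h2
      rw [h1, h2]
      simp only [RCLike.ofReal_div, RCLike.ofReal_pow, RCLike.ofReal_neg, RCLike.ofReal_ofNat]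
      module
    have hl := ((hR.tendsto_smul hA hpos hlim y).add
      (hR.tendsto_smul hA hneg (by simpa only [abs_neg] using hlim) y)).const_smul (1 / 2 : 𝕜)
    have : (1 / 2 : 𝕜) • (y + y) = y := by module
    rw [this] at hl
    exact hl.neg.congr fun n => (he n).symm

theorem IsSkewAdjoint.exists_unitaryGroup (hA : IsSkewAdjoint A) :
    ∃ S : ℝ → X →L[𝕜] X, IsUnitaryGroup A S := by
  obtain ⟨R, hR⟩ := hA.exists_resolvent_clm
  obtain ⟨C, hskew, hcomm, hcommR, hlim⟩ := hR.exists_approximation hA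
  have hnorm : ∀ n t x, ‖expGroup (C n) t x‖ = ‖x‖ := fun n t x => expGroup_norm (hskew n) t x
  have hdiff : ∀ n t x y, ‖expGroup (C n) t x - expGroup (C n) t y‖ = ‖x - y‖ := fun n t x y => by
    rw [← map_sub, hnorm]
  have hcauchy : ∀ x a, UniformCauchySeqOn (fun n t => expGroup (C n) t x) atTop (Icc (-a) a) := by
    intro x a
    rw [Metric.uniformCauchySeqOn_iff]
    intro ε hε
    obtain ⟨y, hy, hxy⟩ := hA.1.exists_dist_lt x (ε := ε / 3) (by positivity)
    rw [dist_eq_norm] at hxy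
    have hc := (hlim y _ (LinearPMap.mem_graph A ⟨y, hy⟩)).cauchySeq
    obtain ⟨N, hN⟩ := Metric.cauchySeq_iff.1 hc (ε / (3 * (|a| + 1))) (by positivity)
    refine ⟨N, fun m hm n hn t ht => ?_⟩
    have h1 := expGroup_sub_le (hskew m) (hskew n) (hcomm m n) t y
    have h2 := hN m hm n hn
    rw [dist_eq_norm] at h2 ⊢
    have h3 : |t| ≤ |a| + 1 := (abs_le.2 ht).trans (by linarith [le_abs_self a])
    have h4 : |t| * ‖C m y - C n y‖ ≤ ε / 3 := by
      calc |t| * ‖C m y - C n y‖ ≤ (|a| + 1) * (ε / (3 * (|a| + 1))) := by gcongr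
        _ = ε / 3 := by field_simp
    calc ‖expGroup (C m) t x - expGroup (C n) t x‖
        = ‖(expGroup (C m) t x - expGroup (C m) t y) + (expGroup (C m) t y - expGroup (C n) t y)
          + (expGroup (C n) t y - expGroup (C n) t x)‖ := by congr 1; abel
      _ ≤ _ := norm_add₃_le
      _ < ε := by
        rw [hdiff, hdiff, norm_sub_rev y x]
        linarith
  have hex : ∀ t x, ∃ y, Tendsto (fun n => expGroup (C n) t x) atTop (𝓝 y) := fun t x =>
    cauchySeq_tendsto_of_complete ((hcauchy x |t|).cauchySeq (abs_le.1 le_rfl))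
  choose S hS using hex
  have hSnorm : ∀ t x, ‖S t x‖ = ‖x‖ := fun t x =>
    tendsto_nhds_unique (hS t x).norm (by simp only [hnorm]; exact tendsto_const_nhds)
  let S' : ℝ → X →L[𝕜] X := fun t => LinearMap.mkContinuous
    { toFun := S t
      map_add' := fun x y => tendsto_nhds_unique (hS t (x + y))
        (by simp only [map_add]; exact (hS t x).add (hS t y))
      map_smul' := fun c x => tendsto_nhds_unique (hS t (c • x))
        (by simp only [map_smul]; exact (hS t x).const_smul c) } 1
    (fun x => by rw [one_mul]; exact (hSnorm t x).le)
  have hS' : ∀ t x, Tendsto (fun n => expGroup (C n) t x) atTop (𝓝 (S' t x)) := hS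
  have hunif : ∀ x a, TendstoUniformlyOn (fun n t => expGroup (C n) t x) (fun t => S' t x) atTop
      (Icc (-a) a) := fun x a => (hcauchy x a).tendstoUniformlyOn_of_tendsto fun t _ => hS t x
  have hIcc : ∀ t : ℝ, t ∈ Ioo (-(|t| + 1)) (|t| + 1) := fun t =>
    abs_lt.1 (by linarith)
  refine ⟨S', fun x => ?_, fun s t x => ?_, hSnorm, fun x => ?_, fun {x y} h t => ?_,
    fun {x y} h t => ?_⟩
  · refine tendsto_nhds_unique (hS' 0 x) ?_
    simp only [expGroup_zero, one_apply_eq_self]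
    exact tendsto_const_nhds
  · refine tendsto_nhds_unique (hS' (s + t) x) ?_
    have h1 := (hS' s (S' t x))
    have h2 : Tendsto (fun n => expGroup (C n) s (expGroup (C n) t x) -
        expGroup (C n) s (S' t x)) atTop (𝓝 0) := by
      rw [tendsto_zero_iff_norm_tendsto_zero]
      simp only [hdiff]
      exact tendsto_iff_norm_sub_tendsto_zero.1 (hS' t x)
    simp only [expGroup_add, mul_apply_eq_comp]
    simpa using h2.add h1
  · refine continuous_iff_continuousAt.2 fun t => ?_
    have hc : ContinuousOn (fun t => S' t x) (Icc (-(|t| + 1)) (|t| + 1)) :=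
      (hunif x _).continuousOn (Eventually.frequently (.of_forall fun n s _ =>
        (hasDerivAt_expGroup (C n) x s).continuousAt.continuousWithinAt))
    exact hc.continuousAt (Icc_mem_nhds (hIcc t).1 (hIcc t).2)
  · -- `x = R 1 (x + y)`, and the approximate groups commute with the resolvent
    refine hA.graph_isClosed.mem_of_tendsto ((hS' t x).prodMk_nhds (hS' t y))
      (.of_forall fun n => ?_)
    have hx : R 1 (x + y) = x := by
      have := hR.apply_graph hA one_ne_zero h
      rwa [RCLike.ofReal_one, one_smul] at this
    have hc : expGroup (C n) t x = R 1 (expGroup (C n) t (x + y)) := by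
      conv_lhs => rw [← hx]
      exact DFunLike.congr_fun (commute_expGroup (hcommR n) t).symm (x + y)
    have := hR 1 one_ne_zero (expGroup (C n) t (x + y))
    rwa [← hc, RCLike.ofReal_one, one_smul, ← map_sub, add_sub_cancel_left] at this
  · have hu : TendstoUniformlyOn (fun n s => expGroup (C n) s (C n x)) (fun s => -S' s y) atTop
        (Ioo (-(|t| + 1)) (|t| + 1)) := by
      rw [Metric.tendstoUniformlyOn_iff]
      intro ε hε
      have h1 := Metric.tendstoUniformlyOn_iff.1 (hunif y (|t| + 1)) (ε / 2) (by positivity)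
      have h2 := Metric.tendsto_nhds.1 (hlim x y h) (ε / 2) (by positivity)
      filter_upwards [h1, h2] with n hn1 hn2 s hs
      have hn3 := hn1 s (Ioo_subset_Icc_self hs)
      rw [dist_eq_norm] at hn2 hn3 ⊢
      calc ‖-S' s y - expGroup (C n) s (C n x)‖
          = ‖-(S' s y - expGroup (C n) s y) - (expGroup (C n) s (C n x - -y))‖ := by
            rw [sub_neg_eq_add, map_add]; congr 1; abel
        _ ≤ ‖S' s y - expGroup (C n) s y‖ + ‖expGroup (C n) s (C n x - -y)‖ := by
            refine (norm_sub_le _ _).trans_eq ?_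
            rw [norm_neg]
        _ < ε := by rw [hnorm]; linarith
    exact hasDerivAt_of_tendstoUniformlyOn isOpen_Ioo hu
      (.of_forall fun n s _ => hasDerivAt_expGroup (C n) x s) (fun s _ => hS' s x) (hIcc t)

end UnitaryGroup

/-! ### Weak solutions in the interaction picture -/

section Mild

variable {𝕜 X : Type*} [RCLike 𝕜] [NormedAddCommGroup X] [InnerProductSpace 𝕜 X]
  [NormedSpace ℝ X] {A : X →ₗ.[𝕜] X} {S : ℝ → X →L[𝕜] X}

namespace IsUnitaryGroup

theorem neg_apply (hS : IsUnitaryGroup A S) (t : ℝ) (x : X) : S (-t) (S t x) = x := by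
  rw [← hS.add, neg_add_cancel, hS.zero]

theorem apply_neg (hS : IsUnitaryGroup A S) (t : ℝ) (x : X) : S t (S (-t) x) = x := by
  rw [← hS.add, add_neg_cancel, hS.zero]

theorem inner_map (hS : IsUnitaryGroup A S) (t : ℝ) (x y : X) :
    inner 𝕜 (S t x) (S t y) = inner 𝕜 x y :=
  (LinearIsometry.mk (S t).toLinearMap (hS.norm t)).inner_map_map x y

theorem inner_apply (hS : IsUnitaryGroup A S) (t : ℝ) (x y : X) :
    inner 𝕜 (S t x) y = inner 𝕜 x (S (-t) y) := by
  rw [← hS.inner_map (-t), hS.neg_apply]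

theorem tendsto {ι : Type*} {l : Filter ι} (hS : IsUnitaryGroup A S) {f : ι → ℝ} {y : ι → X}
    {t : ℝ} {x : X} (hf : Tendsto f l (𝓝 t)) (hy : Tendsto y l (𝓝 x)) :
    Tendsto (fun i => S (f i) (y i)) l (𝓝 (S t x)) := by
  have h1 : Tendsto (fun i => S (f i) x) l (𝓝 (S t x)) := ((hS.continuous x).tendsto t).comp hf
  have h2 : Tendsto (fun i => S (f i) (y i - x)) l (𝓝 0) := by
    rw [tendsto_zero_iff_norm_tendsto_zero]
    simp only [hS.norm]
    exact tendsto_iff_norm_sub_tendsto_zero.1 hy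
  simpa using h2.add h1

theorem continuousOn_comp (hS : IsUnitaryGroup A S) {f : ℝ → ℝ} {y : ℝ → X} {s : Set ℝ}
    (hf : ContinuousOn f s) (hy : ContinuousOn y s) : ContinuousOn (fun t => S (f t) (y t)) s :=
  fun t ht => hS.tendsto (hf t ht) (hy t ht)

theorem continuous_comp (hS : IsUnitaryGroup A S) {f : ℝ → ℝ} {y : ℝ → X}
    (hf : Continuous f) (hy : Continuous y) : Continuous (fun t => S (f t) (y t)) :=
  continuous_iff_continuousAt.2 fun t => hS.tendsto (hf.tendsto t) (hy.tendsto t)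

end IsUnitaryGroup

/-- The differential form of Duhamel's formula for `u' + A u + G(u) = 0`: the function
`v(t) = S(-t) u(t)` solves the ordinary differential equation `v' = -S(-t) G(S(t) v)` in `X`, from
which the unbounded operator has disappeared. -/
structure IsMildSolution (S : ℝ → X →L[𝕜] X) (G : X → X) (u : ℝ → X) : Prop where
  continuousOn : ContinuousOn u (Ici 0)
  hasDeriv : ∀ t : ℝ, 0 ≤ t →
    HasDerivWithinAt (fun τ => S (-τ) (u τ)) (-S (-t) (G (u t))) (Ici 0) t

theorem ContinuousOn.comp_max_zero {Y : Type*} [TopologicalSpace Y] {u : ℝ → Y}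
    (hu : ContinuousOn u (Ici 0)) : Continuous fun t => u (max t 0) :=
  hu.comp_continuous (by fun_prop) fun t => le_max_right t 0

theorem eqOn_of_hasDerivWithinAt_eq {E : Type*} [NormedAddCommGroup E] [NormedSpace ℝ E]
    {f g f' : ℝ → E} (hf : ∀ t, 0 ≤ t → HasDerivWithinAt f (f' t) (Ici 0) t)
    (hg : ∀ t, 0 ≤ t → HasDerivWithinAt g (f' t) (Ici 0) t) (h0 : f 0 = g 0) :
    EqOn f g (Ici 0) := by
  intro b hb
  have hb : (0 : ℝ) ≤ b := hb
  have hd : ∀ t, 0 ≤ t → HasDerivWithinAt (fun t => f t - g t) 0 (Ici 0) t := fun t ht => by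
    have := (hf t ht).sub (hg t ht)
    rwa [sub_self] at this
  have := constant_of_has_deriv_right_zero (a := 0) (b := b)
    (fun t ht => ((hd t ht.1).continuousWithinAt.mono Icc_subset_Ici_self))
    (fun t ht => (hd t ht.1).mono (Ici_subset_Ici.2 ht.1)) b ⟨hb, le_rfl⟩
  rw [h0, sub_self, sub_eq_zero] at this
  exact this

variable [CompleteSpace X] [IsScalarTower ℝ 𝕜 X]

theorem HasDerivWithinAt.clm_map {f : ℝ → X} {f' : X} {s : Set ℝ} {t : ℝ}
    (hf : HasDerivWithinAt f f' s t) (L : X →L[𝕜] X) :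
    HasDerivWithinAt (fun τ => L (f τ)) (L f') s t :=
  (L.restrictScalars ℝ).hasFDerivAt.comp_hasDerivWithinAt t hf

/-- Duhamel's formula in the moving frame. -/
theorem IsMildSolution.eq_integral (hS : IsUnitaryGroup A S) {G : X → X} (hG : Continuous G)
    {u : ℝ → X} (hu : IsMildSolution S G u) {t : ℝ} (ht : 0 ≤ t) :
    S (-t) (u t) = u 0 - ∫ s in (0 : ℝ)..t, S (-s) (G (u s)) := by
  have hc : Continuous fun s => S (-s) (G (u (max s 0))) :=
    hS.continuous_comp continuous_neg (hG.comp hu.continuousOn.comp_max_zero)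
  have hi : ∀ t, 0 ≤ t → HasDerivWithinAt
      (fun t => u 0 - ∫ s in (0 : ℝ)..t, S (-s) (G (u (max s 0))))
      (-S (-t) (G (u t))) (Ici 0) t := fun t ht => by
    have := ((hc.integral_hasStrictDerivAt 0 t).hasDerivAt.const_sub (u 0)).hasDerivWithinAt
      (s := Ici 0)
    rwa [max_eq_left ht] at this
  have h := eqOn_of_hasDerivWithinAt_eq hu.hasDeriv hi (by simp [hS.zero]) (mem_Ici.2 ht)
  simp only at h
  rw [h]
  congr 1
  refine intervalIntegral.integral_congr fun s hs => ?_
  rw [uIcc_of_le ht] at hs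
  simp only [max_eq_left hs.1]

theorem IsMildSolution.congr {G : X → X} {u w : ℝ → X} (hu : IsMildSolution S G u)
    (h : EqOn w u (Ici 0)) : IsMildSolution S G w where
  continuousOn := hu.continuousOn.congr h
  hasDeriv t ht := by
    rw [h (mem_Ici.2 ht)]
    exact (hu.hasDeriv t ht).congr (fun s hs => by rw [h hs]) (by rw [h (mem_Ici.2 ht)])

/-- Solutions can be started at any later time. -/
theorem IsMildSolution.shift (hS : IsUnitaryGroup A S) {G : X → X} {u : ℝ → X}
    (hu : IsMildSolution S G u) {a : ℝ} (ha : 0 ≤ a) :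
    IsMildSolution S G fun t => u (t + a) := by
  have hm : MapsTo (fun t : ℝ => t + a) (Ici 0) (Ici 0) := fun t ht => add_nonneg ht ha
  refine ⟨hu.continuousOn.comp (by fun_prop) hm, fun t ht => ?_⟩
  have h1 := (hu.hasDeriv (t + a) (by positivity)).scomp t
    (((hasDerivAt_id t).add_const a).hasDerivWithinAt (s := Ici 0)) hm
  have h2 := h1.clm_map (S a)
  simp only [one_smul, map_neg, Function.comp_def, id] at h2
  have he : ∀ (τ : ℝ) (x : X), S a (S (-(τ + a)) x) = S (-τ) x := fun τ x => by
    rw [← hS.add]; congr 2; ring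
  simpa only [he] using h2

/-- Conservative solutions are orbits of the group. -/
theorem IsUnitaryGroup.isMildSolution (hS : IsUnitaryGroup A S) (x : X) :
    IsMildSolution S (fun _ => 0) fun t => S t x where
  continuousOn := (hS.continuous x).continuousOn
  hasDeriv t _ := by
    simp only [hS.neg_apply, map_zero, neg_zero]
    exact hasDerivWithinAt_const t _ x

/-- If `p` is differentiable and takes a value in `D(A)` at `t`, then `τ ↦ S(τ) p(τ)` is
differentiable at `t`. -/
theorem IsUnitaryGroup.hasDerivWithinAt_apply (hS : IsUnitaryGroup A S) {p : ℝ → X} {p' z : X}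
    {s : Set ℝ} {t : ℝ} (hp : HasDerivWithinAt p p' s t) (hz : (p t, z) ∈ A.graph) :
    HasDerivWithinAt (fun τ => S τ (p τ)) (S t p' - S t z) s t := by
  rw [hasDerivWithinAt_iff_tendsto_slope] at hp ⊢
  have h1 : Tendsto (fun τ => S τ (slope p t τ)) (𝓝[s \ {t}] t) (𝓝 (S t p')) :=
    hS.tendsto (tendsto_id.mono_left nhdsWithin_le_nhds) hp
  have h2 := (hasDerivWithinAt_iff_tendsto_slope.1 (hS.hasDerivAt hz t).hasDerivWithinAt :
    Tendsto (slope (fun τ => S τ (p t)) t) (𝓝[s \ {t}] t) _)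
  refine ((h1.add h2).congr fun τ => ?_).trans_eq (by rw [sub_eq_add_neg])
  have : S τ (slope p t τ) = (τ - t)⁻¹ • (S τ (p τ) - S τ (p t)) := by
    rw [slope_def_module, ← map_sub]
    exact ((S τ).restrictScalars ℝ).map_smul _ _
  rw [this, slope_def_module, slope_def_module, ← smul_add, sub_add_sub_cancel]

/-- A weak solution is a mild solution: test the equation with `S(t) w` for `w ∈ D(A)`. -/
theorem IsWeakSolution.isMildSolution (hA : IsSkewAdjoint A) (hS : IsUnitaryGroup A S)
    {G : X → X} (hG : Continuous G) {u : ℝ → X} (hu : IsWeakSolution A G u) :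
    IsMildSolution S G u := by
  have hc : Continuous fun s => S (-s) (G (u (max s 0))) :=
    hS.continuous_comp continuous_neg (hG.comp hu.continuousOn.comp_max_zero)
  set V : ℝ → X := fun t => u 0 - ∫ s in (0 : ℝ)..t, S (-s) (G (u (max s 0))) with hVdef
  have hV : ∀ t, 0 ≤ t → HasDerivWithinAt V (-S (-t) (G (u t))) (Ici 0) t := fun t ht => by
    have := ((hc.integral_hasStrictDerivAt 0 t).hasDerivAt.const_sub (u 0)).hasDerivWithinAt
      (s := Ici 0)
    rwa [max_eq_left ht] at this
  have hφ : ∀ w ∈ A.domain, ∀ t, 0 ≤ t → HasDerivWithinAt (fun τ => inner 𝕜 (u τ) (S τ w))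
      (-inner 𝕜 (G (u t)) (S t w)) (Ici 0) t := by
    intro w hw t ht
    have hz := LinearPMap.mem_graph A ⟨w, hw⟩
    set z := A ⟨w, hw⟩
    let y : ℝ → GraphDomain A := fun τ => (⟨(S τ w, S τ z), hS.graph hz τ⟩ : A.graph)
    have hy : Continuous y :=
      Continuous.subtype_mk ((hS.continuous w).prodMk (hS.continuous z)) _
    have h1 := hasDerivWithinAt_iff_tendsto_slope.1 (hu.equation t ht)
    have h2 := ((isBoundedBilinearMap_apply (𝕜 := 𝕜) (E := GraphDomain A) (F := 𝕜)).continuous.tendsto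
      (_, y t)).comp (h1.prodMk_nhds
        ((hy.tendsto t).mono_left (nhdsWithin_le_nhds (s := Ici 0 \ {t}))))
    have h3 : Tendsto (fun τ => inner 𝕜 (u t) (slope (fun τ => S τ w) t τ)) (𝓝[Ici 0 \ {t}] t)
        (𝓝 (inner 𝕜 (u t) (-S t z))) :=
      tendsto_const_nhds.inner
        (hasDerivWithinAt_iff_tendsto_slope.1 (hS.hasDerivAt hz t).hasDerivWithinAt)
    rw [hasDerivWithinAt_iff_tendsto_slope]
    refine ((h2.add h3).congr fun τ => ?_).trans_eq ?_
    · have e1 : (slope (fun τ => pivotEmbedding A (u τ)) t τ) (y τ) =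
          (τ - t)⁻¹ • (inner 𝕜 (u τ) (S τ w) - inner 𝕜 (u t) (S τ w)) := by
        rw [slope_def_module]; rfl
      have e2 : inner 𝕜 (u t) (slope (fun τ => S τ w) t τ) =
          (τ - t)⁻¹ • (inner 𝕜 (u t) (S τ w) - inner 𝕜 (u t) (S t w)) := by
        rw [slope_def_module, ← inner_sub_right, RCLike.real_smul_eq_coe_smul (K := 𝕜),
          inner_smul_right, RCLike.real_smul_eq_coe_mul]
      change slope (fun τ => pivotEmbedding A (u τ)) t τ (y τ) + _ = _
      rw [e1, e2, slope_def_module, ← smul_add, sub_add_sub_cancel]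
    · congr 1
      change (-(-inner 𝕜 (u t) (S t z)) - inner 𝕜 (G (u t)) (S t w)) + inner 𝕜 (u t) (-S t z) = _
      rw [inner_neg_right]; ring
  have hVw : ∀ w, ∀ t, 0 ≤ t → HasDerivWithinAt (fun τ => inner 𝕜 (V τ) w)
      (-inner 𝕜 (G (u t)) (S t w)) (Ici 0) t := by
    intro w t ht
    have := (hV t ht).inner 𝕜 (hasDerivWithinAt_const t (Ici 0) w)
    rwa [inner_zero_right, zero_add, inner_neg_left, hS.inner_apply, neg_neg] at this
  have heq : ∀ t, 0 ≤ t → S (-t) (u t) = V t := by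
    intro t ht
    refine hA.1.eq_of_inner_left 𝕜 fun w hw => ?_
    have := eqOn_of_hasDerivWithinAt_eq (hφ w hw) (hVw w) (by simp [hVdef, hS.zero])
      (mem_Ici.2 ht)
    simp only at this
    rw [← this, hS.inner_apply, neg_neg]
  exact ⟨hu.continuousOn, fun t ht => (hV t ht).congr (fun s hs => heq s hs) (heq t ht)⟩

/-- The difference `y ↦ (w ↦ ⟨y, w + A w⟩)` of the embedding of the pivot space and of the extended
operator, as a real-linear bounded map from `X` to `D(A)'`. -/
noncomputable def pivotSubExtended (A : X →ₗ.[𝕜] X) : X →L[ℝ] DomainDual A :=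
  LinearMap.mkContinuous
    { toFun := fun y => pivotEmbedding A y - extendedOperator A y
      map_add' := fun x y => by
        simp only [pivotEmbedding, extendedOperator, map_add, ContinuousLinearMap.add_comp]
        abel
      map_smul' := fun c x => by
        ext w
        change inner 𝕜 (c • x) (domainInclusion A w) - -inner 𝕜 (c • x) (domainOperator A w) =
          c • (inner 𝕜 x (domainInclusion A w) - -inner 𝕜 x (domainOperator A w))
        rw [RCLike.real_smul_eq_coe_smul (K := 𝕜) c x, inner_smul_left, inner_smul_left,
          RCLike.conj_ofReal, RCLike.real_smul_eq_coe_mul]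
        ring } (‖domainInclusion A‖ + ‖domainOperator A‖) fun y => by
    change ‖(innerSL 𝕜 y).comp (domainInclusion A) -
      -((innerSL 𝕜 y).comp (domainOperator A))‖ ≤ _
    rw [sub_neg_eq_add]
    refine (norm_add_le _ _).trans ?_
    have h1 := (innerSL 𝕜 y).opNorm_comp_le (domainInclusion A)
    have h2 := (innerSL 𝕜 y).opNorm_comp_le (domainOperator A)
    rw [innerSL_apply_norm] at h1 h2
    linarith

theorem pivotEmbedding_eq {x a : X} (hA : IsSkewAdjoint A) (h : (a, a - x) ∈ A.graph) :
    pivotEmbedding A x = pivotSubExtended A a := by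
  ext w
  let w' : A.graph := w
  change inner 𝕜 x w'.1.1 = inner 𝕜 a w'.1.1 - -inner 𝕜 a w'.1.2
  have := hA.inner_graph h w'.2
  rw [inner_sub_left] at this
  linear_combination -this

/-- A mild solution is a weak solution: with `K = (1 - A)⁻¹`, the function `K u` is differentiable
in `X`, and the norm of `D(A)'` is controlled by the norm of `K` in `X`. -/
theorem IsMildSolution.isWeakSolution (hA : IsSkewAdjoint A) (hS : IsUnitaryGroup A S)
    {G : X → X} {u : ℝ → X} (hu : IsMildSolution S G u) : IsWeakSolution A G u := by
  obtain ⟨R, hR⟩ := hA.exists_resolvent_clm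
  set K : X →L[𝕜] X := -R (-1)
  have hm1 : (-1 : ℝ) ≠ 0 := by norm_num
  have hK : ∀ x, (K x, K x - x) ∈ A.graph := fun x => by
    have h := A.graph.neg_mem (hR (-1) hm1 x)
    have : -(R (-1) x, x - ((-1 : ℝ) : 𝕜) • R (-1) x) = (K x, K x - x) := by
      ext
      · rfl
      · change -(x - ((-1 : ℝ) : 𝕜) • R (-1) x) = -R (-1) x - x
        rw [RCLike.ofReal_neg, RCLike.ofReal_one, neg_one_smul]; abel
    rwa [this] at h
  have hKS : ∀ t x, K (S t x) = S t (K x) := fun t x => by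
    have h1 := A.graph.neg_mem (hK (S t x))
    have h2 := A.graph.neg_mem (hS.graph (hK x) t)
    refine neg_injective (hA.resolvent_unique (z := S t x) hm1 ?_ ?_)
    · convert! h1 using 1
      ext
      · rfl
      · simp
    · convert! h2 using 1
      ext
      · rfl
      · simp
  refine ⟨hu.continuousOn, fun t ht => ?_⟩
  have h1 := (hu.hasDeriv t ht).clm_map K
  have h2 := hS.hasDerivWithinAt_apply h1 (hK (S (-t) (u t)))
  simp only [← hKS, map_neg, map_sub, hS.apply_neg] at h2
  have h3 := (pivotSubExtended A).hasFDerivAt.comp_hasDerivWithinAt t h2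
  simp only [Function.comp_def, ← pivotEmbedding_eq hA (hK _)] at h3
  convert! h3 using 1
  rw [map_sub, map_sub, map_neg, ← pivotEmbedding_eq hA (hK _), ← pivotEmbedding_eq hA (hK _)]
  change _ = -_ - (_ - (pivotEmbedding A (u t) - extendedOperator A (u t)))
  abel

end Mild

/-! ### Global well-posedness -/

section ODE

variable {E : Type*} [NormedAddCommGroup E] [NormedSpace ℝ E]

/-- A bounded vector field, uniformly Lipschitz in space and continuous in time, has a global
forward solution from every initial value. -/
theorem exists_global_solution [CompleteSpace E] {N : ℝ → E → E} {K L : NNReal}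
    (hlip : ∀ t, LipschitzWith K (N t)) (hbd : ∀ t x, ‖N t x‖ ≤ L)
    (hcont : ∀ x, Continuous fun t => N t x) (x₀ : E) :
    ∃ v : ℝ → E, v 0 = x₀ ∧ ∀ t, 0 ≤ t → HasDerivWithinAt v (N t (v t)) (Ici 0) t := by
  have hex : ∀ n : ℕ, ∃ v : ℝ → E, v 0 = x₀ ∧
      ∀ t ∈ Icc (0 : ℝ) n, HasDerivWithinAt v (N t (v t)) (Icc 0 n) t := fun n => by
    have hpl : IsPicardLindelof N (tmin := 0) (tmax := n) ⟨0, le_rfl, n.cast_nonneg⟩ x₀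
        (L * n) 0 L K :=
      { lipschitzOnWith := fun t _ => (hlip t).lipschitzOnWith
        continuousOn := fun x _ => (hcont x).continuousOn
        norm_le := fun t _ x _ => hbd t x
        mul_max_le := by simp }
    exact hpl.exists_eq_forall_mem_Icc_hasDerivWithinAt₀
  choose v hv0 hv using hex
  have huniq : ∀ {m n : ℕ} {t : ℝ}, 0 ≤ t → t ≤ m → t ≤ n → v m t = v n t := by
    intro m n t h0 hm hn
    have hd : ∀ k : ℕ, t ≤ k → ContinuousOn (v k) (Icc 0 t) ∧ ∀ s ∈ Ico 0 t,
        HasDerivWithinAt (v k) (N s (v k s)) (Ici s) s := fun k hk =>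
      ⟨fun s hs => (hv k s ⟨hs.1, hs.2.trans hk⟩).continuousWithinAt.mono
        (Icc_subset_Icc_right hk), fun s hs => (hv k s ⟨hs.1, (hs.2.trans_le hk).le⟩).mono_of_mem_nhdsWithin
          (mem_of_superset (Icc_mem_nhdsGE (hs.2.trans_le hk)) (Icc_subset_Icc_left hs.1))⟩
    exact ODE_solution_unique (K := K) hlip (hd m hm).1 (hd m hm).2 (hd n hn).1 (hd n hn).2
      ((hv0 m).trans (hv0 n).symm) ⟨h0, le_rfl⟩
  refine ⟨fun t => v (⌈t⌉₊) t, hv0 _, fun t ht => ?_⟩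
  have hlt : t < (⌈t⌉₊ + 1 : ℕ) := (Nat.le_ceil t).trans_lt (by simp)
  have heq : v ⌈t⌉₊ t = v (⌈t⌉₊ + 1) t := huniq ht (Nat.le_ceil t) hlt.le
  have h1 := hv (⌈t⌉₊ + 1) t ⟨ht, hlt.le⟩
  have hmem : Icc (0 : ℝ) (⌈t⌉₊ + 1 : ℕ) ∈ 𝓝[Ici 0] t := by
    rw [← Ici_inter_Iic]
    exact inter_mem_nhdsWithin _ (Iic_mem_nhds hlt)
  simp only [heq]
  refine (h1.mono_of_mem_nhdsWithin hmem).congr_of_eventuallyEq ?_ heq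
  filter_upwards [hmem] with s hs
  exact huniq hs.1 (Nat.le_ceil s) hs.2

theorem antitoneOn_Ici_of_hasDerivWithinAt_nonpos {f f' : ℝ → ℝ}
    (hf : ∀ t, 0 ≤ t → HasDerivWithinAt f (f' t) (Ici 0) t) (hf' : ∀ t, 0 ≤ t → f' t ≤ 0) :
    AntitoneOn f (Ici 0) :=
  antitoneOn_of_hasDerivWithinAt_nonpos (convex_Ici 0) (fun t ht => (hf t ht).continuousWithinAt)
    (fun t ht => (hf t (interior_subset ht)).mono interior_subset)
    fun t ht => hf' t (interior_subset ht)

/-- The radial retraction of a normed space onto the closed ball of radius `r`. -/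
noncomputable def radialRetraction (r : ℝ) (x : E) : E := (r * (max r ‖x‖)⁻¹) • x

theorem norm_radialRetraction_le {r : ℝ} (hr : 0 < r) (x : E) : ‖radialRetraction r x‖ ≤ r := by
  have h : 0 < max r ‖x‖ := lt_max_of_lt_left hr
  rw [radialRetraction, norm_smul, Real.norm_of_nonneg (by positivity), mul_assoc]
  refine mul_le_of_le_one_right hr.le ?_
  rw [inv_mul_le_one₀ h]
  exact le_max_right _ _

theorem radialRetraction_of_norm_le {r : ℝ} (hr : 0 < r) {x : E} (hx : ‖x‖ ≤ r) :
    radialRetraction r x = x := by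
  rw [radialRetraction, max_eq_left hx, mul_inv_cancel₀ hr.ne', one_smul]

theorem lipschitzWith_radialRetraction {r : ℝ} (hr : 0 < r) :
    LipschitzWith 2 (radialRetraction r : E → E) := by
  refine LipschitzWith.of_dist_le_mul fun x y => ?_
  have hx : 0 < max r ‖x‖ := lt_max_of_lt_left hr
  have hy : 0 < max r ‖y‖ := lt_max_of_lt_left hr
  have h1 : radialRetraction r x - radialRetraction r y = (r * (max r ‖x‖)⁻¹) • (x - y) +
      ((r * (max r ‖x‖)⁻¹) * ((max r ‖y‖ - max r ‖x‖) * (max r ‖y‖)⁻¹)) • y := by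
    have : (r * (max r ‖x‖)⁻¹) * ((max r ‖y‖ - max r ‖x‖) * (max r ‖y‖)⁻¹) =
        r * (max r ‖x‖)⁻¹ - r * (max r ‖y‖)⁻¹ := by field_simp
    rw [this, radialRetraction, radialRetraction, smul_sub, sub_smul]
    abel
  have h2 : r * (max r ‖x‖)⁻¹ ≤ 1 := by
    rw [← div_eq_mul_inv, div_le_one hx]; exact le_max_left _ _
  have h3 : (max r ‖y‖)⁻¹ * ‖y‖ ≤ 1 := by
    rw [inv_mul_le_one₀ hy]; exact le_max_right _ _
  have h4 : |max r ‖y‖ - max r ‖x‖| ≤ ‖x - y‖ := by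
    rw [max_comm r, max_comm r, norm_sub_rev]
    exact (abs_max_sub_max_le_abs _ _ _).trans (abs_norm_sub_norm_le y x)
  rw [dist_eq_norm, dist_eq_norm, h1]
  refine (norm_add_le _ _).trans ?_
  have h7 : ‖r * (max r ‖x‖)⁻¹‖ = r * (max r ‖x‖)⁻¹ := Real.norm_of_nonneg (by positivity)
  have h8 : ‖(max r ‖y‖)⁻¹‖ = (max r ‖y‖)⁻¹ := Real.norm_of_nonneg (by positivity)
  rw [norm_smul, norm_smul, norm_mul (r * _), norm_mul (_ - _), h7, h8, Real.norm_eq_abs]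
  have h5 : r * (max r ‖x‖)⁻¹ * ‖x - y‖ ≤ 1 * ‖x - y‖ := by gcongr
  have h6 : r * (max r ‖x‖)⁻¹ * (|max r ‖y‖ - max r ‖x‖| * (max r ‖y‖)⁻¹) * ‖y‖ ≤
      1 * (‖x - y‖ * 1) := by
    calc _ = r * (max r ‖x‖)⁻¹ * (|max r ‖y‖ - max r ‖x‖| * ((max r ‖y‖)⁻¹ * ‖y‖)) := by ring
      _ ≤ _ := by gcongr
  push_cast
  linarith

end ODE

section WellPosed

variable {𝕜 X : Type*} [RCLike 𝕜] [NormedAddCommGroup X] [InnerProductSpace 𝕜 X]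
  [NormedSpace ℝ X] [CompleteSpace X] [IsScalarTower ℝ 𝕜 X] {A : X →ₗ.[𝕜] X} {S : ℝ → X →L[𝕜] X}
  {G : X → X}

theorem IsUnitaryGroup.hasDerivWithinAt_norm_sq (hS : IsUnitaryGroup A S) {u : ℝ → X} {g : X}
    {s : Set ℝ} {t : ℝ} (h : HasDerivWithinAt (fun τ => S (-τ) (u τ)) (-S (-t) g) s t) :
    HasDerivWithinAt (fun τ => ‖u τ‖ ^ 2) (-2 * RCLike.re (inner 𝕜 (u t) g)) s t := by
  have h1 := (h.inner 𝕜 h)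
  simp only [hS.inner_map, ← map_neg] at h1
  have h2 := (RCLike.reCLM (K := 𝕜)).hasFDerivAt.comp_hasDerivWithinAt t h1
  simp only [Function.comp_def, RCLike.reCLM_apply, inner_self_eq_norm_sq] at h2
  convert! h2 using 1
  rw [map_add, inner_neg_left, inner_neg_right, map_neg, map_neg, ← inner_conj_symm g,
    RCLike.conj_re]
  ring

theorem LipschitzOnBounded.continuous (hG : LipschitzOnBounded G) : Continuous G := by
  refine continuous_iff_continuousAt.2 fun x => ?_
  obtain ⟨K, hK⟩ := hG (‖x‖ + 1)
  refine hK.continuousOn.continuousAt (Metric.closedBall_mem_nhds_of_mem ?_)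
  simp

namespace IsMildSolution

/-- The norm of a solution is nonincreasing when the nonlinearity is accretive at the origin. -/
theorem antitoneOn_norm (hS : IsUnitaryGroup A S) (hacc : ∀ x, 0 ≤ RCLike.re (inner 𝕜 x (G x)))
    {u : ℝ → X} (hu : IsMildSolution S G u) : AntitoneOn (fun t => ‖u t‖) (Ici 0) := by
  have h := antitoneOn_Ici_of_hasDerivWithinAt_nonpos
    (fun t ht => hS.hasDerivWithinAt_norm_sq (hu.hasDeriv t ht))
    (fun t _ => by have := hacc (u t); linarith)
  intro a ha b hb hab
  exact (pow_le_pow_iff_left₀ (norm_nonneg _) (norm_nonneg _) two_ne_zero).1 (h ha hb hab)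

/-- Two solutions in a region where the nonlinearity is `K`-Lipschitz neither separate nor merge
faster than exponentially with rate `K`. -/
theorem dist_le (hS : IsUnitaryGroup A S) {r : ℝ} {K : NNReal}
    (hG : LipschitzOnWith K G (Metric.closedBall 0 r)) {u v : ℝ → X} (hu : IsMildSolution S G u)
    (hv : IsMildSolution S G v) (hur : ∀ t, 0 ≤ t → ‖u t‖ ≤ r) (hvr : ∀ t, 0 ≤ t → ‖v t‖ ≤ r)
    {s t : ℝ} (hs : 0 ≤ s) (ht : 0 ≤ t) :
    ‖u s - v s‖ ≤ Real.exp (K * |t - s|) * ‖u t - v t‖ := by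
  have hd : ∀ t, 0 ≤ t → HasDerivWithinAt (fun τ => ‖u τ - v τ‖ ^ 2)
      (-2 * RCLike.re (inner 𝕜 (u t - v t) (G (u t) - G (v t)))) (Ici 0) t := fun t ht => by
    refine hS.hasDerivWithinAt_norm_sq (((hu.hasDeriv t ht).sub (hv.hasDeriv t ht)).congr_deriv ?_
      |>.congr (fun τ _ => map_sub _ _ _) (map_sub _ _ _))
    rw [map_sub]; abel
  have hb : ∀ t, 0 ≤ t → |RCLike.re (inner 𝕜 (u t - v t) (G (u t) - G (v t)))| ≤
      K * ‖u t - v t‖ ^ 2 := fun t ht => by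
    have h1 := hG.norm_sub_le (mem_closedBall_zero_iff.2 (hur t ht))
      (mem_closedBall_zero_iff.2 (hvr t ht))
    calc _ ≤ ‖inner 𝕜 (u t - v t) (G (u t) - G (v t))‖ := RCLike.abs_re_le_norm _
      _ ≤ ‖u t - v t‖ * ‖G (u t) - G (v t)‖ := norm_inner_le_norm _ _
      _ ≤ ‖u t - v t‖ * (K * ‖u t - v t‖) := by gcongr
      _ = _ := by ring
  have hexp : ∀ (c t : ℝ), HasDerivWithinAt (fun τ => Real.exp (c * τ)) (c * Real.exp (c * t))
      (Ici 0) t := fun c t => by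
    have := ((hasDerivAt_id t).const_mul c).exp.hasDerivWithinAt (s := Ici 0)
    simpa [mul_comm] using this
  have hsq : ‖u s - v s‖ ^ 2 ≤ (Real.exp (K * |t - s|) * ‖u t - v t‖) ^ 2 := by
    rw [mul_pow, ← Real.exp_nat_mul]
    rcases le_total t s with h | h
    · have hanti := antitoneOn_Ici_of_hasDerivWithinAt_nonpos
        (fun t ht => (hexp (-(2 * K)) t).mul (hd t ht)) (fun t ht => by
          have h1 := (abs_le.1 (hb t ht)).1
          have h2 := Real.exp_pos (-(2 * K) * t)
          nlinarith [mul_le_mul_of_nonneg_left h1 h2.le]) (mem_Ici.2 ht) (mem_Ici.2 hs) h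
      simp only [Pi.mul_apply] at hanti
      have h3 := mul_le_mul_of_nonneg_left hanti (Real.exp_pos (2 * K * s)).le
      rw [← mul_assoc, ← mul_assoc, ← Real.exp_add, ← Real.exp_add] at h3
      rw [abs_sub_comm, abs_of_nonneg (sub_nonneg.2 h)]
      convert! h3 using 1
      · rw [neg_mul, add_neg_cancel, Real.exp_zero, one_mul]
      · congr 2; push_cast; ring
    · have hanti := antitoneOn_Ici_of_hasDerivWithinAt_nonpos
        (fun t ht => ((hexp (2 * K) t).mul (hd t ht)).neg) (fun t ht => by
          have h1 := (abs_le.1 (hb t ht)).2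
          have h2 := Real.exp_pos (2 * K * t)
          nlinarith [mul_le_mul_of_nonneg_left h1 h2.le]) (mem_Ici.2 hs) (mem_Ici.2 ht) h
      simp only [Pi.mul_apply, Pi.neg_apply, neg_le_neg_iff] at hanti
      have h3 := mul_le_mul_of_nonneg_left hanti (Real.exp_pos (-(2 * K * s))).le
      rw [← mul_assoc, ← mul_assoc, ← Real.exp_add, ← Real.exp_add] at h3
      rw [abs_of_nonneg (sub_nonneg.2 h)]
      convert! h3 using 1
      · rw [neg_add_cancel, Real.exp_zero, one_mul]
      · congr 2; push_cast; ring
  exact (pow_le_pow_iff_left₀ (norm_nonneg _) (by positivity) two_ne_zero).1 hsq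

theorem unique (hS : IsUnitaryGroup A S) (hG : LipschitzOnBounded G)
    (hacc : ∀ x, 0 ≤ RCLike.re (inner 𝕜 x (G x))) {u v : ℝ → X} (hu : IsMildSolution S G u)
    (hv : IsMildSolution S G v) (h0 : u 0 = v 0) : EqOn u v (Ici 0) := by
  intro t ht
  obtain ⟨K, hK⟩ := hG ‖u 0‖
  have h1 := dist_le hS hK hu hv (fun t ht => hu.antitoneOn_norm hS hacc self_mem_Ici ht ht)
    (fun t ht => by rw [h0]; exact hv.antitoneOn_norm hS hacc self_mem_Ici ht ht)
    (mem_Ici.1 ht) le_rfl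
  rw [h0, sub_self, norm_zero, mul_zero] at h1
  exact sub_eq_zero.1 (norm_le_zero_iff.1 h1)

end IsMildSolution

/-- Global existence: truncate the nonlinearity outside a ball, which the solution of the truncated
problem does not leave because its norm is nonincreasing. -/
theorem exists_isMildSolution (hS : IsUnitaryGroup A S) (hG : LipschitzOnBounded G)
    (hacc : ∀ x, 0 ≤ RCLike.re (inner 𝕜 x (G x))) (u₀ : X) :
    ∃ u : ℝ → X, u 0 = u₀ ∧ IsMildSolution S G u := by
  set r : ℝ := ‖u₀‖ + 1
  have hr : 0 < r := by positivity
  obtain ⟨K, hK⟩ := hG r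
  set P : X → X := radialRetraction r
  have hP : ∀ x, P x ∈ Metric.closedBall (0 : X) r := fun x =>
    mem_closedBall_zero_iff.2 (norm_radialRetraction_le hr x)
  have hlip : LipschitzWith (K * 2) (G ∘ P) := by
    rw [← lipschitzOnWith_univ]
    exact hK.comp (lipschitzWith_radialRetraction hr).lipschitzOnWith fun x _ => hP x
  have hGP : ∀ x, ‖G (P x)‖ ≤ ‖G 0‖ + K * r := fun x => by
    have h1 := hK.norm_sub_le (hP x) (Metric.mem_closedBall_self hr.le)
    rw [sub_zero] at h1
    have h2 := norm_le_norm_add_norm_sub' (G (P x)) (G 0)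
    have h3 : K * ‖P x‖ ≤ K * r := by
      gcongr; exact mem_closedBall_zero_iff.1 (hP x)
    linarith
  have haccP : ∀ x, 0 ≤ RCLike.re (inner 𝕜 x (G (P x))) := fun x => by
    have hc : 0 < r * (max r ‖x‖)⁻¹ := by
      have : 0 < max r ‖x‖ := lt_max_of_lt_left hr
      positivity
    have h1 := hacc (P x)
    have h2 : P x = ((r * (max r ‖x‖)⁻¹ : ℝ) : 𝕜) • x := by
      rw [← RCLike.real_smul_eq_coe_smul]; rfl
    nth_rw 1 [h2] at h1
    rw [inner_smul_left, RCLike.conj_ofReal, RCLike.re_ofReal_mul] at h1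
    exact nonneg_of_mul_nonneg_right h1 hc
  obtain ⟨v, hv0, hv⟩ := exists_global_solution (N := fun t x => -S (-t) (G (P (S t x))))
    (K := K * 2) (L := ⟨‖G 0‖ + K * r, by positivity⟩)
    (fun t => LipschitzWith.of_dist_le_mul fun x y => by
      rw [dist_neg_neg, dist_eq_norm, ← map_sub, hS.norm, ← dist_eq_norm]
      refine (hlip.dist_le_mul _ _).trans_eq ?_
      rw [dist_eq_norm, ← map_sub, hS.norm, ← dist_eq_norm])
    (fun t x => by rw [norm_neg, hS.norm]; exact hGP _)
    (fun x => (hS.continuous_comp continuous_neg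
      (hlip.continuous.comp (hS.continuous x))).neg) u₀
  have hmild : IsMildSolution S (G ∘ P) fun t => S t (v t) :=
    ⟨hS.continuousOn_comp continuousOn_id fun t ht => (hv t ht).continuousWithinAt,
      fun t ht => by simp only [hS.neg_apply]; exact hv t ht⟩
  have h0 : S 0 (v 0) = u₀ := by rw [hS.zero, hv0]
  refine ⟨fun t => S t (v t), h0, hmild.continuousOn, fun t ht => ?_⟩
  have h1 : ‖S t (v t)‖ ≤ r := by
    have := hmild.antitoneOn_norm hS haccP self_mem_Ici ht ht
    simp only [h0] at this
    exact this.trans (by simp [r])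
  have h2 := hmild.hasDeriv t ht
  rwa [Function.comp_apply, show P (S t (v t)) = S t (v t) from
    radialRetraction_of_norm_le hr h1] at h2

end WellPosed

/-! ### Regularity for initial data in the domain -/

section Regularity

variable {𝕜 X : Type*} [RCLike 𝕜] [NormedAddCommGroup X] [InnerProductSpace 𝕜 X]
  [NormedSpace ℝ X] [CompleteSpace X] [IsScalarTower ℝ 𝕜 X] {A : X →ₗ.[𝕜] X} {S : ℝ → X →L[𝕜] X}
  {G : X → X}

theorem IsSkewAdjoint.mem_domain_of_bound (hA : IsSkewAdjoint A) {x : X} {c : ℝ}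
    (h : ∀ w z, (w, z) ∈ A.graph → ‖inner 𝕜 x z‖ ≤ c * ‖w‖) : x ∈ A.domain := by
  have : x ∈ A.adjoint.domain := by
    rw [LinearPMap.mem_adjoint_domain_iff]
    exact AddMonoidHomClass.continuous_of_bound ((innerₛₗ 𝕜 x).comp A.toFun) c fun w =>
      h _ _ (LinearPMap.mem_graph A w)
  rwa [hA.2] at this

namespace IsMildSolution

theorem hasDerivWithinAt_of_mem_graph (hS : IsUnitaryGroup A S) {u : ℝ → X}
    (hu : IsMildSolution S G u) {t : ℝ} (ht : 0 ≤ t) {a : X} (h : (u t, a) ∈ A.graph) :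
    HasDerivWithinAt u (-a - G (u t)) (Ici 0) t := by
  have h1 := hS.hasDerivWithinAt_apply (hu.hasDeriv t ht) (hS.graph h (-t))
  simp only [hS.apply_neg, map_neg] at h1
  convert! h1 using 1
  abel

theorem hasDerivWithinAt_inner (hS : IsUnitaryGroup A S) {u : ℝ → X} (hu : IsMildSolution S G u)
    {t : ℝ} (ht : 0 ≤ t) {w z : X} (h : (w, z) ∈ A.graph) :
    HasDerivWithinAt (fun τ => inner 𝕜 (u τ) w) (inner 𝕜 (u t) z - inner 𝕜 (G (u t)) w)
      (Ici 0) t := by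
  have h1 : HasDerivAt (fun τ => S (-τ) w) (S (-t) z) t := by
    have := (hS.hasDerivAt h (-t)).scomp t (hasDerivAt_neg t)
    simpa [Function.comp_def] using this
  have h2 := (hu.hasDeriv t ht).inner 𝕜 h1.hasDerivWithinAt
  simp only [hS.inner_map, ← map_neg] at h2
  convert! h2 using 1
  rw [inner_neg_left]; ring

/-- The time increments of a solution are controlled by those at any other time. -/
theorem norm_increment_le (hS : IsUnitaryGroup A S) (hG : LipschitzOnBounded G)
    (hacc : ∀ x, 0 ≤ RCLike.re (inner 𝕜 x (G x))) {u : ℝ → X} (hu : IsMildSolution S G u) :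
    ∃ K : ℝ, 0 ≤ K ∧ ∀ s t h : ℝ, 0 ≤ s → 0 ≤ t → 0 ≤ h →
      ‖u (s + h) - u s‖ ≤ Real.exp (K * |t - s|) * ‖u (t + h) - u t‖ := by
  obtain ⟨K, hK⟩ := hG ‖u 0‖
  have hb : ∀ t, 0 ≤ t → ‖u t‖ ≤ ‖u 0‖ := fun t ht =>
    hu.antitoneOn_norm hS hacc self_mem_Ici ht ht
  exact ⟨K, K.2, fun s t h hs ht hh => dist_le hS hK (hu.shift hS hh) hu
    (fun t ht => hb _ (add_nonneg ht hh)) hb hs ht⟩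

theorem norm_deriv_le_of_increment {u : ℝ → X} {c s t : ℝ} {p q : X} (hs : 0 ≤ s) (ht : 0 ≤ t)
    (hp : HasDerivWithinAt u p (Ici 0) s) (hq : HasDerivWithinAt u q (Ici 0) t)
    (h : ∀ h : ℝ, 0 ≤ h → ‖u (s + h) - u s‖ ≤ c * ‖u (t + h) - u t‖) : ‖p‖ ≤ c * ‖q‖ := by
  have key : ∀ {t : ℝ} {q : X}, 0 ≤ t → HasDerivWithinAt u q (Ici 0) t →
      Tendsto (fun h : ℝ => h⁻¹ * ‖u (t + h) - u t‖) (𝓝[>] 0) (𝓝 ‖q‖) := by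
    intro t q ht hq
    have h1 := (hasDerivWithinAt_iff_tendsto_slope'
      (notMem_Ioi.2 le_rfl)).1 (hq.mono (Ioi_subset_Ici ht))
    have h2 : Tendsto (fun h : ℝ => t + h) (𝓝[>] 0) (𝓝[>] t) := by
      refine tendsto_nhdsWithin_iff.2 ⟨?_, ?_⟩
      · have : Tendsto (fun h : ℝ => t + h) (𝓝 0) (𝓝 (t + 0)) :=
          (continuous_const.add continuous_id).tendsto 0
        rw [add_zero] at this
        exact this.mono_left nhdsWithin_le_nhds
      · filter_upwards [self_mem_nhdsWithin] with h hh
        exact lt_add_of_pos_right t hh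
    refine ((h1.comp h2).norm).congr' ?_
    filter_upwards [self_mem_nhdsWithin] with h hh
    have hh : 0 < h := hh
    simp only [Function.comp_apply, slope_def_module, norm_smul, add_sub_cancel_left, norm_inv,
      Real.norm_of_nonneg hh.le]
  refine le_of_tendsto_of_tendsto (key hs hp) ((key ht hq).const_mul c) ?_
  filter_upwards [self_mem_nhdsWithin] with h' hh
  have hh : 0 < h' := hh
  have := h h' hh.le
  calc h'⁻¹ * ‖u (s + h') - u s‖ ≤ h'⁻¹ * (c * ‖u (t + h') - u t‖) := by gcongr
    _ = _ := by ring

/-- A solution that starts in `D(A)` stays in `D(A)`: its increments are of the order of the time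
step at all times, so that `w ↦ ⟨u(t), A w⟩` is bounded. -/
theorem mem_domain (hA : IsSkewAdjoint A) (hS : IsUnitaryGroup A S) (hG : LipschitzOnBounded G)
    (hacc : ∀ x, 0 ≤ RCLike.re (inner 𝕜 x (G x))) {u : ℝ → X} (hu : IsMildSolution S G u)
    (h0 : u 0 ∈ A.domain) {t : ℝ} (ht : 0 ≤ t) : u t ∈ A.domain := by
  obtain ⟨K, -, hK⟩ := hu.norm_increment_le hS hG hacc
  have hd0 := hu.hasDerivWithinAt_of_mem_graph hS le_rfl (LinearPMap.mem_graph A ⟨u 0, h0⟩)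
  set q := -A ⟨u 0, h0⟩ - G (u 0)
  refine hA.mem_domain_of_bound
    (c := Real.exp (K * |0 - t|) * ‖q‖ + ‖G (u t)‖) fun w z hwz => ?_
  have hd := hu.hasDerivWithinAt_inner hS ht hwz
  set D := inner 𝕜 (u t) z - inner 𝕜 (G (u t)) w
  have hD : ‖D‖ ≤ Real.exp (K * |0 - t|) * ‖q‖ * ‖w‖ := by
    have h1 := (hasDerivWithinAt_iff_tendsto_slope'
      (notMem_Ioi.2 le_rfl)).1 (hd.mono (Ioi_subset_Ici ht))
    have h2 := (hasDerivWithinAt_iff_tendsto_slope'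
      (notMem_Ioi.2 le_rfl)).1 (hd0.mono (Ioi_subset_Ici le_rfl))
    have h3 : Tendsto (fun τ : ℝ => τ - t) (𝓝[>] t) (𝓝[>] 0) := by
      refine tendsto_nhdsWithin_iff.2 ⟨?_, ?_⟩
      · have : Tendsto (fun τ : ℝ => τ - t) (𝓝 t) (𝓝 (t - t)) :=
          (continuous_id.sub continuous_const).tendsto t
        rw [sub_self] at this
        exact this.mono_left nhdsWithin_le_nhds
      · filter_upwards [self_mem_nhdsWithin] with τ hτ
        exact sub_pos.2 (mem_Ioi.1 hτ)
    refine le_of_tendsto_of_tendsto h1.norm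
      (((h2.comp h3).norm.const_mul (Real.exp (K * |0 - t|))).mul_const ‖w‖) ?_
    filter_upwards [self_mem_nhdsWithin] with τ hτ
    have hτ : 0 < τ - t := sub_pos.2 hτ
    have h4 := hK t 0 (τ - t) ht le_rfl hτ.le
    rw [add_sub_cancel, zero_add] at h4
    have h5 := norm_inner_le_norm (𝕜 := 𝕜) (u τ - u t) w
    rw [inner_sub_left] at h5
    simp only [Function.comp_apply, slope_def_module, norm_smul, sub_zero, norm_inv,
      Real.norm_of_nonneg hτ.le]
    calc (τ - t)⁻¹ * ‖inner 𝕜 (u τ) w - inner 𝕜 (u t) w‖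
        ≤ (τ - t)⁻¹ * ((Real.exp (K * |0 - t|) * ‖u (τ - t) - u 0‖) * ‖w‖) := by
          gcongr
          exact h5.trans (by gcongr)
      _ = _ := by ring
  have h6 : inner 𝕜 (u t) z = D + inner 𝕜 (G (u t)) w := by simp [D]
  rw [h6]
  refine (norm_add_le _ _).trans ?_
  have := norm_inner_le_norm (𝕜 := 𝕜) (G (u t)) w
  linarith

theorem isStrongSolution (hA : IsSkewAdjoint A) (hS : IsUnitaryGroup A S)
    (hG : LipschitzOnBounded G) (hacc : ∀ x, 0 ≤ RCLike.re (inner 𝕜 x (G x))) {u : ℝ → X}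
    (hu : IsMildSolution S G u) (h0 : u 0 ∈ A.domain) : IsStrongSolution A G u := by
  have hex : ∀ t, ∃ a, 0 ≤ t → (u t, a) ∈ A.graph := fun t => by
    by_cases ht : 0 ≤ t
    · exact ⟨_, fun _ => LinearPMap.mem_graph A ⟨u t, hu.mem_domain hA hS hG hacc h0 ht⟩⟩
    · exact ⟨0, fun h => absurd h ht⟩
  choose a ha using hex
  have hd : ∀ t, 0 ≤ t → HasDerivWithinAt u (-a t - G (u t)) (Ici 0) t := fun t ht =>
    hu.hasDerivWithinAt_of_mem_graph hS ht (ha t ht)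
  have hGu : ContinuousOn (fun t => G (u t)) (Ici 0) :=
    hG.continuous.comp_continuousOn hu.continuousOn
  obtain ⟨K, hK0, hK⟩ := hu.norm_increment_le hS hG hacc
  set p : ℝ → X := fun t => -a t - G (u t) with hp
  have hpn : ∀ s t, 0 ≤ s → 0 ≤ t → ‖p s‖ ≤ Real.exp (K * |t - s|) * ‖p t‖ := fun s t hs ht =>
    norm_deriv_le_of_increment hs ht (hd s hs) (hd t ht) fun h hh => hK s t h hs ht hh
  -- the norm of the derivative is continuous, and the derivative is weakly continuous
  have hpc : ContinuousOn p (Ici 0) := by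
    intro t ht
    have ht : 0 ≤ t := ht
    have hexp : ∀ c : ℝ, Tendsto (fun s => Real.exp (c * |t - s|)) (𝓝[Ici 0] t) (𝓝 1) := fun c => by
      have : Continuous fun s => Real.exp (c * |t - s|) := by fun_prop
      have := (this.tendsto t).mono_left (nhdsWithin_le_nhds (s := Ici 0))
      simpa using this
    have hnorm : Tendsto (fun s => ‖p s‖) (𝓝[Ici 0] t) (𝓝 ‖p t‖) := by
      have h1 := (hexp (-K)).mul_const ‖p t‖
      have h2 := (hexp K).mul_const ‖p t‖
      rw [one_mul] at h1 h2
      refine tendsto_of_tendsto_of_tendsto_of_le_of_le' h1 h2 ?_ ?_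
      · filter_upwards [self_mem_nhdsWithin] with s hs
        have := hpn t s ht hs
        rw [abs_sub_comm] at this
        rw [neg_mul, Real.exp_neg, inv_mul_le_iff₀ (Real.exp_pos _)]
        exact this
      · filter_upwards [self_mem_nhdsWithin] with s hs
        exact hpn s t hs ht
    have hweak : ∀ y, Tendsto (fun s => inner 𝕜 (p s) y) (𝓝[Ici 0] t) (𝓝 (inner 𝕜 (p t) y)) := by
      have hlip : ∀ s, ‖p s‖ ≤ ‖p t‖ + 1 → ∀ x y : X,
          ‖inner 𝕜 (p s) x - inner 𝕜 (p s) y‖ ≤ (‖p t‖ + 1) * ‖x - y‖ := fun s hs x y => by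
        rw [← inner_sub_right]
        exact (norm_inner_le_norm _ _).trans (by gcongr)
      refine tendsto_of_tendsto_on_dense (f := fun s y => inner 𝕜 (p s) y)
        (g := fun y => inner 𝕜 (p t) y) (C := ‖p t‖ + 1) hA.1 ?_ (hlip t (by simp)) ?_
      · filter_upwards [hnorm.eventually (ge_mem_nhds (lt_add_one ‖p t‖))] with s hs
        exact hlip s hs
      · intro y hy
        have hyz := LinearPMap.mem_graph A ⟨y, hy⟩
        have he : ∀ s, 0 ≤ s → inner 𝕜 (p s) y =
            inner 𝕜 (u s) (A ⟨y, hy⟩) - inner 𝕜 (G (u s)) y := fun s hs => by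
          rw [hp, inner_sub_left, inner_neg_left, hA.inner_graph (ha s hs) hyz, neg_neg]
        have h1 : Tendsto (fun s => inner 𝕜 (u s) (A ⟨y, hy⟩) - inner 𝕜 (G (u s)) y)
            (𝓝[Ici 0] t) (𝓝 (inner 𝕜 (u t) (A ⟨y, hy⟩) - inner 𝕜 (G (u t)) y)) :=
          ((hu.continuousOn t ht).inner tendsto_const_nhds).sub
            ((hGu t ht).inner tendsto_const_nhds)
        rw [← he t ht] at h1
        refine h1.congr' ?_
        filter_upwards [self_mem_nhdsWithin] with s hs
        exact (he s hs).symm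
    -- weak convergence and convergence of the norms give strong convergence
    have hsq : Tendsto (fun s => ‖p s - p t‖ ^ 2) (𝓝[Ici 0] t) (𝓝 0) := by
      have h1 := ((hnorm.pow 2).sub (((RCLike.continuous_re.tendsto _).comp
        (hweak (p t))).const_mul 2)).add_const (‖p t‖ ^ 2)
      rw [inner_self_eq_norm_sq] at h1
      refine (h1.congr fun s => (@norm_sub_sq 𝕜 _ _ _ _ (p s) (p t)).symm).trans_eq ?_
      congr 1; ring
    refine tendsto_iff_norm_sub_tendsto_zero.2 ?_
    have := hsq.sqrt
    simpa only [Real.sqrt_sq (norm_nonneg _), Real.sqrt_zero] using this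
  refine ⟨a, ha, hu.continuousOn, (hpc.neg.sub hGu).congr fun t _ => ?_, hd⟩
  simp [hp]

end IsMildSolution

end Regularity

/-! ### The comparison function and its convex conjugate -/

namespace IsProfile

variable {g : ℝ → ℝ} {s₀ : ℝ}

theorem pos (hg : IsProfile g s₀) {x : ℝ} (hx : 0 < x) : 0 < g x := by
  have := hg.strictMono hx
  rwa [hg.zero] at this

theorem nonneg (hg : IsProfile g s₀) {x : ℝ} (hx : 0 ≤ x) : 0 ≤ g x := by
  have := hg.strictMono.monotone hx
  rwa [hg.zero] at this

theorem hasDerivAt (hg : IsProfile g s₀) (x : ℝ) : HasDerivAt g (deriv g x) x :=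
  (hg.contDiff.differentiable one_ne_zero x).hasDerivAt

theorem sq_pos (hg : IsProfile g s₀) : 0 < s₀ ^ 2 := pow_pos hg.s₀_pos 2

theorem Hfun_nonneg (hg : IsProfile g s₀) (s : ℝ) : 0 ≤ Hfun g s :=
  mul_nonneg (Real.sqrt_nonneg _) (hg.nonneg (Real.sqrt_nonneg _))

theorem Hfun_zero (g : ℝ → ℝ) : Hfun g 0 = 0 := by simp [Hfun]

theorem Hfun_sq (g : ℝ → ℝ) {x : ℝ} (hx : 0 ≤ x) : Hfun g (x ^ 2) = x * g x := by
  rw [Hfun, Real.sqrt_sq hx]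

theorem hasDerivAt_Hfun (hg : IsProfile g s₀) {s : ℝ} (hs : 0 < s) :
    HasDerivAt (Hfun g) ((g √s / √s + deriv g √s) / 2) s := by
  have h1 := Real.hasDerivAt_sqrt hs.ne'
  have h2 := h1.mul ((hg.hasDerivAt √s).comp s h1)
  have hpos := Real.sqrt_pos.2 hs
  convert! h2 using 1
  simp only [Function.comp_apply]
  field_simp

theorem tendsto_div (hg : IsProfile g s₀) : Tendsto (fun x => g x / x) (𝓝[≠] 0) (𝓝 0) := by
  have := hasDerivAt_iff_tendsto_slope.1 (hg.hasDerivAt 0)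
  rw [hg.deriv_zero] at this
  refine this.congr fun x => ?_
  rw [slope_def_field, hg.zero, sub_zero, sub_zero]

theorem tendsto_sqrt_nhdsGT : Tendsto (fun x : ℝ => √x) (𝓝[>] 0) (𝓝[≠] 0) := by
  refine tendsto_nhdsWithin_iff.2 ⟨?_, ?_⟩
  · have := (Real.continuous_sqrt.tendsto 0).mono_left (nhdsWithin_le_nhds (s := Ioi 0))
    rwa [Real.sqrt_zero] at this
  · filter_upwards [self_mem_nhdsWithin] with x hx
    exact (Real.sqrt_pos.2 hx).ne'

theorem hasDerivAt_Hfun_zero (hg : IsProfile g s₀) : HasDerivAt (Hfun g) 0 0 := by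
  rw [hasDerivAt_iff_tendsto_slope, ← Iio_union_Ioi, nhdsWithin_union, tendsto_sup]
  constructor
  · refine tendsto_const_nhds.congr' ?_
    filter_upwards [self_mem_nhdsWithin] with x hx
    have hx : x < 0 := hx
    simp [slope_def_field, Hfun, Real.sqrt_eq_zero_of_nonpos hx.le]
  · refine (hg.tendsto_div.comp tendsto_sqrt_nhdsGT).congr' ?_
    filter_upwards [self_mem_nhdsWithin] with x hx
    have hx : 0 < x := hx
    have hpos := Real.sqrt_pos.2 hx
    rw [slope_def_field, Hfun_zero, sub_zero, sub_zero, Function.comp_apply, Hfun,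
      div_eq_div_iff hpos.ne' hx.ne']
    linear_combination (-g √x) * Real.mul_self_sqrt hx.le

theorem differentiableAt_Hfun (hg : IsProfile g s₀) {s : ℝ} (hs : 0 ≤ s) :
    DifferentiableAt ℝ (Hfun g) s := by
  rcases hs.eq_or_lt with rfl | hs
  · exact hg.hasDerivAt_Hfun_zero.differentiableAt
  · exact (hg.hasDerivAt_Hfun hs).differentiableAt

theorem deriv_Hfun_zero (hg : IsProfile g s₀) : deriv (Hfun g) 0 = 0 :=
  hg.hasDerivAt_Hfun_zero.deriv

theorem continuousOn_Hfun (hg : IsProfile g s₀) : ContinuousOn (Hfun g) (Ici 0) :=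
  fun _ hs => (hg.differentiableAt_Hfun hs).continuousAt.continuousWithinAt

theorem continuousOn_deriv_Hfun (hg : IsProfile g s₀) : ContinuousOn (deriv (Hfun g)) (Ici 0) := by
  have hdc : Continuous (deriv g) := hg.contDiff.continuous_deriv le_rfl
  have hgc : Continuous g := hg.contDiff.continuous
  intro s hs
  rcases (mem_Ici.1 hs).eq_or_lt with rfl | hs
  · rw [← continuousWithinAt_Ioi_iff_Ici, ContinuousWithinAt, hg.deriv_Hfun_zero]
    have h1 := hg.tendsto_div.comp tendsto_sqrt_nhdsGT
    have h2 : Tendsto (fun x => deriv g √x) (𝓝[>] 0) (𝓝 0) := by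
      have := ((hdc.comp Real.continuous_sqrt).tendsto 0).mono_left
        (nhdsWithin_le_nhds (s := Ioi 0))
      simpa only [Function.comp_def, Real.sqrt_zero, hg.deriv_zero] using this
    have h3 := (h1.add h2).div_const 2
    simp only [add_zero, zero_div] at h3
    refine h3.congr' ?_
    filter_upwards [self_mem_nhdsWithin] with x hx
    exact (hg.hasDerivAt_Hfun hx).deriv.symm
  · have hc : ContinuousAt (fun x => (g √x / √x + deriv g √x) / 2) s := by
      have := (Real.sqrt_pos.2 hs).ne'
      have h1 : ContinuousAt (fun x => g √x) s := (hgc.comp Real.continuous_sqrt).continuousAt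
      have h2 : ContinuousAt (fun x => deriv g √x) s := (hdc.comp Real.continuous_sqrt).continuousAt
      exact ((h1.div Real.continuous_sqrt.continuousAt this).add h2).div_const 2
    refine (hc.congr ?_).continuousWithinAt
    filter_upwards [Ioi_mem_nhds hs] with x hx
    exact (hg.hasDerivAt_Hfun hx).deriv.symm

theorem strictMonoOn_deriv_Hfun (hg : IsProfile g s₀) :
    StrictMonoOn (deriv (Hfun g)) (Icc 0 (s₀ ^ 2)) :=
  hg.strictConvexOn.strictMonoOn_deriv fun _ hs => hg.differentiableAt_Hfun hs.1

theorem deriv_Hfun_pos (hg : IsProfile g s₀) {s : ℝ} (hs : s ∈ Ioc 0 (s₀ ^ 2)) :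
    0 < deriv (Hfun g) s := by
  have := hg.strictMonoOn_deriv_Hfun ⟨le_rfl, hg.sq_pos.le⟩ (Ioc_subset_Icc_self hs) hs.1
  rwa [hg.deriv_Hfun_zero] at this

/-- `H'(s₀²) > 0`. -/
theorem slope_pos (hg : IsProfile g s₀) : 0 < deriv (Hfun g) (s₀ ^ 2) :=
  hg.deriv_Hfun_pos ⟨hg.sq_pos, le_rfl⟩

theorem Hfun_tangent (hg : IsProfile g s₀) {s t : ℝ} (hs : s ∈ Icc 0 (s₀ ^ 2))
    (ht : t ∈ Icc 0 (s₀ ^ 2)) : deriv (Hfun g) s * (t - s) ≤ Hfun g t - Hfun g s := by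
  have hd : ∀ {a b : ℝ}, 0 ≤ a → ∀ x ∈ Ioo a b, HasDerivAt (Hfun g) (deriv (Hfun g) x) x :=
    fun ha x hx => (hg.differentiableAt_Hfun (ha.trans hx.1.le)).hasDerivAt
  have hc : ∀ {a b : ℝ}, 0 ≤ a → ContinuousOn (Hfun g) (Icc a b) :=
    fun ha => hg.continuousOn_Hfun.mono fun x hx => ha.trans hx.1
  have hm := hg.strictMonoOn_deriv_Hfun.monotoneOn
  rcases lt_trichotomy s t with h | rfl | h
  · obtain ⟨c, hcm, he⟩ := exists_hasDerivAt_eq_slope _ _ h (hc hs.1) (hd hs.1)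
    rw [eq_div_iff (sub_pos.2 h).ne'] at he
    rw [← he]
    have := hm hs ⟨hs.1.trans hcm.1.le, hcm.2.le.trans ht.2⟩ hcm.1.le
    have := sub_pos.2 h
    gcongr
  · simp
  · obtain ⟨c, hcm, he⟩ := exists_hasDerivAt_eq_slope _ _ h (hc ht.1) (hd ht.1)
    rw [eq_div_iff (sub_pos.2 h).ne'] at he
    have := hm ⟨ht.1.trans hcm.1.le, hcm.2.le.trans hs.2⟩ hs hcm.2.le
    have h2 := mul_le_mul_of_nonneg_right this (sub_pos.2 h).le
    linarith

/-! ### The inverse of `H'` -/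

theorem HderivInv_deriv (hg : IsProfile g s₀) {s : ℝ} (hs : s ∈ Icc 0 (s₀ ^ 2)) :
    HderivInv g s₀ (deriv (Hfun g) s) = s := by
  have : {t : ℝ | t ∈ Icc 0 (s₀ ^ 2) ∧ deriv (Hfun g) t ≤ deriv (Hfun g) s} = Icc 0 s := by
    ext t
    constructor
    · rintro ⟨ht, h⟩
      exact ⟨ht.1, (hg.strictMonoOn_deriv_Hfun.le_iff_le ht hs).1 h⟩
    · rintro ⟨h1, h2⟩
      have ht : t ∈ Icc 0 (s₀ ^ 2) := ⟨h1, h2.trans hs.2⟩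
      exact ⟨ht, (hg.strictMonoOn_deriv_Hfun.le_iff_le ht hs).2 h2⟩
  rw [HderivInv, this, csSup_Icc hs.1]

theorem exists_deriv_eq (hg : IsProfile g s₀) {v : ℝ} (hv : v ∈ Icc 0 (deriv (Hfun g) (s₀ ^ 2))) :
    ∃ s ∈ Icc 0 (s₀ ^ 2), deriv (Hfun g) s = v := by
  have := intermediate_value_Icc hg.sq_pos.le
    (hg.continuousOn_deriv_Hfun.mono Icc_subset_Ici_self)
  rw [hg.deriv_Hfun_zero] at this
  exact this hv

theorem HderivInv_mem (hg : IsProfile g s₀) {v : ℝ}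
    (hv : v ∈ Icc 0 (deriv (Hfun g) (s₀ ^ 2))) :
    HderivInv g s₀ v ∈ Icc 0 (s₀ ^ 2) ∧ deriv (Hfun g) (HderivInv g s₀ v) = v := by
  obtain ⟨s, hs, rfl⟩ := hg.exists_deriv_eq hv
  rw [hg.HderivInv_deriv hs]
  exact ⟨hs, rfl⟩

theorem HderivInv_pos (hg : IsProfile g s₀) {v : ℝ}
    (hv : v ∈ Ioc 0 (deriv (Hfun g) (s₀ ^ 2))) : 0 < HderivInv g s₀ v := by
  obtain ⟨h1, h2⟩ := hg.HderivInv_mem (Ioc_subset_Icc_self hv)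
  refine h1.1.lt_of_ne fun h => ?_
  rw [← h, hg.deriv_Hfun_zero] at h2
  exact hv.1.ne h2

theorem HderivInv_mono (hg : IsProfile g s₀) {v w : ℝ} (hv : 0 ≤ v) (hvw : v ≤ w) :
    HderivInv g s₀ v ≤ HderivInv g s₀ w :=
  csSup_le_csSup ⟨s₀ ^ 2, fun _ h => h.1.2⟩
    ⟨0, ⟨le_rfl, hg.sq_pos.le⟩, by rwa [hg.deriv_Hfun_zero]⟩ fun _ h => ⟨h.1, h.2.trans hvw⟩

theorem continuousOn_HderivInv (hg : IsProfile g s₀) :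
    ContinuousOn (HderivInv g s₀) (Icc 0 (deriv (Hfun g) (s₀ ^ 2))) := by
  rw [continuousOn_iff_continuous_domRestrict]
  let f : Icc 0 (deriv (Hfun g) (s₀ ^ 2)) → Icc 0 (s₀ ^ 2) := fun v =>
    ⟨HderivInv g s₀ v, (hg.HderivInv_mem v.2).1⟩
  have hf : Monotone f := fun v w h => hg.HderivInv_mono v.2.1 h
  have hsurj : Function.Surjective f := fun s =>
    ⟨⟨deriv (Hfun g) s, by
      have h := hg.strictMonoOn_deriv_Hfun.monotoneOn
      have h1 := h ⟨le_rfl, hg.sq_pos.le⟩ s.2 s.2.1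
      rw [hg.deriv_Hfun_zero] at h1
      exact ⟨h1, h s.2 ⟨hg.sq_pos.le, le_rfl⟩ s.2.2⟩⟩, Subtype.ext (hg.HderivInv_deriv s.2)⟩
  exact continuous_subtype_val.comp (hf.continuous_of_surjective hsurj)

/-! ### The convex conjugate -/

theorem bddAbove_conj (hg : IsProfile g s₀) (r : ℝ) :
    BddAbove ((fun s => r * s - Hfun g s) '' Icc 0 (s₀ ^ 2)) :=
  (isCompact_Icc.image_of_continuousOn ((by fun_prop : ContinuousOn (fun s => r * s) _).sub
    (hg.continuousOn_Hfun.mono Icc_subset_Ici_self))).bddAbove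

/-- The Fenchel-Young inequality. -/
theorem le_conj (hg : IsProfile g s₀) (r : ℝ) {s : ℝ} (hs : s ∈ Icc 0 (s₀ ^ 2)) :
    r * s ≤ HhatConj g s₀ r + Hfun g s := by
  have : r * s - Hfun g s ≤ HhatConj g s₀ r := le_csSup (hg.bddAbove_conj r) ⟨s, hs, rfl⟩
  linarith

/-- Equality in the Fenchel-Young inequality: the supremum is attained at `(H')⁻¹(r)`. -/
theorem conj_eq (hg : IsProfile g s₀) {r : ℝ} (hr : r ∈ Icc 0 (deriv (Hfun g) (s₀ ^ 2))) :
    HhatConj g s₀ r = r * HderivInv g s₀ r - Hfun g (HderivInv g s₀ r) := by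
  obtain ⟨h1, h2⟩ := hg.HderivInv_mem hr
  refine le_antisymm (csSup_le (Set.Nonempty.image _ ⟨0, le_rfl, hg.sq_pos.le⟩) ?_) ?_
  · rintro _ ⟨t, ht, rfl⟩
    have := hg.Hfun_tangent h1 ht
    rw [h2] at this
    simp only
    linarith
  · linarith [hg.le_conj r h1]

theorem conj_sub_le (hg : IsProfile g s₀) {r t : ℝ} (hr : r ∈ Icc 0 (deriv (Hfun g) (s₀ ^ 2))) :
    HhatConj g s₀ r - HhatConj g s₀ t ≤ HderivInv g s₀ r * (r - t) := by
  have h1 := hg.conj_eq hr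
  have h2 := hg.le_conj t (hg.HderivInv_mem hr).1
  linarith

theorem conj_nonneg (hg : IsProfile g s₀) (r : ℝ) : 0 ≤ HhatConj g s₀ r := by
  have := hg.le_conj r ⟨le_rfl, hg.sq_pos.le⟩
  rwa [mul_zero, Hfun_zero, add_zero] at this

theorem conj_pos (hg : IsProfile g s₀) {r : ℝ} (hr : r ∈ Ioc 0 (deriv (Hfun g) (s₀ ^ 2))) :
    0 < HhatConj g s₀ r := by
  have hr' := Ioc_subset_Icc_self hr
  have hspos := hg.HderivInv_pos hr
  obtain ⟨h1, h2⟩ := hg.HderivInv_mem hr'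
  set s := HderivInv g s₀ r
  -- strict inequality between the tangents at `s` and at `s / 2`
  have hs2 : s / 2 ∈ Icc 0 (s₀ ^ 2) := ⟨by linarith, by linarith [h1.2]⟩
  have h3 := hg.le_conj r hs2
  have h4 := hg.Hfun_tangent hs2 ⟨le_rfl, hg.sq_pos.le⟩
  have h5 := hg.strictMonoOn_deriv_Hfun hs2 h1 (by linarith)
  rw [h2] at h5
  rw [Hfun_zero] at h4
  nlinarith

theorem conj_mono (hg : IsProfile g s₀) {r t : ℝ} (hr : r ∈ Icc 0 (deriv (Hfun g) (s₀ ^ 2)))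
    (h : r ≤ t) : HhatConj g s₀ r ≤ HhatConj g s₀ t := by
  have h1 := hg.conj_sub_le (t := t) hr
  have h2 := (hg.HderivInv_mem hr).1.1
  nlinarith

theorem continuousOn_conj (hg : IsProfile g s₀) :
    ContinuousOn (HhatConj g s₀) (Icc 0 (deriv (Hfun g) (s₀ ^ 2))) := by
  have h1 : ContinuousOn (fun r => r * HderivInv g s₀ r - Hfun g (HderivInv g s₀ r))
      (Icc 0 (deriv (Hfun g) (s₀ ^ 2))) :=
    (continuousOn_id.mul hg.continuousOn_HderivInv).sub
      (hg.continuousOn_Hfun.comp hg.continuousOn_HderivInv fun r hr => (hg.HderivInv_mem hr).1.1)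
  exact h1.congr fun r hr => hg.conj_eq hr

theorem hasDerivAt_conj (hg : IsProfile g s₀) {v : ℝ}
    (hv : v ∈ Ioo 0 (deriv (Hfun g) (s₀ ^ 2))) :
    HasDerivAt (HhatConj g s₀) (HderivInv g s₀ v) v := by
  rw [hasDerivAt_iff_tendsto_slope, tendsto_iff_norm_sub_tendsto_zero]
  have hc := hg.continuousOn_HderivInv.continuousAt (Icc_mem_nhds hv.1 hv.2)
  have h0 := (tendsto_iff_norm_sub_tendsto_zero.1 hc.tendsto).mono_left
    (nhdsWithin_le_nhds (s := {v}ᶜ))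
  refine squeeze_zero' (.of_forall fun _ => norm_nonneg _) ?_ h0
  filter_upwards [self_mem_nhdsWithin, mem_nhdsWithin_of_mem_nhds (Icc_mem_nhds hv.1 hv.2)]
    with t hne ht
  have hne : t ≠ v := hne
  have h1 := hg.conj_sub_le (t := v) ht
  have h2 := hg.conj_sub_le (t := t) (Ioo_subset_Icc_self hv)
  have hsl := slope_def_field (HhatConj g s₀) v t
  rw [Real.norm_eq_abs, Real.norm_eq_abs, hsl]
  rcases hne.lt_or_gt with h | h
  · have hneg : t - v < 0 := sub_neg.2 h
    have h3 : HderivInv g s₀ t ≤ (HhatConj g s₀ t - HhatConj g s₀ v) / (t - v) := by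
      rw [le_div_iff_of_neg hneg]; linarith
    have h4 : (HhatConj g s₀ t - HhatConj g s₀ v) / (t - v) ≤ HderivInv g s₀ v := by
      rw [div_le_iff_of_neg hneg]; linarith
    rw [abs_of_nonpos (by linarith), abs_of_nonpos (by linarith)]
    linarith
  · have hpos : 0 < t - v := sub_pos.2 h
    have h3 : (HhatConj g s₀ t - HhatConj g s₀ v) / (t - v) ≤ HderivInv g s₀ t := by
      rw [div_le_iff₀ hpos]; linarith
    have h4 : HderivInv g s₀ v ≤ (HhatConj g s₀ t - HhatConj g s₀ v) / (t - v) := by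
      rw [le_div_iff₀ hpos]; linarith
    rw [abs_of_nonneg (by linarith), abs_of_nonneg (by linarith)]
    linarith

theorem Lfun_eq {r : ℝ} (hr : 0 < r) : Lfun g s₀ r = HhatConj g s₀ r / r := by
  rw [Lfun, if_neg hr.ne']

theorem Lfun_pos (hg : IsProfile g s₀) {r : ℝ} (hr : r ∈ Ioc 0 (deriv (Hfun g) (s₀ ^ 2))) :
    0 < Lfun g s₀ r := by
  rw [Lfun_eq hr.1]
  exact div_pos (hg.conj_pos hr) hr.1

theorem Lfun_le_HderivInv (hg : IsProfile g s₀) {r : ℝ}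
    (hr : r ∈ Ioc 0 (deriv (Hfun g) (s₀ ^ 2))) : Lfun g s₀ r ≤ HderivInv g s₀ r := by
  rw [Lfun_eq hr.1, div_le_iff₀ hr.1, hg.conj_eq (Ioc_subset_Icc_self hr), mul_comm]
  linarith [hg.Hfun_nonneg (HderivInv g s₀ r)]

end IsProfile

/-! ### The decay profile -/

theorem integral_const_div_sq {a b c : ℝ} (ha : 0 < a) (hab : a ≤ b) :
    ∫ v in a..b, c / v ^ 2 = c * (1 / a - 1 / b) := by
  have hpos : ∀ v ∈ uIcc a b, 0 < v := fun v hv => by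
    rw [uIcc_of_le hab] at hv; exact ha.trans_le hv.1
  rw [intervalIntegral.integral_eq_sub_of_hasDerivAt (f := fun v => -c * v⁻¹)]
  · field_simp; ring
  · intro v hv
    convert! (hasDerivAt_inv (hpos v hv).ne').const_mul (-c) using 1
    field_simp
  · refine ContinuousOn.intervalIntegrable (continuousOn_const.div (by fun_prop) fun v hv => ?_)
    exact pow_ne_zero 2 (hpos v hv).ne'

namespace IsProfile

variable {g : ℝ → ℝ} {s₀ : ℝ}

theorem LambdaH_HderivInv (hg : IsProfile g s₀) {v : ℝ}
    (hv : v ∈ Ioc 0 (deriv (Hfun g) (s₀ ^ 2))) :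
    1 - LambdaH g (HderivInv g s₀ v) = HhatConj g s₀ v / (v * HderivInv g s₀ v) := by
  have h1 := hg.HderivInv_pos hv
  have h2 := (hg.HderivInv_mem (Ioc_subset_Icc_self hv)).2
  have h3 := hv.1
  rw [LambdaH, h2, hg.conj_eq (Ioc_subset_Icc_self hv)]
  field_simp

theorem LambdaH_mem (hg : IsProfile g s₀) {s : ℝ} (hs : s ∈ Ioc 0 (s₀ ^ 2)) :
    0 ≤ LambdaH g s ∧ LambdaH g s < 1 := by
  have h1 := hg.deriv_Hfun_pos hs
  have h2 : deriv (Hfun g) s ≤ deriv (Hfun g) (s₀ ^ 2) :=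
    hg.strictMonoOn_deriv_Hfun.monotoneOn (Ioc_subset_Icc_self hs) ⟨hg.sq_pos.le, le_rfl⟩ hs.2
  have h3 := hg.LambdaH_HderivInv ⟨h1, h2⟩
  rw [hg.HderivInv_deriv (Ioc_subset_Icc_self hs)] at h3
  have h4 : 0 < HhatConj g s₀ (deriv (Hfun g) s) / (deriv (Hfun g) s * s) :=
    div_pos (hg.conj_pos ⟨h1, h2⟩) (mul_pos h1 hs.1)
  exact ⟨div_nonneg (hg.Hfun_nonneg s) (mul_pos hs.1 h1).le, by linarith⟩

/-- The integrand in the definition of `ψ`. -/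
noncomputable def psiIntegrand (g : ℝ → ℝ) (s₀ v : ℝ) : ℝ :=
  1 / (v ^ 2 * (1 - LambdaH g (HderivInv g s₀ v)))

theorem psi_eq (g : ℝ → ℝ) (s₀ s : ℝ) : psi g s₀ s = 1 / deriv (Hfun g) (s₀ ^ 2) +
    ∫ v in (1 / s)..(deriv (Hfun g) (s₀ ^ 2)), psiIntegrand g s₀ v := rfl

theorem psiIntegrand_eq (hg : IsProfile g s₀) {v : ℝ}
    (hv : v ∈ Ioc 0 (deriv (Hfun g) (s₀ ^ 2))) :
    psiIntegrand g s₀ v = HderivInv g s₀ v / (v * HhatConj g s₀ v) := by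
  have h1 := hg.HderivInv_pos hv
  have h2 := hg.conj_pos hv
  have h3 := hv.1
  rw [psiIntegrand, hg.LambdaH_HderivInv hv]
  field_simp

theorem le_psiIntegrand (hg : IsProfile g s₀) {v : ℝ}
    (hv : v ∈ Ioc 0 (deriv (Hfun g) (s₀ ^ 2))) : 1 / v ^ 2 ≤ psiIntegrand g s₀ v := by
  obtain ⟨h1, h2⟩ := hg.HderivInv_mem (Ioc_subset_Icc_self hv)
  have h3 := hg.LambdaH_mem ⟨hg.HderivInv_pos hv, h1.2⟩
  have h4 := hv.1
  refine one_div_le_one_div_of_le (mul_pos (by positivity) (by linarith)) ?_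
  exact mul_le_of_le_one_right (by positivity) (by linarith)

theorem continuousOn_psiIntegrand (hg : IsProfile g s₀) :
    ContinuousOn (psiIntegrand g s₀) (Ioc 0 (deriv (Hfun g) (s₀ ^ 2))) := by
  have h : ContinuousOn (fun v => HderivInv g s₀ v / (v * HhatConj g s₀ v))
      (Ioc 0 (deriv (Hfun g) (s₀ ^ 2))) :=
    (hg.continuousOn_HderivInv.mono Ioc_subset_Icc_self).div
      (continuousOn_id.mul (hg.continuousOn_conj.mono Ioc_subset_Icc_self)) fun v hv =>
        (mul_pos hv.1 (hg.conj_pos hv)).ne'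
  exact h.congr fun v hv => hg.psiIntegrand_eq hv

theorem intervalIntegrable_psiIntegrand (hg : IsProfile g s₀) {a b : ℝ} (ha : 0 < a) (hab : a ≤ b)
    (hb : b ≤ deriv (Hfun g) (s₀ ^ 2)) : IntervalIntegrable (psiIntegrand g s₀) volume a b := by
  refine (hg.continuousOn_psiIntegrand.mono ?_).intervalIntegrable
  rw [uIcc_of_le hab]
  exact fun v hv => ⟨ha.trans_le hv.1, hv.2.trans hb⟩

theorem inv_mem (hg : IsProfile g s₀) {x : ℝ} (hx : 1 / deriv (Hfun g) (s₀ ^ 2) ≤ x) :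
    1 / x ∈ Ioc 0 (deriv (Hfun g) (s₀ ^ 2)) := by
  have h1 := hg.slope_pos
  have h2 : 0 < x := (one_div_pos.2 h1).trans_le hx
  exact ⟨one_div_pos.2 h2, by rwa [one_div_le h2 h1]⟩

theorem psi_sub (hg : IsProfile g s₀) {x y : ℝ} (hx : 1 / deriv (Hfun g) (s₀ ^ 2) ≤ x)
    (hxy : x ≤ y) :
    psi g s₀ y - psi g s₀ x = ∫ v in (1 / y)..(1 / x), psiIntegrand g s₀ v := by
  have hx' := hg.inv_mem hx
  have hy' := hg.inv_mem (hx.trans hxy)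
  have hpos : 0 < x := one_div_pos.1 hx'.1
  have h1 := intervalIntegral.integral_add_adjacent_intervals
    (hg.intervalIntegrable_psiIntegrand hy'.1 (one_div_le_one_div_of_le hpos hxy) hx'.2)
    (hg.intervalIntegrable_psiIntegrand hx'.1 hx'.2 le_rfl)
  rw [psi_eq, psi_eq, ← h1]
  ring

theorem sub_le_psi_sub (hg : IsProfile g s₀) {x y : ℝ} (hx : 1 / deriv (Hfun g) (s₀ ^ 2) ≤ x)
    (hxy : x ≤ y) : y - x ≤ psi g s₀ y - psi g s₀ x := by
  have hx' := hg.inv_mem hx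
  have hy' := hg.inv_mem (hx.trans hxy)
  have hpos : 0 < x := one_div_pos.1 hx'.1
  have hle := one_div_le_one_div_of_le hpos hxy
  rw [hg.psi_sub hx hxy]
  have h1 := integral_const_div_sq (c := 1) hy'.1 hle
  rw [one_div_one_div, one_div_one_div, one_mul] at h1
  rw [← h1]
  refine intervalIntegral.integral_mono_on hle ?_
    (hg.intervalIntegrable_psiIntegrand hy'.1 hle hx'.2) fun v hv =>
      hg.le_psiIntegrand ⟨hy'.1.trans_le hv.1, hv.2.trans hx'.2⟩
  refine ContinuousOn.intervalIntegrable (continuousOn_const.div (by fun_prop) fun v hv => ?_)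
  rw [uIcc_of_le hle] at hv
  exact pow_ne_zero 2 (hy'.1.trans_le hv.1).ne'

theorem psi_start (g : ℝ → ℝ) (s₀ : ℝ) :
    psi g s₀ (1 / deriv (Hfun g) (s₀ ^ 2)) = 1 / deriv (Hfun g) (s₀ ^ 2) := by
  rw [psi_eq, one_div_one_div, intervalIntegral.integral_same, add_zero]

theorem continuousOn_psi (hg : IsProfile g s₀) (b : ℝ) :
    ContinuousOn (psi g s₀) (Icc (1 / deriv (Hfun g) (s₀ ^ 2)) b) := by
  rcases lt_or_ge b (1 / deriv (Hfun g) (s₀ ^ 2)) with hb | hb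
  · rw [Icc_eq_empty hb.not_ge]; exact continuousOn_empty _
  have hb' := hg.inv_mem hb
  have hbpos : 0 < b := one_div_pos.1 hb'.1
  have h1 : ContinuousOn (fun x => ∫ v in x..(deriv (Hfun g) (s₀ ^ 2)), psiIntegrand g s₀ v)
      (uIcc (1 / b) (deriv (Hfun g) (s₀ ^ 2))) := by
    refine intervalIntegral.continuousOn_primitive_interval_left ?_
    rw [uIcc_of_le hb'.2]
    exact (hg.continuousOn_psiIntegrand.mono fun v hv =>
      ⟨hb'.1.trans_le hv.1, hv.2⟩).integrableOn_Icc
  rw [uIcc_of_le hb'.2] at h1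
  have hpos : ∀ x ∈ Icc (1 / deriv (Hfun g) (s₀ ^ 2)) b, 0 < x := fun x hx =>
    one_div_pos.1 (hg.inv_mem hx.1).1
  have h2 : ContinuousOn (fun x : ℝ => 1 / x) (Icc (1 / deriv (Hfun g) (s₀ ^ 2)) b) :=
    continuousOn_const.div continuousOn_id fun x hx => (hpos x hx).ne'
  exact continuousOn_const.add (h1.comp h2 fun x hx =>
    ⟨one_div_le_one_div_of_le (hpos x hx) hx.2, (hg.inv_mem hx.1).2⟩)

/-- `ψ⁻¹` is the inverse of `ψ`, extended by a constant. -/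
theorem psiInv_spec (hg : IsProfile g s₀) (τ : ℝ) :
    1 / deriv (Hfun g) (s₀ ^ 2) ≤ psiInv g s₀ τ ∧
      psi g s₀ (psiInv g s₀ τ) = max τ (1 / deriv (Hfun g) (s₀ ^ 2)) := by
  set a := 1 / deriv (Hfun g) (s₀ ^ 2) with ha
  have hle : a ≤ max τ a := le_max_right _ _
  have h1 : max τ a ∈ Icc (psi g s₀ a) (psi g s₀ (max τ a)) := by
    have := hg.sub_le_psi_sub le_rfl hle
    rw [← ha, psi_start] at this
    rw [psi_start]
    exact ⟨hle, by linarith⟩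
  obtain ⟨x, hx, hpx⟩ := intermediate_value_Icc hle (hg.continuousOn_psi _) h1
  have hset : {s : ℝ | a ≤ s ∧ τ ≤ psi g s₀ s} = Ici x := by
    ext y
    constructor
    · rintro ⟨hy, hτ⟩
      by_contra hlt
      rw [mem_Ici, not_le] at hlt
      have h2 := hg.sub_le_psi_sub hy hlt.le
      have h3 := hg.sub_le_psi_sub le_rfl hy
      rw [← ha, psi_start] at h3
      have h4 : max τ a ≤ psi g s₀ y := max_le hτ (by linarith)
      linarith
    · intro hy
      have h2 := hg.sub_le_psi_sub hx.1 hy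
      have h3 : x ≤ y := hy
      exact ⟨hx.1.trans hy, by linarith [le_max_left τ a]⟩
  have : psiInv g s₀ τ = x := by rw [psiInv, hset, csInf_Ici]
  rw [this]
  exact ⟨hx.1, hpx⟩

/-- The weight `r(τ) = 1 / ψ⁻¹(τ)` lies in `(0, H'(s₀²)]`, where `(H')⁻¹` is a true inverse. -/
theorem one_div_psiInv_mem (hg : IsProfile g s₀) (τ : ℝ) :
    1 / psiInv g s₀ τ ∈ Ioc 0 (deriv (Hfun g) (s₀ ^ 2)) :=
  hg.inv_mem (hg.psiInv_spec τ).1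

theorem psiInv_mono (hg : IsProfile g s₀) {τ σ : ℝ} (h : τ ≤ σ) :
    psiInv g s₀ τ ≤ psiInv g s₀ σ := by
  obtain ⟨h1, h2⟩ := hg.psiInv_spec τ
  obtain ⟨h3, h4⟩ := hg.psiInv_spec σ
  by_contra hlt
  rw [not_le] at hlt
  have h5 := hg.sub_le_psi_sub h3 hlt.le
  have h6 := max_le_max_right (1 / deriv (Hfun g) (s₀ ^ 2)) h
  linarith

/-- The decay profile `y(τ) = L(r(τ))`, `r(τ) = 1 / ψ⁻¹(τ)`, is a supersolution of `y' = -r y`: over a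
time `δ` it loses at most the fraction `δ r` of its value. Since `(Ĥ*)' = (H')⁻¹`, the integrand
of `ψ` is `(Ĥ*)'(v) / (v Ĥ*(v))`, and `v Ĥ*(v)` is increasing. -/
theorem Lfun_psiInv_add (hg : IsProfile g s₀) {τ δ : ℝ} (hδ : 0 ≤ δ) :
    Lfun g s₀ (1 / psiInv g s₀ τ) * (1 - δ * (1 / psiInv g s₀ τ)) ≤
      Lfun g s₀ (1 / psiInv g s₀ (τ + δ)) := by
  have hle : τ ≤ τ + δ := by linarith
  obtain ⟨h1, h2⟩ := hg.psiInv_spec τ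
  obtain ⟨h3, h4⟩ := hg.psiInv_spec (τ + δ)
  have hmono := hg.psiInv_mono hle
  have hpos : 0 < psiInv g s₀ τ := one_div_pos.1 (hg.inv_mem h1).1
  have hr := hg.one_div_psiInv_mem τ
  have hr' := hg.one_div_psiInv_mem (τ + δ)
  have hrr := one_div_le_one_div_of_le hpos hmono
  have hint : ∫ v in (1 / psiInv g s₀ (τ + δ))..(1 / psiInv g s₀ τ), psiIntegrand g s₀ v ≤ δ := by
    rw [← hg.psi_sub h1 hmono, h2, h4, sub_le_iff_le_add']
    refine max_le ?_ ?_
    · linarith [le_max_left τ (1 / deriv (Hfun g) (s₀ ^ 2))]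
    · linarith [le_max_right τ (1 / deriv (Hfun g) (s₀ ^ 2))]
  set r := 1 / psiInv g s₀ τ
  set r' := 1 / psiInv g s₀ (τ + δ)
  have hsub : Icc r' r ⊆ Icc 0 (deriv (Hfun g) (s₀ ^ 2)) := fun v hv =>
    ⟨hr'.1.le.trans hv.1, hv.2.trans hr.2⟩
  have hi : IntervalIntegrable (HderivInv g s₀) volume r' r :=
    (hg.continuousOn_HderivInv.mono (by rwa [uIcc_of_le hrr])).intervalIntegrable
  have hftc := intervalIntegral.integral_eq_sub_of_hasDerivAt_of_le hrr
    (hg.continuousOn_conj.mono hsub)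
    (fun v hv => hg.hasDerivAt_conj ⟨hr'.1.trans hv.1, hv.2.trans_le hr.2⟩) hi
  have hM := hg.conj_pos hr
  have hbound : ∫ v in r'..r, HderivInv g s₀ v ≤ r * HhatConj g s₀ r * δ := by
    refine le_trans ?_ (mul_le_mul_of_nonneg_left hint (mul_pos hr.1 hM).le)
    rw [← intervalIntegral.integral_const_mul]
    refine intervalIntegral.integral_mono_on hrr hi
      ((hg.intervalIntegrable_psiIntegrand hr'.1 hrr hr.2).const_mul _) fun v hv => ?_
    have hv0 : 0 < v := hr'.1.trans_le hv.1
    have hv' : v ∈ Ioc 0 (deriv (Hfun g) (s₀ ^ 2)) := ⟨hv0, hv.2.trans hr.2⟩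
    have hMv := hg.conj_pos hv'
    have hs := hg.HderivInv_pos hv'
    rw [hg.psiIntegrand_eq hv', mul_div_assoc', le_div_iff₀ (mul_pos hv0 hMv), mul_comm]
    have hm := hg.conj_mono (Ioc_subset_Icc_self hv') hv.2
    have := hr.1
    gcongr
    exact hv.2
  rw [hftc] at hbound
  rw [Lfun_eq hr.1, Lfun_eq hr'.1]
  have hMr' := hg.conj_nonneg r'
  have h5 : HhatConj g s₀ r' / r ≤ HhatConj g s₀ r' / r' :=
    div_le_div_of_nonneg_left hMr' hr'.1 hrr
  refine le_trans ?_ h5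
  have h6 := hr.1
  rw [div_mul_eq_mul_div, div_le_div_iff_of_pos_right h6]
  nlinarith

theorem Lfun_psiInv_zero (hg : IsProfile g s₀) :
    Lfun g s₀ (1 / psiInv g s₀ 0) = Lfun g s₀ (deriv (Hfun g) (s₀ ^ 2)) := by
  obtain ⟨h1, h2⟩ := hg.psiInv_spec 0
  have h3 := hg.sub_le_psi_sub le_rfl h1
  rw [psi_start, h2, max_eq_right (one_div_pos.2 hg.slope_pos).le] at h3
  have : psiInv g s₀ 0 = 1 / deriv (Hfun g) (s₀ ^ 2) := le_antisymm (by linarith) h1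
  rw [this, one_div_one_div]

theorem exists_LambdaH_le (hg : IsProfile g s₀) (hlim : limsup (LambdaH g) (𝓝[>] 0) < 1) :
    ∃ η, 0 < η ∧ η ≤ 1 ∧ ∀ s ∈ Ioc 0 (s₀ ^ 2), η ≤ 1 - LambdaH g s := by
  obtain ⟨c, hc, hc1⟩ := exists_between hlim
  have hbdd : IsBoundedUnder (· ≤ ·) (𝓝[>] 0) (LambdaH g) :=
    isBoundedUnder_of_eventually_le (a := 1) (by
      filter_upwards [Ioc_mem_nhdsGT hg.sq_pos] with s hs
      exact (hg.LambdaH_mem hs).2.le)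
  have hev := eventually_lt_of_limsup_lt hc hbdd
  obtain ⟨ε, hε, hεc⟩ := mem_nhdsGT_iff_exists_Ioo_subset.1 hev
  have hε : 0 < ε := hε
  set m := min (ε / 2) (s₀ ^ 2)
  have hm0 : 0 < m := lt_min (by linarith) hg.sq_pos
  have hpos : ∀ s ∈ Icc m (s₀ ^ 2), s ∈ Ioc 0 (s₀ ^ 2) := fun s hs => ⟨hm0.trans_le hs.1, hs.2⟩
  have hcont : ContinuousOn (fun s => 1 - LambdaH g s) (Icc m (s₀ ^ 2)) := by
    refine continuousOn_const.sub (ContinuousOn.div (hg.continuousOn_Hfun.mono ?_)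
      (continuousOn_id.mul (hg.continuousOn_deriv_Hfun.mono ?_)) fun s hs => ?_)
    · exact fun s hs => (hpos s hs).1.le
    · exact fun s hs => (hpos s hs).1.le
    · exact (mul_pos (hpos s hs).1 (hg.deriv_Hfun_pos (hpos s hs))).ne'
  obtain ⟨x, hx, hmin⟩ := isCompact_Icc.exists_isMinOn ⟨m, le_rfl, min_le_right _ _⟩ hcont
  have hx1 := hg.LambdaH_mem (hpos x hx)
  refine ⟨min (1 - c) (1 - LambdaH g x), lt_min (by linarith) (by linarith),
    (min_le_right _ _).trans (by linarith), fun s hs => ?_⟩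
  rcases lt_or_ge s m with h | h
  · have h1 : LambdaH g s < c :=
      hεc ⟨hs.1, h.trans_le ((min_le_left _ _).trans (by linarith))⟩
    exact (min_le_left _ _).trans (by linarith)
  · exact (min_le_right _ _).trans (hmin ⟨h, hs.2⟩)

/-- If `limsup Λ_H < 1` then `ψ` grows at most linearly, so that `1 / ψ⁻¹(τ)` is `O(1 / τ)`. -/
theorem exists_one_div_psiInv_le (hg : IsProfile g s₀)
    (hlim : limsup (LambdaH g) (𝓝[>] 0) < 1) :
    ∃ γ, 0 < γ ∧ ∀ τ, 0 < τ → 1 / psiInv g s₀ τ ≤ γ / τ := by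
  obtain ⟨η, hη, hη1, hΛ⟩ := hg.exists_LambdaH_le hlim
  refine ⟨1 / η, one_div_pos.2 hη, fun τ hτ => ?_⟩
  obtain ⟨h1, h2⟩ := hg.psiInv_spec τ
  have hpos : 0 < psiInv g s₀ τ := one_div_pos.1 (hg.inv_mem h1).1
  have hx := hg.inv_mem h1
  set x := psiInv g s₀ τ
  have hR := hg.slope_pos
  have h3 : psi g s₀ x ≤ x / η := by
    have h4 : ∫ v in (1 / x)..(deriv (Hfun g) (s₀ ^ 2)), psiIntegrand g s₀ v ≤
        ∫ v in (1 / x)..(deriv (Hfun g) (s₀ ^ 2)), (1 / η) / v ^ 2 := by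
      refine intervalIntegral.integral_mono_on hx.2
        (hg.intervalIntegrable_psiIntegrand hx.1 hx.2 le_rfl) ?_ fun v hv => ?_
      · refine ContinuousOn.intervalIntegrable (continuousOn_const.div (by fun_prop) fun v hv => ?_)
        rw [uIcc_of_le hx.2] at hv
        exact pow_ne_zero 2 (hx.1.trans_le hv.1).ne'
      · have hv' : v ∈ Ioc 0 (deriv (Hfun g) (s₀ ^ 2)) := ⟨hx.1.trans_le hv.1, hv.2⟩
        have h5 := hΛ _ ⟨hg.HderivInv_pos hv',
          (hg.HderivInv_mem (Ioc_subset_Icc_self hv')).1.2⟩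
        have h6 := hv'.1
        rw [psiIntegrand, div_div, mul_comm η]
        gcongr
    rw [integral_const_div_sq hx.1 hx.2, one_div_one_div] at h4
    rw [psi_eq]
    have h7 : 1 / deriv (Hfun g) (s₀ ^ 2) ≤ 1 / η * (1 / deriv (Hfun g) (s₀ ^ 2)) :=
      le_mul_of_one_le_left (one_div_pos.2 hR).le (by rwa [le_div_iff₀ hη, one_mul])
    have h8 : x / η = 1 / η * x := by ring
    rw [h8]
    linarith
  rw [h2] at h3
  have h4 : τ ≤ x / η := (le_max_left _ _).trans h3
  rw [le_div_iff₀ hη] at h4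
  rw [div_div]
  exact one_div_le_one_div_of_le (by positivity) (by linarith)

end IsProfile

/-! ### The multiplication representation -/

section Multiplication

variable {𝕜 X Ω : Type*} [RCLike 𝕜] [NormedAddCommGroup X] [InnerProductSpace 𝕜 X]
  [MeasurableSpace Ω] {μ : Measure Ω} {B : X →L[𝕜] X} {b : Ω → ℝ} {U : Lp 𝕜 2 μ ≃ₗᵢ[𝕜] X}

namespace IsMultiplicationRepresentation

theorem ae_le (h : IsMultiplicationRepresentation B μ b U) : ∀ᵐ x ∂μ, b x ≤ ‖B‖ := by
  have h1 := ae_le_eLpNormEssSup (f := b) (μ := μ)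
  rw [← eLpNorm_exponent_top, h.norm_eq] at h1
  filter_upwards [h1] with x hx
  rw [Real.enorm_of_nonneg (h.nonneg x)] at hx
  exact (ENNReal.ofReal_le_ofReal_iff (norm_nonneg _)).1 hx

/-- The square root of `B` exists: it is the multiplication by `√b`. -/
theorem exists_sqrt (h : IsMultiplicationRepresentation B μ b U) :
    ∃ R : X →L[𝕜] X, R.IsPositive ∧ R.comp R = B := by
  have hm : MemLp (fun x => ((√(b x) : ℝ) : 𝕜)) ⊤ μ := by
    refine memLp_top_of_bound
      (RCLike.measurable_ofReal.comp h.measurable.sqrt).aestronglyMeasurable √‖B‖ ?_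
    filter_upwards [h.ae_le] with x hx
    rw [RCLike.norm_ofReal, abs_of_nonneg (Real.sqrt_nonneg _)]
    exact Real.sqrt_le_sqrt hx
  let M : Lp 𝕜 2 μ →L[𝕜] Lp 𝕜 2 μ :=
    (ContinuousLinearMap.mul 𝕜 𝕜).holderL μ ⊤ 2 2 hm.toLp
  have hM : ∀ f : Lp 𝕜 2 μ, ∀ᵐ x ∂μ, M f x = ((√(b x) : ℝ) : 𝕜) * f x := fun f => by
    filter_upwards [(ContinuousLinearMap.mul 𝕜 𝕜).coeFn_holder (r := 2) hm.toLp f, hm.coeFn_toLp]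
      with x h1 h2
    rw [h2] at h1
    exact h1
  let R : X →L[𝕜] X :=
    (U.toContinuousLinearEquiv : Lp 𝕜 2 μ →L[𝕜] X).comp
      (M.comp (U.symm.toContinuousLinearEquiv : X →L[𝕜] Lp 𝕜 2 μ))
  have hR : ∀ x, R x = U (M (U.symm x)) := fun x => rfl
  refine ⟨R, ContinuousLinearMap.isPositive_def.2 ⟨fun x y => ?_, fun x => ?_⟩, ?_⟩
  · change inner 𝕜 (R x) y = inner 𝕜 x (R y)
    rw [hR, hR, U.inner_map_eq_flip, ← U.symm.inner_map_map x, U.symm_apply_apply, L2.inner_def,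
      L2.inner_def]
    refine integral_congr_ae ?_
    filter_upwards [hM (U.symm x), hM (U.symm y)] with w h1 h2
    rw [h1, h2, ← smul_eq_mul, ← smul_eq_mul, inner_smul_left, inner_smul_right,
      RCLike.conj_ofReal]
  · rw [ContinuousLinearMap.reApplyInnerSelf_apply, hR, U.inner_map_eq_flip, L2.inner_def,
      ← integral_re (L2.integrable_inner _ _)]
    refine integral_nonneg_of_ae ?_
    filter_upwards [hM (U.symm x)] with w h1
    rw [h1, ← smul_eq_mul, inner_smul_left, RCLike.conj_ofReal, RCLike.re_ofReal_mul,
      inner_self_eq_norm_sq]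
    exact mul_nonneg (Real.sqrt_nonneg _) (sq_nonneg _)
  · ext x
    refine U.symm.injective ?_
    rw [ContinuousLinearMap.comp_apply, hR, hR, U.symm_apply_apply, U.symm_apply_apply]
    refine Lp.ext ?_
    have h1 := h.apply_eq (U.symm x)
    rw [U.apply_symm_apply] at h1
    filter_upwards [hM (M (U.symm x)), hM (U.symm x), h1] with w h2 h3 h4
    rw [h2, h3, h4, ← mul_assoc, ← RCLike.ofReal_mul, Real.mul_self_sqrt (h.nonneg w)]

theorem posSqrt_spec (h : IsMultiplicationRepresentation B μ b U) :
    (posSqrt B).IsPositive ∧ (posSqrt B).comp (posSqrt B) = B := by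
  have hex := h.exists_sqrt
  rw [posSqrt, dif_pos hex]
  exact hex.choose_spec

theorem posSqrt_posSqrt (h : IsMultiplicationRepresentation B μ b U) (x : X) :
    posSqrt B (posSqrt B x) = B x :=
  DFunLike.congr_fun h.posSqrt_spec.2 x

theorem norm_posSqrt_sq (h : IsMultiplicationRepresentation B μ b U) (x : X) :
    ‖posSqrt B x‖ ^ 2 = RCLike.re (inner 𝕜 x (B x)) := by
  have hs : inner 𝕜 (posSqrt B x) (posSqrt B x) = inner 𝕜 x (posSqrt B (posSqrt B x)) :=
    h.posSqrt_spec.1.isSymmetric x (posSqrt B x)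
  rw [← h.posSqrt_posSqrt, ← hs, inner_self_eq_norm_sq]

theorem norm_apply_le (h : IsMultiplicationRepresentation B μ b U) (x : X) :
    ‖B x‖ ≤ ‖posSqrt B‖ * ‖posSqrt B x‖ := by
  rw [← h.posSqrt_posSqrt]
  exact (posSqrt B).le_opNorm _

/-- The form `re ⟨·, B ·⟩` in the representation space. -/
theorem re_inner (h : IsMultiplicationRepresentation B μ b U) (f k : Lp 𝕜 2 μ) :
    Integrable (fun x => b x * RCLike.re (inner 𝕜 (f x) (k x))) μ ∧
      RCLike.re (inner 𝕜 (U f) (B (U k))) =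
        ∫ x, b x * RCLike.re (inner 𝕜 (f x) (k x)) ∂μ := by
  have hi := L2.integrable_inner (𝕜 := 𝕜) f (U.symm (B (U k)))
  have he : (fun x => RCLike.re (inner 𝕜 (f x) (U.symm (B (U k)) x))) =ᵐ[μ]
      fun x => b x * RCLike.re (inner 𝕜 (f x) (k x)) := by
    filter_upwards [h.apply_eq k] with x hx
    rw [hx, ← smul_eq_mul, inner_smul_right, RCLike.re_ofReal_mul]
  refine ⟨hi.re.congr he, ?_⟩
  rw [U.inner_map_eq_flip, L2.inner_def, ← integral_re hi]
  exact integral_congr_ae he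

theorem norm_posSqrt_sq_eq (h : IsMultiplicationRepresentation B μ b U) (f : Lp 𝕜 2 μ) :
    Integrable (fun x => b x * ‖f x‖ ^ 2) μ ∧
      ‖posSqrt B (U f)‖ ^ 2 = ∫ x, b x * ‖f x‖ ^ 2 ∂μ := by
  have := h.re_inner f f
  simp only [inner_self_eq_norm_sq] at this
  rwa [h.norm_posSqrt_sq]

end IsMultiplicationRepresentation

/-- Truncations of a square integrable function converge to it. -/
theorem exists_truncation (f : Lp 𝕜 2 μ) :
    ∃ fn : ℕ → Lp 𝕜 2 μ, (∀ n, MemLp (fn n) ⊤ μ) ∧ Tendsto fn atTop (𝓝 f) ∧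
      ∀ᵐ x ∂μ, ∀ᶠ n in atTop, fn n x = f x := by
  let s : ℕ → Set Ω := fun n => {x | ‖f x‖ ≤ n}
  have hs : ∀ n, MeasurableSet (s n) := fun n =>
    (Lp.stronglyMeasurable f).norm.measurable measurableSet_Iic
  have hmem : ∀ n, MemLp ((s n).indicator f) 2 μ := fun n => (Lp.memLp f).indicator (hs n)
  have hae : ∀ᵐ x ∂μ, ∀ n, (hmem n).toLp _ x = (s n).indicator f x :=
    ae_all_iff.2 fun n => (hmem n).coeFn_toLp
  have hev : ∀ x, ∀ᶠ n in atTop, (s n).indicator f x = f x := fun x => by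
    obtain ⟨N, hN⟩ := exists_nat_ge ‖f x‖
    filter_upwards [eventually_ge_atTop N] with n hn
    exact indicator_of_mem (show x ∈ s n from hN.trans (by exact_mod_cast hn)) _
  refine ⟨fun n => (hmem n).toLp, fun n => ?_, ?_, ?_⟩
  · refine memLp_top_of_bound (Lp.aestronglyMeasurable _) n ?_
    filter_upwards [hae] with x hx
    rw [hx n]
    by_cases h : x ∈ s n
    · rw [indicator_of_mem h]; exact h
    · rw [indicator_of_notMem h, norm_zero]; exact n.cast_nonneg
  · rw [tendsto_iff_norm_sub_tendsto_zero]
    have hsq : ∀ k : Lp 𝕜 2 μ, ‖k‖ ^ 2 = ∫ x, ‖k x‖ ^ 2 ∂μ := fun k => by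
      rw [← inner_self_eq_norm_sq (𝕜 := 𝕜), L2.inner_def, ← integral_re (L2.integrable_inner k k)]
      simp only [inner_self_eq_norm_sq]
    have hint : Integrable (fun x => ‖f x‖ ^ 2) μ := by
      have := (L2.integrable_inner (𝕜 := 𝕜) f f).re
      simpa only [inner_self_eq_norm_sq] using this
    have hlim : Tendsto (fun n => ∫ x, ‖((hmem n).toLp - f : Lp 𝕜 2 μ) x‖ ^ 2 ∂μ) atTop
        (𝓝 (∫ _, 0 ∂μ)) := by
      have hsub : ∀ᵐ x ∂μ, ∀ n, ((hmem n).toLp - f : Lp 𝕜 2 μ) x = (s n).indicator f x - f x := by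
        filter_upwards [hae, ae_all_iff.2 fun n => Lp.coeFn_sub (hmem n).toLp f] with x h1 h2 n
        rw [h2 n, Pi.sub_apply, h1 n]
      refine tendsto_integral_of_dominated_convergence _
        (fun n => (Lp.aestronglyMeasurable _).norm.pow 2) hint (fun n => ?_) ?_
      · filter_upwards [hsub] with x hx
        rw [hx n]
        by_cases h : x ∈ s n
        · rw [indicator_of_mem h, sub_self, norm_zero]; simp
        · rw [indicator_of_notMem h, zero_sub, norm_neg]; simp
      · filter_upwards [hsub] with x hx
        refine tendsto_const_nhds.congr' ?_
        filter_upwards [hev x] with n hn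
        rw [hx n, hn, sub_self, norm_zero]; simp
    rw [integral_zero] at hlim
    have := hlim.sqrt
    simpa only [← hsq, Real.sqrt_sq (norm_nonneg _), Real.sqrt_zero] using this
  · filter_upwards [hae] with x hx
    filter_upwards [hev x] with n hn
    rw [hx n, hn]

/-- The comparison of `ρ` with `g`, assumed for bounded functions, extends to all square integrable
functions when `ρ` is continuous. -/
theorem IsComparable.of_continuous {g : ℝ → ℝ} {c₁ c₂ : ℝ} {ρ : Lp 𝕜 2 μ → Lp 𝕜 2 μ}
    (h : IsComparable g c₁ c₂ ρ) (hρ : Continuous ρ) (f : Lp 𝕜 2 μ) : ∀ᵐ x ∂μ,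
    (‖f x‖ ≤ 1 → c₁ * g ‖f x‖ ≤ ‖ρ f x‖ ∧ ‖ρ f x‖ ≤ c₂ * Function.invFun g ‖f x‖) ∧
    (1 ≤ ‖f x‖ → c₁ * ‖f x‖ ≤ ‖ρ f x‖ ∧ ‖ρ f x‖ ≤ c₂ * ‖f x‖) := by
  obtain ⟨fn, hfn, hlim, hev⟩ := exists_truncation f
  obtain ⟨ns, hns, hae⟩ := (tendstoInMeasure_of_tendsto_Lp
    ((hρ.tendsto f).comp hlim)).exists_seq_tendsto_ae
  filter_upwards [hae, hev, ae_all_iff.2 fun n => h (fn n) (hfn n)] with x h1 h2 h3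
  have h2' : ∀ᶠ n in atTop, fn (ns n) x = f x := hns.tendsto_atTop.eventually h2
  refine ⟨fun hx => ⟨ge_of_tendsto h1.norm ?_, le_of_tendsto h1.norm ?_⟩,
    fun hx => ⟨ge_of_tendsto h1.norm ?_, le_of_tendsto h1.norm ?_⟩⟩ <;>
  filter_upwards [h2'] with n hn <;>
  have h4 := h3 (ns n) <;>
  rw [hn] at h4
  · exact (h4.1 hx).1
  · exact (h4.1 hx).2
  · exact (h4.2 hx).1
  · exact (h4.2 hx).2

end Multiplication

/-! ### The weighted energy inequality -/

theorem IsProfile.invFun_spec {g : ℝ → ℝ} {s₀ : ℝ} (hg : IsProfile g s₀) {a : ℝ} (h0 : 0 ≤ a)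
    (h1 : a ≤ 1) : g (Function.invFun g a) = a := by
  obtain ⟨x, hx⟩ := hg.one_mem_range
  have hx0 : 0 ≤ x := by
    rw [← hg.strictMono.le_iff_le, hg.zero, hx]; exact zero_le_one
  have hiv := intermediate_value_Icc hx0 hg.contDiff.continuous.continuousOn
  rw [hg.zero, hx] at hiv
  obtain ⟨y, -, hy⟩ := hiv ⟨h0, h1⟩
  exact Function.invFun_eq ⟨y, hy⟩

/-- For `a = |f(x)|` and `p = |ρ(f)(x)|`: where `a` is small, the Fenchel-Young inequality for `H` at
`a²` and at `(p / c₂)²`, where `H(a²) = a g(a)` and `H((p / c₂)²)` are both bounded by a multiple of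
`a p`; where `a` is not small, `a² + p²` is itself bounded by a multiple of `a p`. -/
theorem IsProfile.exists_pointwise {g : ℝ → ℝ} {s₀ : ℝ} (hg : IsProfile g s₀) {c₁ c₂ : ℝ}
    (hc₁ : 0 < c₁) (hc₂ : 0 < c₂) :
    ∃ C₃ C₄ : ℝ, 0 < C₃ ∧ 1 ≤ C₄ ∧ ∀ r a p : ℝ, 0 ≤ r → 0 ≤ a → 0 ≤ p →
      (a ≤ 1 → c₁ * g a ≤ p ∧ p ≤ c₂ * Function.invFun g a) →
      (1 ≤ a → c₁ * a ≤ p ∧ p ≤ c₂ * a) →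
      r * (a ^ 2 + p ^ 2) ≤ C₃ * HhatConj g s₀ r + C₄ * (1 + r) * (a * p) := by
  set ε := min s₀ (g s₀)
  have hε : 0 < ε := lt_min hg.s₀_pos (hg.pos hg.s₀_pos)
  have he : 0 < g ε := hg.pos hε
  set β := Function.invFun g 1
  have hβ : g β = 1 := hg.invFun_spec zero_le_one le_rfl
  have hβ0 : 0 < β := by rw [← hg.strictMono.lt_iff_lt, hg.zero, hβ]; exact one_pos
  have k1 : 0 < 1 / c₁ := by positivity
  have k2 : 0 < 1 / (c₁ * g ε) := by positivity
  have k3 : 0 < c₂ * β / ε := by positivity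
  set C₄ := 1 + 1 / c₁ + c₂ + 1 / (c₁ * g ε) + c₂ * β / ε with hC₄
  refine ⟨1 + c₂ ^ 2, C₄, by positivity, by linarith, fun r a p hr ha hp h1 h2 => ?_⟩
  have hap : 0 ≤ a * p := mul_nonneg ha hp
  have hM := hg.conj_nonneg r
  rcases le_or_gt a ε with h | h
  · have ha1 : a ≤ 1 := h.trans ((min_le_left _ _).trans hg.s₀_le_one)
    obtain ⟨h3, h4⟩ := h1 ha1
    have hb := hg.invFun_spec ha ha1
    set y := Function.invFun g a
    have hys : y ≤ s₀ := by
      rw [← hg.strictMono.le_iff_le, hb]; exact h.trans (min_le_right _ _)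
    set q := p / c₂ with hq
    have hq0 : 0 ≤ q := div_nonneg hp hc₂.le
    have hpq : p = c₂ * q := by rw [hq]; field_simp
    have hqy : q ≤ y := by rw [hq, div_le_iff₀ hc₂]; linarith
    have hgq : g q ≤ a := by rw [← hb]; exact hg.strictMono.monotone hqy
    have has : a ≤ s₀ := h.trans (min_le_left _ _)
    have f1 := hg.le_conj r (s := a ^ 2) ⟨sq_nonneg _, by gcongr⟩
    have f2 := hg.le_conj r (s := q ^ 2) ⟨sq_nonneg _, by gcongr; exact hqy.trans hys⟩
    rw [IsProfile.Hfun_sq g ha] at f1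
    rw [IsProfile.Hfun_sq g hq0] at f2
    have e1 : a * g a ≤ 1 / c₁ * (a * p) := by
      have : g a ≤ p / c₁ := by rw [le_div_iff₀ hc₁]; linarith
      calc a * g a ≤ a * (p / c₁) := by gcongr
        _ = _ := by ring
    have e2 : c₂ ^ 2 * (q * g q) ≤ c₂ * (a * p) := by
      calc c₂ ^ 2 * (q * g q) ≤ c₂ ^ 2 * (q * a) := by gcongr
        _ = _ := by rw [hpq]; ring
    have e3 : r * p ^ 2 = c₂ ^ 2 * (r * q ^ 2) := by rw [hpq]; ring
    have e4 : c₂ ^ 2 * (r * q ^ 2) ≤ c₂ ^ 2 * (HhatConj g s₀ r + q * g q) := by gcongr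
    have e5 : (1 / c₁ + c₂) * (a * p) ≤ C₄ * (1 + r) * (a * p) := by
      gcongr
      calc 1 / c₁ + c₂ ≤ C₄ := by linarith
        _ ≤ C₄ * (1 + r) := le_mul_of_one_le_right (by linarith) (by linarith)
    nlinarith
  · have key : a ^ 2 + p ^ 2 ≤ C₄ * (a * p) := by
      rcases le_total a 1 with ha1 | ha1
      · obtain ⟨h3, h4⟩ := h1 ha1
        have hp1 : c₁ * g ε ≤ p := by
          refine le_trans ?_ h3
          have := hg.strictMono.monotone h.le
          gcongr
        have hb := hg.invFun_spec ha ha1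
        have hyβ : Function.invFun g a ≤ β := by
          rw [← hg.strictMono.le_iff_le, hb, hβ]; exact ha1
        have e1 : a ^ 2 ≤ 1 / (c₁ * g ε) * (a * p) := by
          have : 1 ≤ p / (c₁ * g ε) := by rwa [le_div_iff₀ (by positivity), one_mul]
          calc a ^ 2 ≤ a * 1 := by rw [pow_two]; gcongr
            _ ≤ a * (p / (c₁ * g ε)) := by gcongr
            _ = _ := by ring
        have e2 : p ^ 2 ≤ c₂ * β / ε * (a * p) := by
          have h5 : p ≤ c₂ * β := h4.trans (by gcongr)
          have h6 : 1 ≤ a / ε := by rw [le_div_iff₀ hε, one_mul]; exact h.le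
          calc p ^ 2 = p * p * 1 := by ring
            _ ≤ (c₂ * β) * p * (a / ε) := by gcongr
            _ = _ := by ring
        rw [hC₄]
        nlinarith
      · obtain ⟨h3, h4⟩ := h2 ha1
        have e1 : a ^ 2 ≤ 1 / c₁ * (a * p) := by
          have : a ≤ p / c₁ := by rw [le_div_iff₀ hc₁]; linarith
          calc a ^ 2 = a * a := by ring
            _ ≤ a * (p / c₁) := by gcongr
            _ = _ := by ring
        have e2 : p ^ 2 ≤ c₂ * (a * p) := by
          calc p ^ 2 = p * p := by ring
            _ ≤ (c₂ * a) * p := by gcongr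
            _ = _ := by ring
        rw [hC₄]
        nlinarith
    have hC0 : 0 ≤ C₄ := by linarith
    have e3 : r * (a ^ 2 + p ^ 2) ≤ r * (C₄ * (a * p)) := by gcongr
    have e4 : 0 ≤ (1 + c₂ ^ 2) * HhatConj g s₀ r := by positivity
    have e5 : 0 ≤ C₄ * (a * p) := by positivity
    linarith

/-- The weighted energy inequality
`r (‖B^{1/2} u‖² + ‖B^{1/2} F(u)‖²) ≤ C₃ ‖B‖ Ĥ*(r) + C₄ (1 + r) ⟨u, B F(u)⟩`. -/
theorem weighted_energy_le {𝕜 X Ω : Type*} [RCLike 𝕜] [NormedAddCommGroup X]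
    [InnerProductSpace 𝕜 X] [MeasurableSpace Ω] {μ : Measure Ω} [IsProbabilityMeasure μ]
    {B : X →L[𝕜] X} {F : X → X} {b : Ω → ℝ} {U : Lp 𝕜 2 μ ≃ₗᵢ[𝕜] X} {g : ℝ → ℝ}
    {s₀ c₁ c₂ C₃ C₄ : ℝ} (hg : IsProfile g s₀) (hC₃ : 0 < C₃)
    (hpt : ∀ r a p : ℝ, 0 ≤ r → 0 ≤ a → 0 ≤ p →
      (a ≤ 1 → c₁ * g a ≤ p ∧ p ≤ c₂ * Function.invFun g a) →
      (1 ≤ a → c₁ * a ≤ p ∧ p ≤ c₂ * a) →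
      r * (a ^ 2 + p ^ 2) ≤ C₃ * HhatConj g s₀ r + C₄ * (1 + r) * (a * p))
    (hB : IsMultiplicationRepresentation B μ b U) (hF : Continuous F)
    (hsign : ∀ f : Lp 𝕜 2 μ, ∀ᵐ x ∂μ, 0 ≤ (starRingEnd 𝕜) (f x) * pullback U F f x)
    (hcomp : IsComparable g c₁ c₂ (pullback U F)) {r : ℝ} (hr : 0 ≤ r) (u : X) :
    r * (‖posSqrt B u‖ ^ 2 + ‖posSqrt B (F u)‖ ^ 2) ≤
      C₃ * ‖B‖ * HhatConj g s₀ r + C₄ * (1 + r) * RCLike.re (inner 𝕜 u (B (F u))) := by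
  set f := U.symm u
  have hu : U f = u := U.apply_symm_apply u
  set k := pullback U F f
  have hk : U k = F u := by
    change U (U.symm (F (U f))) = _
    rw [U.apply_symm_apply, hu]
  have hρ : Continuous (pullback U F) :=
    U.symm.continuous.comp (hF.comp U.continuous)
  obtain ⟨i1, e1⟩ := hB.norm_posSqrt_sq_eq f
  obtain ⟨i2, e2⟩ := hB.norm_posSqrt_sq_eq k
  obtain ⟨i3, e3⟩ := hB.re_inner f k
  rw [hu] at e1 e3
  rw [hk] at e2 e3
  have hmono : ∫ x, r * (b x * ‖f x‖ ^ 2 + b x * ‖k x‖ ^ 2) ∂μ ≤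
      ∫ x, (C₃ * ‖B‖ * HhatConj g s₀ r +
        C₄ * (1 + r) * (b x * RCLike.re (inner 𝕜 (f x) (k x)))) ∂μ := by
    refine integral_mono_ae ((i1.add i2).const_mul r)
      ((integrable_const _).add (i3.const_mul _)) ?_
    filter_upwards [hB.ae_le, hsign f, hcomp.of_continuous hρ f] with x hb hs hc
    have h1 := hpt r ‖f x‖ ‖k x‖ hr (norm_nonneg _) (norm_nonneg _) hc.1 hc.2
    -- a nonnegative scalar is equal to its modulus
    have h2 : RCLike.re (inner 𝕜 (f x) (k x)) = ‖f x‖ * ‖k x‖ := by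
      have h3 : inner 𝕜 (f x) (k x) = (starRingEnd 𝕜) (f x) * k x := by
        rw [RCLike.inner_apply, mul_comm]
      have h4 := congrArg RCLike.re (RCLike.norm_of_nonneg' hs)
      rw [RCLike.ofReal_re, norm_mul, RCLike.norm_conj] at h4
      rw [h3]
      exact h4.symm
    rw [h2]
    have hb0 := hB.nonneg x
    have h4 := mul_le_mul_of_nonneg_left h1 hb0
    have h5 : b x * (C₃ * HhatConj g s₀ r) ≤ ‖B‖ * (C₃ * HhatConj g s₀ r) := by
      have := hg.conj_nonneg r
      gcongr
    linarith
  rw [integral_const_mul, integral_add i1 i2, integral_add (integrable_const _) (i3.const_mul _),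
    integral_const, integral_const_mul, ← e1, ← e2, ← e3] at hmono
  simpa using hmono

/-! ### From the energy inequality to the decay rate -/

/-- A nonincreasing function `E` whose loss over each period of length `T` is bounded below, for every
weight `r`, by `2 γ T r E - γ T r β L(r)`, is dominated by `2 β` times the decay profile. The weight
is taken from the profile itself, `r = 1 / ψ⁻¹(n γ T)`. -/
theorem IsProfile.energy_decay {g : ℝ → ℝ} {s₀ : ℝ} (hg : IsProfile g s₀) {E : ℝ → ℝ} {T γ β : ℝ}
    (hE : AntitoneOn E (Ici 0)) (hT : 0 < T) (hγ : 0 < γ) (hβ : 0 ≤ β)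
    (hsmall : γ * T * deriv (Hfun g) (s₀ ^ 2) ≤ 1 / 4)
    (h0 : E 0 ≤ β * Lfun g s₀ (deriv (Hfun g) (s₀ ^ 2)))
    (hstep : ∀ n : ℕ, ∀ r ∈ Ioc 0 (deriv (Hfun g) (s₀ ^ 2)),
      2 * (γ * T) * r * E (n * T) ≤
        γ * T * r * (β * Lfun g s₀ r) + (E (n * T) - E ((n + 1 : ℕ) * T)))
    {t : ℝ} (ht : 0 ≤ t) : E t ≤ 2 * β * Lfun g s₀ (1 / psiInv g s₀ (γ * t)) := by
  have hδ : 0 < γ * T := mul_pos hγ hT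
  have hr : ∀ τ, 1 / psiInv g s₀ τ ∈ Ioc 0 (deriv (Hfun g) (s₀ ^ 2)) := hg.one_div_psiInv_mem
  have hrs : ∀ τ, γ * T * (1 / psiInv g s₀ τ) ≤ 1 / 4 := fun τ =>
    (mul_le_mul_of_nonneg_left (hr τ).2 hδ.le).trans hsmall
  have hind : ∀ n : ℕ, E (n * T) ≤ β * Lfun g s₀ (1 / psiInv g s₀ (γ * T * n)) := by
    intro n
    induction n with
    | zero =>
      rw [Nat.cast_zero, zero_mul, mul_zero, hg.Lfun_psiInv_zero]
      exact h0
    | succ n ih =>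
      have h1 := hstep n _ (hr (γ * T * n))
      have h2 := hg.Lfun_psiInv_add (τ := γ * T * n) hδ.le
      have h3 := hrs (γ * T * n)
      have h4 : γ * T * n + γ * T = γ * T * (n + 1 : ℕ) := by push_cast; ring
      rw [h4] at h2
      set r := 1 / psiInv g s₀ (γ * T * n)
      have h5 : (1 - 2 * (γ * T) * r) * E (n * T) ≤
          (1 - 2 * (γ * T) * r) * (β * Lfun g s₀ r) := by
        have : 0 ≤ 1 - 2 * (γ * T) * r := by linarith
        gcongr
      have h6 := mul_le_mul_of_nonneg_left h2 hβ
      linarith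
  set n := ⌊t / T⌋₊
  have hn1 : n * T ≤ t := by
    rw [← le_div_iff₀ hT]; exact Nat.floor_le (by positivity)
  have hn2 : t ≤ (n + 1) * T := by
    rw [← div_le_iff₀ hT]; exact (Nat.lt_floor_add_one _).le
  have h1 : E t ≤ E (n * T) := hE (mem_Ici.2 (by positivity)) (mem_Ici.2 ht) hn1
  have h2 := hg.Lfun_psiInv_add (τ := γ * T * n) (δ := γ * (t - n * T))
    (mul_nonneg hγ.le (sub_nonneg.2 hn1))
  have h3 : γ * T * n + γ * (t - n * T) = γ * t := by ring
  rw [h3] at h2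
  have h4 := hrs (γ * T * n)
  have h5 := hg.Lfun_pos (hr (γ * T * n))
  have h6 := (hr (γ * T * n)).1
  have h7 := hind n
  set r := 1 / psiInv g s₀ (γ * T * n)
  have h8 : γ * (t - n * T) * r ≤ 1 / 2 := by
    have : γ * (t - n * T) * r ≤ γ * T * r := by
      gcongr; linarith
    linarith
  have h9 : Lfun g s₀ r * (1 / 2) ≤ Lfun g s₀ r * (1 - γ * (t - n * T) * r) := by
    gcongr; linarith
  have h10 := mul_le_mul_of_nonneg_left (h9.trans h2) hβ
  linarith

theorem sq_integral_le {h : ℝ → ℝ} (hh : Continuous h) {t : ℝ} (ht : 0 ≤ t) :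
    (∫ s in (0 : ℝ)..t, h s) ^ 2 ≤ t * ∫ s in (0 : ℝ)..t, h s ^ 2 := by
  rcases ht.eq_or_lt with rfl | ht
  · simp
  have hh2 : Continuous fun s => h s ^ 2 := hh.pow 2
  set I := ∫ s in (0 : ℝ)..t, h s
  have h1 : ∫ s in (0 : ℝ)..t, 2 * (I / t) * h s ≤
      ∫ s in (0 : ℝ)..t, ((I / t) ^ 2 + h s ^ 2) := by
    refine intervalIntegral.integral_mono_on ht.le ?_ ?_ fun s _ => ?_
    · exact (by fun_prop : Continuous fun s => 2 * (I / t) * h s).intervalIntegrable _ _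
    · exact (by fun_prop : Continuous fun s => (I / t) ^ 2 + h s ^ 2).intervalIntegrable _ _
    · nlinarith [sq_nonneg (I / t - h s)]
  rw [intervalIntegral.integral_const_mul, intervalIntegral.integral_add
    _root_.intervalIntegrable_const (hh2.intervalIntegrable _ _),
    intervalIntegral.integral_const, sub_zero, smul_eq_mul] at h1
  have h2 : 2 * (I / t) * I - t * (I / t) ^ 2 = I ^ 2 / t := by field_simp; ring
  have h3 : I ^ 2 / t ≤ ∫ s in (0 : ℝ)..t, h s ^ 2 := by
    rw [← h2]; linarith
  rwa [div_le_iff₀ ht, mul_comm] at h3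

section Energy

variable {𝕜 X Ω : Type*} [RCLike 𝕜] [NormedAddCommGroup X] [InnerProductSpace 𝕜 X]
  [CompleteSpace X] [NormedSpace ℝ X] [IsScalarTower ℝ 𝕜 X] [MeasurableSpace Ω] {μ : Measure Ω}
  {A : X →ₗ.[𝕜] X} {S : ℝ → X →L[𝕜] X} {B : X →L[𝕜] X} {F : X → X} {b : Ω → ℝ}
  {U : Lp 𝕜 2 μ ≃ₗᵢ[𝕜] X} {T CT : ℝ}

/-- The observability constant is at most `T ‖B^{1/2}‖²`. -/
theorem IsObservable.le_mul_norm_sq (hobs : IsObservable A B T CT) (hA : IsSkewAdjoint A)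
    (hS : IsUnitaryGroup A S) (hT : 0 < T) (hB : B ≠ 0) : CT ≤ T * ‖posSqrt B‖ ^ 2 := by
  obtain ⟨x, hx⟩ : ∃ x, B x ≠ 0 := by
    by_contra! h
    exact hB (ContinuousLinearMap.ext h)
  have hx0 : 0 < ‖x‖ ^ 2 := by
    have : x ≠ 0 := fun h => hx (by rw [h, map_zero])
    positivity
  have h1 := hobs _ ((hS.isMildSolution x).isWeakSolution hA hS)
  have h2 : ∫ t in (0 : ℝ)..T, ‖posSqrt B (S t x)‖ ^ 2 ≤
      ∫ _ in (0 : ℝ)..T, ‖posSqrt B‖ ^ 2 * ‖x‖ ^ 2 := by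
    refine intervalIntegral.integral_mono_on hT.le ?_ _root_.intervalIntegrable_const fun t _ => ?_
    · exact ((((posSqrt B).continuous.comp (hS.continuous x)).norm).pow 2).intervalIntegrable _ _
    · rw [← hS.norm t x, ← mul_pow]
      gcongr
      exact (posSqrt B).le_opNorm _
  rw [intervalIntegral.integral_const, sub_zero, smul_eq_mul, ← mul_assoc] at h2
  rw [hS.zero] at h1
  exact le_of_mul_le_mul_right (h1.trans h2) hx0

/-- The observability inequality passes from the conservative equation to the damped one: by
Duhamel's formula, a damped and a conservative solution with the same initial value differ by at
most `∫ ‖B F(u)‖`. -/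
theorem IsObservable.energy_le (hobs : IsObservable A B T CT) (hA : IsSkewAdjoint A)
    (hS : IsUnitaryGroup A S) (hB : IsMultiplicationRepresentation B μ b U) (hF : Continuous F)
    (hT : 0 < T) {u : ℝ → X} (huc : Continuous u) (hu : IsMildSolution S (fun x => B (F x)) u) :
    CT * energy u 0 ≤ (T ^ 2 * ‖posSqrt B‖ ^ 4 + 1) *
      ∫ t in (0 : ℝ)..T, (‖posSqrt B (u t)‖ ^ 2 + ‖posSqrt B (F (u t))‖ ^ 2) := by
  set Q := posSqrt B
  set p : ℝ → ℝ := fun t => ‖Q (F (u t))‖ with hp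
  have hpc : Continuous p := (Q.continuous.comp (hF.comp huc)).norm
  have hqc : Continuous fun t => ‖Q (u t)‖ := (Q.continuous.comp huc).norm
  have hp2 : Continuous fun t => p t ^ 2 := hpc.pow 2
  have hq2 : Continuous fun t => ‖Q (u t)‖ ^ 2 := hqc.pow 2
  have hφ2 : Continuous fun t => ‖Q (S t (u 0))‖ ^ 2 :=
    ((Q.continuous.comp (hS.continuous (u 0))).norm).pow 2
  set J := ∫ t in (0 : ℝ)..T, p t ^ 2
  have hsq : ∀ {t}, IntervalIntegrable (fun s => p s ^ 2) volume 0 t :=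
    hp2.intervalIntegrable _ _
  have hdiff : ∀ t ∈ Icc 0 T, ‖Q (S t (u 0))‖ ^ 2 ≤
      2 * ‖Q (u t)‖ ^ 2 + 2 * (‖Q‖ ^ 4 * (T * J)) := by
    intro t ht
    have h1 := hu.eq_integral hS (B.continuous.comp hF) ht.1
    have h2 : ‖S t (u 0) - u t‖ ≤ ‖Q‖ * ∫ s in (0 : ℝ)..t, p s := by
      have h3 : S t (u 0) - u t = S t (∫ s in (0 : ℝ)..t, S (-s) (B (F (u s)))) := by
        have : u 0 - S (-t) (u t) = ∫ s in (0 : ℝ)..t, S (-s) (B (F (u s))) := by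
          rw [h1]; abel
        rw [← this, map_sub, hS.apply_neg]
      rw [h3, hS.norm, ← intervalIntegral.integral_const_mul]
      refine intervalIntegral.norm_integral_le_of_norm_le ht.1 (.of_forall fun s _ => ?_)
        ((hpc.const_mul _).intervalIntegrable _ _)
      rw [hS.norm]
      exact hB.norm_apply_le _
    have h4 : (∫ s in (0 : ℝ)..t, p s) ^ 2 ≤ T * J := by
      refine (sq_integral_le hpc ht.1).trans ?_
      refine mul_le_mul ht.2 ?_ ?_ hT.le
      · exact intervalIntegral.integral_mono_interval le_rfl ht.1 ht.2
          (.of_forall fun s => sq_nonneg _) hsq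
      · exact intervalIntegral.integral_nonneg ht.1 fun s _ => sq_nonneg _
    have h5 : ‖Q (S t (u 0) - u t)‖ ^ 2 ≤ ‖Q‖ ^ 4 * (T * J) := by
      have h6 : ‖Q (S t (u 0) - u t)‖ ≤ ‖Q‖ * (‖Q‖ * ∫ s in (0 : ℝ)..t, p s) :=
        (Q.le_opNorm _).trans (by gcongr)
      calc ‖Q (S t (u 0) - u t)‖ ^ 2 ≤ (‖Q‖ * (‖Q‖ * ∫ s in (0 : ℝ)..t, p s)) ^ 2 := by gcongr
        _ = ‖Q‖ ^ 4 * (∫ s in (0 : ℝ)..t, p s) ^ 2 := by ring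
        _ ≤ _ := by gcongr
    have h7 : ‖Q (S t (u 0))‖ ≤ ‖Q (u t)‖ + ‖Q (S t (u 0) - u t)‖ := by
      refine (norm_add_le _ _).trans_eq' ?_
      rw [← map_add, add_sub_cancel]
    calc ‖Q (S t (u 0))‖ ^ 2 ≤ (‖Q (u t)‖ + ‖Q (S t (u 0) - u t)‖) ^ 2 := by gcongr
      _ ≤ 2 * ‖Q (u t)‖ ^ 2 + 2 * ‖Q (S t (u 0) - u t)‖ ^ 2 := by
        nlinarith [sq_nonneg (‖Q (u t)‖ - ‖Q (S t (u 0) - u t)‖)]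
      _ ≤ _ := by gcongr
  have h1 := hobs _ ((hS.isMildSolution (u 0)).isWeakSolution hA hS)
  rw [hS.zero] at h1
  have h2 := intervalIntegral.integral_mono_on (a := 0) (b := T) (μ := volume) hT.le
    (hφ2.intervalIntegrable _ _)
    ((by fun_prop : Continuous fun t => 2 * ‖Q (u t)‖ ^ 2 + 2 * (‖Q‖ ^ 4 * (T * J))).intervalIntegrable
      _ _) hdiff
  rw [intervalIntegral.integral_add ((hq2.const_mul 2).intervalIntegrable _ _)
    (_root_.intervalIntegrable_const), intervalIntegral.integral_const,
    intervalIntegral.integral_const_mul, sub_zero, smul_eq_mul] at h2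
  rw [intervalIntegral.integral_add (hq2.intervalIntegrable _ _)
    (hp2.intervalIntegrable _ _)]
  have hJ : 0 ≤ J := intervalIntegral.integral_nonneg hT.le fun s _ => sq_nonneg _
  have hI : 0 ≤ ∫ t in (0 : ℝ)..T, ‖Q (u t)‖ ^ 2 :=
    intervalIntegral.integral_nonneg hT.le fun s _ => sq_nonneg _
  set I := ∫ t in (0 : ℝ)..T, ‖Q (u t)‖ ^ 2
  have h3 : 0 ≤ T ^ 2 * ‖Q‖ ^ 4 * I := by positivity
  have h4 : CT * ‖u 0‖ ^ 2 ≤ 2 * I + T * (2 * (‖Q‖ ^ 4 * (T * J))) := h1.trans h2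
  rw [energy]
  nlinarith

theorem IsMildSolution.integral_dissipation (hS : IsUnitaryGroup A S) {G : X → X}
    (hG : Continuous G) (hT : 0 < T) {u : ℝ → X} (huc : Continuous u)
    (hu : IsMildSolution S G u) :
    ∫ t in (0 : ℝ)..T, RCLike.re (inner 𝕜 (u t) (G (u t))) = energy u 0 - energy u T := by
  have hc : Continuous fun t => RCLike.re (inner 𝕜 (u t) (G (u t))) :=
    RCLike.continuous_re.comp (huc.inner (hG.comp huc))
  have h := intervalIntegral.integral_eq_sub_of_hasDerivAt_of_le hT.le
    ((huc.norm.pow 2).continuousOn)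
    (fun t ht => (hS.hasDerivWithinAt_norm_sq (hu.hasDeriv t ht.1.le)).hasDerivAt
      (Ici_mem_nhds ht.1)) ((hc.const_mul _).intervalIntegrable _ _)
  rw [intervalIntegral.integral_const_mul] at h
  simp only [Pi.pow_apply] at h
  rw [energy, energy]
  linarith

end Energy

theorem theorem1 {𝕜 : Type*} [RCLike 𝕜]
    -- the comparison function `g` and the comparison constants
    (g : ℝ → ℝ) (s₀ c₁ c₂ : ℝ) (hg : IsProfile g s₀) (hc₁ : 0 < c₁) (hc₂ : 0 < c₂) :
    -- the implied constants, which depend on `g`, `s₀`, `c₁`, `c₂` only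
    ∃ C κ₁ κ₂ γ₃ : ℝ, 0 < C ∧ 0 < κ₁ ∧ 0 < κ₂ ∧ 0 < γ₃ ∧
    ∀ (X : Type*) [NormedAddCommGroup X] [InnerProductSpace 𝕜 X] [CompleteSpace X]
      [NormedSpace ℝ X] [IsScalarTower ℝ 𝕜 X]
      (Ω : Type*) [MeasurableSpace Ω] (μ : Measure Ω) [IsProbabilityMeasure μ]
      (A : X →ₗ.[𝕜] X) (B : X →L[𝕜] X) (F : X → X)
      (b : Ω → ℝ) (U : Lp 𝕜 2 μ ≃ₗᵢ[𝕜] X) (T CT : ℝ),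
      IsSkewAdjoint A →
      B ≠ 0 → B.IsPositive →
      LipschitzOnBounded F →
      (∀ x : X, 0 ≤ inner 𝕜 x (B (F x))) →
      IsMultiplicationRepresentation B μ b U →
      pullback U F 0 = 0 →
      (∀ f : Lp 𝕜 2 μ, ∀ᵐ x ∂μ, 0 ≤ (starRingEnd 𝕜) (f x) * pullback U F f x) →
      IsComparable g c₁ c₂ (pullback U F) →
      0 < T → 0 < CT → IsObservable A B T CT →
      -- global well-posedness, and regularity for initial data in the domain
      (∀ u₀ : X, ∃ u : ℝ → X, u 0 = u₀ ∧ IsWeakSolution A (fun x => B (F x)) u ∧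
        (∀ v : ℝ → X, v 0 = u₀ → IsWeakSolution A (fun x => B (F x)) v → EqOn v u (Ici 0)) ∧
        (u₀ ∈ A.domain → IsStrongSolution A (fun x => B (F x)) u)) ∧
      -- decay of the energy
      (∀ γ₁ γ₂ : ℝ, γ₂ = κ₂ * (CT / (T ^ 3 * ‖posSqrt B‖ ^ 4 + T)) → γ₁ = κ₁ * (‖B‖ / γ₂) →
        ∀ u : ℝ → X, IsWeakSolution A (fun x => B (F x)) u →
          (∀ t : ℝ, 0 ≤ t →
            energy u t ≤ C * max 1 T * max γ₁ (energy u 0) *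
              Lfun g s₀ (1 / psiInv g s₀ (γ₂ * t))) ∧
          (limsup (LambdaH g) (𝓝[>] 0) < 1 →
            ∀ t : ℝ, 0 < t →
              energy u t ≤ C * max 1 T * max γ₁ (energy u 0) *
                HderivInv g s₀ (γ₃ / (γ₂ * t)))) := by
  obtain ⟨C₃, C₄, hC₃, hC₄, hpt⟩ := hg.exists_pointwise hc₁ hc₂
  set R := deriv (Hfun g) (s₀ ^ 2) with hRdef
  have hR : 0 < R := hg.slope_pos
  set ℓ := Lfun g s₀ R
  have hℓ : 0 < ℓ := hg.Lfun_pos ⟨hR, le_rfl⟩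
  obtain ⟨γ₃, hγ₃, hγ₃'⟩ : ∃ γ₃ : ℝ, 0 < γ₃ ∧ (limsup (LambdaH g) (𝓝[>] 0) < 1 →
      ∀ τ, 0 < τ → 1 / psiInv g s₀ τ ≤ γ₃ / τ) := by
    by_cases h : limsup (LambdaH g) (𝓝[>] 0) < 1
    · obtain ⟨γ, hγ, hγ'⟩ := hg.exists_one_div_psiInv_le h
      exact ⟨γ, hγ, fun _ => hγ'⟩
    · exact ⟨1, one_pos, fun h' => absurd h' h⟩
  have hC₄0 : 0 < C₄ := by linarith
  set κ₂ := 1 / (2 * C₄ * (1 + R)) with hκ₂def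
  have hκ₂ : 0 < κ₂ := by positivity
  refine ⟨2 / ℓ, 2 * C₃ * κ₂ * ℓ, κ₂, γ₃, by positivity, by positivity, hκ₂, hγ₃, ?_⟩
  intro X _ _ _ _ _ Ω _ μ _ A B F b U T CT hA hB0 _ hF haccF hB _ hsign hcomp hT hCT hobs
  obtain ⟨S, hS⟩ := hA.exists_unitaryGroup
  set G : X → X := fun x => B (F x) with hGdef
  have hG : LipschitzOnBounded G := fun r => by
    obtain ⟨K, hK⟩ := hF r
    exact ⟨_, B.lipschitz.comp_lipschitzOnWith hK⟩
  have hacc : ∀ x, 0 ≤ RCLike.re (inner 𝕜 x (G x)) := fun x => (RCLike.nonneg_iff.1 (haccF x)).1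
  have hFc : Continuous F := hF.continuous
  refine ⟨fun u₀ => ?_, fun γ₁ γ₂ hγ₂ hγ₁ u hu => ?_⟩
  · obtain ⟨u, hu0, hu⟩ := exists_isMildSolution hS hG hacc u₀
    exact ⟨u, hu0, hu.isWeakSolution hA hS, fun v hv0 hv =>
      (hv.isMildSolution hA hS hG.continuous).unique hS hG hacc hu (hv0.trans hu0.symm),
      fun h => hu.isStrongSolution hA hS hG hacc (hu0 ▸ h)⟩
  -- replace `u` by a function that is continuous on the whole line
  obtain ⟨w, hwc, hw, hwu⟩ : ∃ w : ℝ → X, Continuous w ∧ IsMildSolution S G w ∧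
      ∀ t, 0 ≤ t → w t = u t :=
    ⟨fun t => u (max t 0), hu.continuousOn.comp_max_zero,
      (hu.isMildSolution hA hS hG.continuous).congr fun t ht => by
        simp only [max_eq_left (mem_Ici.1 ht)], fun t ht => by simp only [max_eq_left ht]⟩
  have hEw : ∀ t, 0 ≤ t → energy w t = energy u t := fun t ht => by rw [energy, energy, hwu t ht]
  set N := ‖posSqrt B‖
  set K := T ^ 2 * N ^ 4 + 1 with hK
  have hK0 : 0 < K := by positivity
  have hγ₂' : γ₂ * T = κ₂ * CT / K := by
    rw [hγ₂, hK]; field_simp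
  have hγ₂0 : 0 < γ₂ := by rw [hγ₂]; positivity
  have hδ0 : 0 < γ₂ * T := by positivity
  have hγ₁0 : 0 ≤ γ₁ := by rw [hγ₁]; positivity
  have hEanti : AntitoneOn (energy w) (Ici 0) := fun s hs t ht hst => by
    have := hw.antitoneOn_norm hS hacc hs ht hst
    simp only at this
    rw [energy, energy]
    gcongr
  have hκR : κ₂ * R ≤ 1 / 2 := by
    rw [hκ₂def, div_mul_eq_mul_div, one_mul, div_le_div_iff₀ (by positivity) two_pos]
    nlinarith
  -- since `CT ≤ T ‖B^{1/2}‖²`, the dimensionless number `γ₂ T` is at most `κ₂ / 2`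
  have hsmall : γ₂ * T * R ≤ 1 / 4 := by
    have h1 := hobs.le_mul_norm_sq hA hS hT hB0
    have h2 : CT ≤ K / 2 := by
      rw [hK]; nlinarith [sq_nonneg (T * N ^ 2 - 1)]
    have h3 : γ₂ * T ≤ κ₂ / 2 := by
      rw [hγ₂', div_le_iff₀ hK0]
      nlinarith
    nlinarith
  set m := max γ₁ (energy w 0)
  have hm0 : 0 ≤ m := hγ₁0.trans (le_max_left _ _)
  set β := m / ℓ with hβ
  have hβ0 : 0 ≤ β := by positivity
  have hdecay : ∀ t, 0 ≤ t → energy w t ≤ 2 * β * Lfun g s₀ (1 / psiInv g s₀ (γ₂ * t)) := by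
    intro t ht
    refine hg.energy_decay hEanti hT hγ₂0 hβ0 hsmall ?_ (fun n r hr => ?_) ht
    · rw [hβ, div_mul_cancel₀ _ hℓ.ne']
      exact le_max_right _ _
    set z : ℝ → X := fun t => w (t + n * T) with hz
    have hzc : Continuous z := hwc.comp (by fun_prop)
    have hzm : IsMildSolution S G z := hw.shift hS (by positivity)
    have hz0 : energy z 0 = energy w (n * T) := by simp only [energy, hz, zero_add]
    have hzT : energy z T = energy w ((n + 1 : ℕ) * T) := by
      have : T + n * T = (n + 1 : ℕ) * T := by push_cast; ring
      simp only [energy, hz, this]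
    have h1 := hobs.energy_le hA hS hB hFc hT hzc hzm
    have h2 := hzm.integral_dissipation hS hG.continuous hT hzc
    have hQc := (posSqrt B).continuous
    have c1 : Continuous fun t => ‖posSqrt B (z t)‖ ^ 2 + ‖posSqrt B (F (z t))‖ ^ 2 :=
      ((hQc.comp hzc).norm.pow 2).add ((hQc.comp (hFc.comp hzc)).norm.pow 2)
    have c2 : Continuous fun t => RCLike.re (inner 𝕜 (z t) (G (z t))) :=
      RCLike.continuous_re.comp (hzc.inner (hG.continuous.comp hzc))
    have h3 := intervalIntegral.integral_mono_on (a := 0) (b := T) (μ := volume) hT.le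
      ((c1.const_mul r).intervalIntegrable _ _)
      ((by fun_prop : Continuous fun t => C₃ * ‖B‖ * HhatConj g s₀ r +
        C₄ * (1 + r) * RCLike.re (inner 𝕜 (z t) (G (z t)))).intervalIntegrable _ _)
      (fun t _ => weighted_energy_le hg hC₃ hpt hB hFc hsign hcomp hr.1.le (z t))
    rw [intervalIntegral.integral_const_mul, intervalIntegral.integral_add
      _root_.intervalIntegrable_const ((c2.const_mul _).intervalIntegrable _ _),
      intervalIntegral.integral_const, intervalIntegral.integral_const_mul, h2, sub_zero,
      smul_eq_mul] at h3
    rw [hz0] at h1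
    rw [hz0, hzT] at h3
    have hloss : 0 ≤ energy w (n * T) - energy w ((n + 1 : ℕ) * T) := sub_nonneg.2
      (hEanti (mem_Ici.2 (by positivity)) (mem_Ici.2 (by positivity))
        (by push_cast; nlinarith))
    set E₀ := energy w (n * T)
    set E₁ := energy w ((n + 1 : ℕ) * T)
    set I := ∫ t in (0 : ℝ)..T, (‖posSqrt B (z t)‖ ^ 2 + ‖posSqrt B (F (z t))‖ ^ 2)
    have hL : HhatConj g s₀ r = r * Lfun g s₀ r := by
      have := hr.1
      rw [IsProfile.Lfun_eq hr.1]; field_simp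
    have hLpos := hg.Lfun_pos hr
    have hr0 := hr.1
    -- multiply by `2 κ₂ r / K`; by the choice of `κ₂`, `2 κ₂ C₄ (1 + r) ≤ 1`
    have h4 : 2 * (γ₂ * T) * r * E₀ ≤ 2 * κ₂ * (r * I) := by
      have : 2 * (γ₂ * T) * r * E₀ = 2 * κ₂ * r / K * (CT * E₀) := by rw [hγ₂']; ring
      rw [this]
      calc 2 * κ₂ * r / K * (CT * E₀) ≤ 2 * κ₂ * r / K * (K * I) := by gcongr
        _ = 2 * κ₂ * (r * I) := by field_simp
    have h5 : 2 * κ₂ * (C₄ * (1 + r)) ≤ 1 := by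
      have : 2 * κ₂ * (C₄ * (1 + r)) ≤ 2 * κ₂ * (C₄ * (1 + R)) := by
        gcongr; exact hr.2
      refine this.trans_eq ?_
      rw [hκ₂def]; field_simp
    -- by the choice of `κ₁`, the error term is absorbed by `β ≥ γ₁ / ℓ`
    have h6 : 2 * κ₂ * (C₃ * ‖B‖) * T ≤ γ₂ * T * β := by
      have h7 : 2 * κ₂ * (C₃ * ‖B‖) * T = γ₂ * T * (γ₁ / ℓ) := by
        rw [hγ₁]; field_simp
      rw [h7, hβ]
      gcongr
      exact le_max_left _ _
    have h8 : 2 * κ₂ * (r * I) ≤ 2 * κ₂ * (T * (C₃ * ‖B‖ * HhatConj g s₀ r) +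
        C₄ * (1 + r) * (E₀ - E₁)) := by gcongr
    have h9 : 2 * κ₂ * (C₃ * ‖B‖) * T * (r * Lfun g s₀ r) ≤
        γ₂ * T * β * (r * Lfun g s₀ r) := by gcongr
    have h10 : 2 * κ₂ * (C₄ * (1 + r)) * (E₀ - E₁) ≤ 1 * (E₀ - E₁) := by gcongr
    rw [hL] at h8
    linarith
  have hmu : m = max γ₁ (energy u 0) := by rw [← hEw 0 le_rfl]
  have hfirst : ∀ t, 0 ≤ t → energy u t ≤ 2 / ℓ * max 1 T * max γ₁ (energy u 0) *
      Lfun g s₀ (1 / psiInv g s₀ (γ₂ * t)) := by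
    intro t ht
    have hLpos := hg.Lfun_pos (hg.one_div_psiInv_mem (γ₂ * t))
    rw [← hEw t ht, ← hmu]
    calc energy w t ≤ 2 * β * Lfun g s₀ (1 / psiInv g s₀ (γ₂ * t)) := hdecay t ht
      _ = 2 / ℓ * 1 * m * Lfun g s₀ (1 / psiInv g s₀ (γ₂ * t)) := by rw [hβ]; ring
      _ ≤ _ := by gcongr; exact le_max_left _ _
  refine ⟨hfirst, fun hlim t ht => (hfirst t ht.le).trans ?_⟩
  have hr := hg.one_div_psiInv_mem (γ₂ * t)
  have h1 := (hg.Lfun_le_HderivInv hr).trans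
    (hg.HderivInv_mono hr.1.le (hγ₃' hlim (γ₂ * t) (by positivity)))
  rw [← hmu]
  gcongr
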